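/- **Setting.** Let $\mathcal X,\mathcal V$ be finite sets. There are $N\ge1$ experts, expert $i$ being given by distributions $\pi_i(\cdot|x)$ on $\mathcal V$, $x\in\mathcal X$, and $E\ge1$ episodes of $T\ge1$ steps. In episode $e$, if expert $i$ is played, the context, action and reward $(X,V,Y)$ have law $p_e(x)\pi_i(v|x)q_e(dy|v,x)$, with $Y\in[0,1]$ and mean $\mu_{i,e}=\mathbb E_{i,e}[Y]$; put $\mu_e^*=\max_i\mu_{i,e}$, and let $0=\Delta_{1,e}\le\Delta_{2,e}\le\dots\le\Delta_{N,e}$ be the gaps $\mu_e^*-\mu_{i,e}$ in increasing order. The agent knows $p_X,p_V,\gamma>0$ with $p_X\le p_e(x)$, $p_V\le\pi_i(v|x)$, $\gamma\le\mu_{i,e}$ for all $e,i,x,v$. The regret is $R(E,T)=\sum_{e=1}^E\sum_{t=1}^T(\mu_e^*-\mu_{k_{t,e},e})$, where $k_{t,e}$ is the expert played. **Constants.** $f_1(x)=xe^{x-1}-1$; for $x>0$, $w(x)=y$ iff $y\in(0,2)$ and $y/\log(2/y)=x$, and $w(0)=0$; $\rho=\frac{1-p_V}{p_V}$; $M$ is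 any number with $M\ge1+\log(1+f_1(\rho))$ and $M\ge(1-p_X)|\mathcal X||\mathcal V|f_1(\rho)$; $C=\frac{32M}{\gamma(1-p_V)}$; $\xi=\frac{2}{p_V\gamma}\bigl(\sqrt{1+p_V^4\gamma^2/4}-1\bigr)$, i.e. the positive root of $\frac{\xi}{p_V}\bigl(\frac1{p_V-\xi}+\frac1{p_V+\xi}\bigr)=\frac{\gamma p_V}2$; $n=2|\mathcal V|\log(2T)/\xi^2$; $A=\bigl\lceil\frac{2n}{p_X}+\frac{\log(|\mathcal X|NT\sqrt E)}{2p_X^2}\bigr\rceil$. **Algorithm.** In the first $AN$ of the $ET$ steps every expert is played $A$ times, and $\hat\pi_i(v|x)$ is the resulting empirical frequency of $v$ among the plays of $i$ with context $x$. From then on, in each episode a fresh instance of ED-UCB with input $\hat\pi$ is run (starting at the first step of the episode after the sampling phase): after $t\ge1$ steps of the instance, in which $k_1,\dots,k_t$ were played and $(X_s,V_s,Y_s)$ observed, it plays an expert maximizing $$U_i(t)=\tilde Y_i(t)+\tfrac32\epsilon_i(t)+e_i(t);$$ its first choice is arbitrary. Ties and this first choice are resolved on the basis of the past and independent randomness.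 Here $\hat r_{ij}=\hat\pi_i/\hat\pi_j$, $\underline r_{ij}=\hat r_{ij}-\frac{\xi}{p_V(p_V-\xi)}$, $\overline r_{ij}=\hat r_{ij}+\frac{\xi}{p_V(p_V+\xi)}$, $\underline M_{ij}=1+\log\bigl(1+p_X\sum_{x,v}(\hat\pi_i(v|x)-\xi)f_1(\underline r_{ij}(v|x))\bigr)$, $Z_i(t)=\sum_{s\le t}\underline M_{ik_s}^{-1}$, $\epsilon_i(t)=C\,w\bigl(\sqrt{t\log t}/Z_i(t)\bigr)$, and with $\mathbf 1_{ij,t}(v|x)$ the indicator of $\overline r_{ij}(v|x)\le2\log(2/\epsilon_i(t))\underline M_{ij}$ (equal to $1$ when $\epsilon_i(t)=0$), $$\tilde Y_i(t)=\frac1{Z_i(t)}\sum_{s\le t}\frac{Y_s}{\underline M_{ik_s}}\,\underline r_{ik_s}(V_s|X_s)\,\mathbf 1_{ik_s,t}(V_s|X_s),\qquad e_i(t)=\max_{j,x,v}\bigl(\overline r_{ij}(v|x)-\underline r_{ij}(v|x)\mathbf 1_{ij,t}(v|x)\bigr).$$ **Times.** $T_{clip}$ is the first time from which on all indicators $\mathbf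 1_{ij,t}(v|x)$ equal $1$, for every sequence of plays and every family of distributions $\hat\pi_i(\cdot|x)$ with $\|\hat\pi_i(\cdot|x)-\pi_i(\cdot|x)\|_\infty\le\xi$ for all $i,x$; $\tau_1=\min\{t\ge2:C\,w(\sqrt{\log t/t})\le\gamma\}$; $\tau(\Delta)=\min\Bigl\{t\ge2:\frac t{\log t}\ge\frac{9C^2M^2\log^2(6C/(\Delta-\gamma p_V))}{(\Delta-\gamma p_V)^2}\Bigr\}$; $T_{k,e}=\max\{T_{clip},\tau_1,\tau(\Delta_{k,e})\}$. Put $$R(\mathbf\Delta_e)=\frac{\pi^2}3\sum_{k=2}^N\Delta_{k,e}+T_{N,e}\Delta_{N,e}+\sum_{k=2}^{N-1}(T_{k,e}-T_{k+1,e})\Delta_{k,e}.$$ **Theorem 4.** Suppose that, in every episode, the best expert is unique and $\Delta_{2,e}>\gamma p_V$, and that $T\ge T_{2,e}$ (both void if $N=1$). Then the expected regret of the online process is at most $AN$ plus the bound for the bootstrapped agent: $$\mathbb E[R(E,T)]\le AN+\sqrt E+E+\Bigl(\sum_{e=1}^ER(\mathbf\Delta_e)\Bigr)\Bigl(1+\frac1{T^2\sqrt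 E}\Bigr).$$ Moreover, for every $g>0$ there is a constant $K$, depending only on $\mathcal X,\mathcal V,p_X,p_V,\gamma,M$ and $g$, such that if in addition $\Delta_{2,e}\ge\gamma p_V+g$ for all $e$, then $$\mathbb E[R(E,T)]\le K\Bigl(N\log(NT^2\sqrt E)+E(N+1)+\frac{N\sqrt E}{T^2}\Bigr).$$ -/

import Mathlib

open MeasureTheory

universe u₁ u₂ u₃

namespace EDUCB

noncomputable section

/-- An episodic bandit with stochastic experts on finite context and action sets: the context
distributions `p_e`, the expert policies `π_i(·|x)` (the same in all episodes) and the reward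
distributions `q_e(·|x, v)` on `[0, 1]`. -/
structure Bandit (X V : Type*) [Fintype X] [Fintype V] (N E : ℕ) where
  ctx : Fin E → X → ℝ
  pol : Fin N → X → V → ℝ
  rew : Fin E → X → V → Measure ℝ
  ctx_mem : ∀ e, ctx e ∈ stdSimplex ℝ X
  pol_mem : ∀ i x, pol i x ∈ stdSimplex ℝ V
  rew_prob : ∀ e x v, IsProbabilityMeasure (rew e x v)
  rew_supp : ∀ e x v, ∀ᵐ y ∂(rew e x v), y ∈ Set.Icc (0 : ℝ) 1

/-- The numbers the agent is given: `p_X`, `p_V`, `γ` and the divergence bound `M`. -/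
structure Params where
  pX : ℝ
  pV : ℝ
  γ : ℝ
  M : ℝ

section Model

variable {X V : Type*} [Fintype X] [Fintype V] {N E : ℕ}

/-- `μ_{i,e}`, the mean reward of expert `i` in episode `e`. -/
def Bandit.mean (I : Bandit X V N E) (e : Fin E) (i : Fin N) : ℝ :=
  ∑ x, I.ctx e x * ∑ v, I.pol i x v * ∫ y, y ∂(I.rew e x v)

/-- `μ*_e`, the mean reward of the best expert in episode `e`. -/
def Bandit.best (I : Bandit X V N E) (e : Fin E) : ℝ := ⨆ i, I.mean e i

/-- The suboptimality gap of expert `i` in episode `e`. -/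
def Bandit.gap (I : Bandit X V N E) (e : Fin E) (i : Fin N) : ℝ := I.best e - I.mean e i

/-- The three lower bounds on context probabilities, action probabilities and mean rewards. -/
structure Bandit.Bounded (I : Bandit X V N E) (b : Params) : Prop where
  ctx_le : ∀ e x, b.pX ≤ I.ctx e x
  pol_le : ∀ i x v, b.pV ≤ I.pol i x v
  mean_le : ∀ e i, b.γ ≤ I.mean e i

end Model

/-! ### The ED-UCB index -/

/-- `f₁(x) = x exp(x - 1) - 1`. -/
def f₁ (x : ℝ) : ℝ := x * Real.exp (x - 1) - 1

/-- The function `w` given by `w(x) = y ↔ y / log(2 / y) = x` with `0 < y < 2`, for `x > 0`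
(there is exactly one such `y`); `w(0) = 0`. -/
def w (x : ℝ) : ℝ := sSup {y : ℝ | 0 < y ∧ y < 2 ∧ y / Real.log (2 / y) = x}

/-- The accuracy `ξ`: the positive solution of
`ξ / p_V * (1 / (p_V - ξ) + 1 / (p_V + ξ)) = γ p_V / 2`. -/
def Params.ξ (b : Params) : ℝ :=
  2 * (√(1 + b.pV ^ 4 * b.γ ^ 2 / 4) - 1) / (b.pV * b.γ)

/-- The constant `C = 32 M / (γ (1 - p_V))`. -/
def Params.C (b : Params) : ℝ := 32 * b.M / (b.γ * (1 - b.pV))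

section Index

variable {X V : Type*} [Fintype X] [Fintype V] {N : ℕ}

/-- Estimated importance sampling ratio `π̂_i(v|x) / π̂_j(v|x)`. -/
def rHat (ph : Fin N → X → V → ℝ) (i j : Fin N) (x : X) (v : V) : ℝ := ph i x v / ph j x v

/-- Lower confidence value of the ratio. -/
def rLow (b : Params) (ph : Fin N → X → V → ℝ) (i j : Fin N) (x : X) (v : V) : ℝ :=
  rHat ph i j x v - b.ξ / (b.pV * (b.pV - b.ξ))

/-- Upper confidence value of the ratio. -/
def rUp (b : Params) (ph : Fin N → X → V → ℝ) (i j : Fin N) (x : X) (v : V) : ℝ :=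
  rHat ph i j x v + b.ξ / (b.pV * (b.pV + b.ξ))

/-- The divergence estimate `D̲_{f₁}(i‖j)`. -/
def DLow (b : Params) (ph : Fin N → X → V → ℝ) (i j : Fin N) : ℝ :=
  b.pX * ∑ x, ∑ v, (ph i x v - b.ξ) * f₁ (rLow b ph i j x v)

/-- `M̲_{ij} = 1 + log(1 + D̲_{f₁}(i‖j))`. -/
def MLow (b : Params) (ph : Fin N → X → V → ℝ) (i j : Fin N) : ℝ :=
  1 + Real.log (1 + DLow b ph i j)

/-- The normalizing factor `Z_i(t)`; `ks s` is the expert played at the `(s+1)`-th step. -/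
def Z (b : Params) (ph : Fin N → X → V → ℝ) (ks : ℕ → Fin N) (t : ℕ) (i : Fin N) : ℝ :=
  ∑ s ∈ Finset.range t, (MLow b ph i (ks s))⁻¹

/-- `ε_i(t) = C w(√(t log t) / Z_i(t))`. -/
def eps (b : Params) (ph : Fin N → X → V → ℝ) (ks : ℕ → Fin N) (t : ℕ) (i : Fin N) : ℝ :=
  b.C * w (√(t * Real.log t) / Z b ph ks t i)

/-- The condition `r̄_{ij}(v|x) ≤ 2 log(2 / ε_i(t)) M̲_{ij}` in the clippers. For `ε_i(t) = 0`
(at `t = 1`) the clipper level is infinite. -/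
def Unclipped (b : Params) (ph : Fin N → X → V → ℝ) (ks : ℕ → Fin N) (t : ℕ) (i j : Fin N)
    (x : X) (v : V) : Prop :=
  eps b ph ks t i = 0 ∨
    rUp b ph i j x v ≤ 2 * Real.log (2 / eps b ph ks t i) * MLow b ph i j

open Classical in
/-- The empirical clipped importance sampling estimator `Ỹ_i(t)`. -/
def Ytilde (b : Params) (ph : Fin N → X → V → ℝ) (ks : ℕ → Fin N) (xs : ℕ → X) (vs : ℕ → V)
    (ys : ℕ → ℝ) (t : ℕ) (i : Fin N) : ℝ :=
  (Z b ph ks t i)⁻¹ * ∑ s ∈ Finset.range t,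
    ys s / MLow b ph i (ks s) * rLow b ph i (ks s) (xs s) (vs s) *
      (if Unclipped b ph ks t i (ks s) (xs s) (vs s) then 1 else 0)

open Classical in
/-- The maximal deviation `e_i(t)` of the estimator. -/
def err (b : Params) (ph : Fin N → X → V → ℝ) (ks : ℕ → Fin N) (t : ℕ) (i : Fin N) : ℝ :=
  ⨆ a : Fin N × X × V, (rUp b ph i a.1 a.2.1 a.2.2 -
    rLow b ph i a.1 a.2.1 a.2.2 *
      (if Unclipped b ph ks t i a.1 a.2.1 a.2.2 then 1 else 0))

/-- The ED-UCB index `U_i(t)` after `t ≥ 1` steps. -/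
def U (b : Params) (ph : Fin N → X → V → ℝ) (ks : ℕ → Fin N) (xs : ℕ → X) (vs : ℕ → V)
    (ys : ℕ → ℝ) (t : ℕ) (i : Fin N) : ℝ :=
  Ytilde b ph ks xs vs ys t i + 3 / 2 * eps b ph ks t i + err b ph ks t i

/-- `π̂` consists of probability vectors that are uniformly `ξ`-close to the policies `π`. -/
def Accurate (b : Params) (π ph : Fin N → X → V → ℝ) : Prop :=
  ∀ i x, ph i x ∈ stdSimplex ℝ V ∧ ∀ v, |ph i x v - π i x v| ≤ b.ξ

/-- `T_clip`, the time from which on all clippers are inactive, whatever the experts played and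
whatever the `ξ`-accurate estimates in use. -/
def tClip (b : Params) (π : Fin N → X → V → ℝ) : ℕ :=
  sInf {t₀ : ℕ | ∀ t ≥ t₀, ∀ ph, Accurate b π ph → ∀ (ks : ℕ → Fin N) (i j : Fin N) (x : X)
    (v : V), Unclipped b ph ks t i j x v}

end Index

/-! ### The problem-dependent times and the single-episode regret constant -/

/-- `τ₁`, the first time with `C w(√(log t / t)) ≤ γ` (`t = 1`, where `log t = 0`, is left
out). -/
def tau₁ (b : Params) : ℕ := sInf {t : ℕ | 2 ≤ t ∧ b.C * w √(Real.log t / t) ≤ b.γ}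

/-- `τ_k` for an expert with gap `Δ`. -/
def tau (b : Params) (Δ : ℝ) : ℕ :=
  sInf {t : ℕ | 2 ≤ t ∧
    9 * b.C ^ 2 * b.M ^ 2 * Real.log (6 * b.C / (Δ - b.γ * b.pV)) ^ 2 / (Δ - b.γ * b.pV) ^ 2
      ≤ t / Real.log t}

section Constants

variable {X V : Type*} [Fintype X] [Fintype V] {N E : ℕ}

/-- `T_k = max {T_clip, τ₁, τ_k}` for an expert with gap `Δ`. -/
def time (b : Params) (I : Bandit X V N E) (Δ : ℝ) : ℕ :=
  max (max (tClip b I.pol) (tau₁ b)) (tau b Δ)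

/-- The gaps of episode `e` in increasing order, `0 = Δ_1 ≤ Δ_2 ≤ … ≤ Δ_N`
(`sortedGap I e k` is `Δ_k`, for `1 ≤ k ≤ N`). -/
def sortedGap (I : Bandit X V N E) (e : Fin E) (k : ℕ) : ℝ :=
  if h : k - 1 < N then I.gap e (Tuple.sort (I.gap e) ⟨k - 1, h⟩) else 0

/-- `R(Δ_e) = π²/3 ∑_{k=2}^N Δ_k + T_N Δ_N + ∑_{k=2}^{N-1} (T_k - T_{k+1}) Δ_k`. -/
def regretConst (b : Params) (I : Bandit X V N E) (e : Fin E) : ℝ :=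
  Real.pi ^ 2 / 3 * ∑ k ∈ Finset.Icc 2 N, sortedGap I e k
    + time b I (sortedGap I e N) * sortedGap I e N
    + ∑ k ∈ Finset.Icc 2 (N - 1),
        ((time b I (sortedGap I e k) : ℝ) - time b I (sortedGap I e (k + 1))) * sortedGap I e k

end Constants

/-! ### The online process -/

/-- `n = 2 |V| log(2T) / ξ²`. -/
def nSamples (b : Params) (cardV T : ℕ) : ℝ := 2 * cardV * Real.log (2 * T) / b.ξ ^ 2

/-- `A = 2n / p_X + log(|X| N T √E) / (2 p_X²)`, rounded up. -/
def A (b : Params) (cardX cardV N E T : ℕ) : ℕ :=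
  ⌈2 * nSamples b cardV T / b.pX
    + Real.log (cardX * N * T * √E) / (2 * b.pX ^ 2)⌉₊

/-- The empirical policies from the first `m` steps. -/
def empirical {X V : Type*} [DecidableEq X] [DecidableEq V] {N : ℕ} (m : ℕ)
    (ks : ℕ → Fin N) (xs : ℕ → X) (vs : ℕ → V) (i : Fin N) (x : X) (v : V) : ℝ :=
  ((Finset.range m).filter fun s => ks s = i ∧ xs s = x ∧ vs s = v).card /
    ((Finset.range m).filter fun s => ks s = i ∧ xs s = x).card

/-- `(k, X, V, Y)` is a run of the online process over `E` episodes of `T` steps on the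
probability space `(Ω, P)`. Step `t` of episode `e` has number `e * T + t` (counting from `0`);
`F τ` is the information available before step `τ` (the past and possibly
additional randomness for breaking ties).
Every expert is played `m` times in the first `N * m` steps; afterwards a fresh instance of
ED-UCB, fed with the empirical policies of those first steps, is used in each episode. -/
structure IsOnlineRun {X V : Type*} [Fintype X] [Fintype V] [DecidableEq X] [DecidableEq V]
    {N E : ℕ} (b : Params) (I : Bandit X V N E) (T m : ℕ) {Ω : Type*} [mΩ : MeasurableSpace Ω]
    (P : Measure Ω) (F : Filtration ℕ mΩ)
    (k : ℕ → Ω → Fin N) (x : ℕ → Ω → X) (v : ℕ → Ω → V) (y : ℕ → Ω → ℝ) : Prop where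
  /-- the choice at step `τ` is made on the basis of `F τ` -/
  choice_meas : ∀ τ i, MeasurableSet[F τ] {ω | k τ ω = i}
  ctx_meas : ∀ τ s, s < τ → ∀ a, MeasurableSet[F τ] {ω | x s ω = a}
  act_meas : ∀ τ s, s < τ → ∀ a, MeasurableSet[F τ] {ω | v s ω = a}
  rew_meas : ∀ τ s, s < τ → Measurable[F τ] (y s)
  /-- given `F τ`, the context, action and reward of step `τ` in episode `e` have the law
  `p_e(x) π_{k_τ}(v|x) q_e(dy|x, v)` -/
  law : ∀ (e : Fin E) (t : ℕ), t < T → ∀ G, MeasurableSet[F (e * T + t)] G →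
    ∀ (i : Fin N) (a : X) (c : V) (B : Set ℝ), MeasurableSet B →
      P (G ∩ {ω | k (e * T + t) ω = i ∧ x (e * T + t) ω = a ∧ v (e * T + t) ω = c ∧
          y (e * T + t) ω ∈ B})
        = P (G ∩ {ω | k (e * T + t) ω = i}) * ENNReal.ofReal (I.ctx e a * I.pol i a c)
          * I.rew e a c B
  /-- sampling phase: expert `0` for `m` steps, then expert `1` for `m` steps, and so on -/
  sampling : ∀ τ < N * m, ∀ ω, (k τ ω : ℕ) = τ / m
  /-- later on, an expert of maximal index is played (`U_i(0) = ∞`: no constraint at the first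
  step of an instance of ED-UCB); the instance of episode `e` starts at step `max (e T) (N m)` -/
  ucb : ∀ (e : Fin E) (t : ℕ), t < T → max (e * T) (N * m) < e * T + t → ∀ ω j,
    let s₀ := max (e * T) (N * m)
    let ph := empirical (N * m) (fun s => k s ω) (fun s => x s ω) (fun s => v s ω)
    let idx := U b ph (fun s => k (s₀ + s) ω) (fun s => x (s₀ + s) ω) (fun s => v (s₀ + s) ω)
      (fun s => y (s₀ + s) ω) (e * T + t - s₀)
    idx j ≤ idx (k (e * T + t) ω)

/-- The cumulative regret `R(T, E) = ∑_e ∑_t (μ*_e - μ_{k_t, e})`. -/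
def regret {X V : Type*} [Fintype X] [Fintype V] {N E : ℕ} (I : Bandit X V N E) (T : ℕ)
    {Ω : Type*} (k : ℕ → Ω → Fin N) (ω : Ω) : ℝ :=
  ∑ e : Fin E, ∑ t ∈ Finset.range T, (I.best e - I.mean e (k (e * T + t) ω))

end

end EDUCB

namespace EDUCB

/-! ### Parameters and ratio estimates -/

/-- Parameters that are consistent with at least two different experts. -/
structure Params.Admissible (b : Params) : Prop where
  pX_pos : 0 < b.pX
  pV_pos : 0 < b.pV
  pV_le : b.pV ≤ 1 / 2
  γ_pos : 0 < b.γ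
  γ_le : b.γ ≤ 1
  le_M : 1 + Real.log (1 + f₁ ((1 - b.pV) / b.pV)) ≤ b.M

namespace Params.Admissible

variable {b : Params} (hb : b.Admissible)
include hb

lemma one_le_ρ : 1 ≤ (1 - b.pV) / b.pV := by
  have := hb.pV_pos
  have := hb.pV_le
  rw [le_div_iff₀ hb.pV_pos]; linarith

lemma ρ_le_M : (1 - b.pV) / b.pV ≤ b.M := by
  have h1 := hb.one_le_ρ
  refine le_trans ?_ hb.le_M
  set ρ := (1 - b.pV) / b.pV
  have : 1 + f₁ ρ = ρ * Real.exp (ρ - 1) := by unfold f₁; ring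
  rw [this, Real.log_mul (by linarith) (Real.exp_pos _).ne', Real.log_exp]
  have := Real.log_nonneg h1
  linarith

lemma one_le_M : 1 ≤ b.M := hb.one_le_ρ.trans hb.ρ_le_M

lemma ξ_eq : 4 * b.ξ = b.γ * b.pV * (b.pV ^ 2 - b.ξ ^ 2) := by
  have h1 := hb.pV_pos
  have h2 := hb.γ_pos
  set s := √(1 + b.pV ^ 4 * b.γ ^ 2 / 4) with hs
  have hs2 : s ^ 2 = 1 + b.pV ^ 4 * b.γ ^ 2 / 4 := Real.sq_sqrt (by positivity)
  have hξ : b.ξ = 2 * (s - 1) / (b.pV * b.γ) := rfl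
  rw [hξ]
  field_simp
  linear_combination 4 * hs2

lemma ξ_pos : 0 < b.ξ := by
  have h1 := hb.pV_pos
  have h2 := hb.γ_pos
  have : 1 < √(1 + b.pV ^ 4 * b.γ ^ 2 / 4) := by
    rw [Real.lt_sqrt (by norm_num)]
    have : 0 < b.pV ^ 4 * b.γ ^ 2 / 4 := by positivity
    linarith
  unfold Params.ξ
  have : 0 < √(1 + b.pV ^ 4 * b.γ ^ 2 / 4) - 1 := by linarith
  positivity

lemma ξ_le : b.ξ ≤ b.γ * b.pV ^ 3 / 4 := by
  have h := hb.ξ_eq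
  have h1 := hb.pV_pos
  have h2 := hb.γ_pos
  have : 0 ≤ b.γ * b.pV * b.ξ ^ 2 := by positivity
  nlinarith

lemma ξ_le_pV : b.ξ ≤ b.pV / 16 := by
  have h := hb.ξ_le
  have h1 := hb.pV_pos
  have h3 := hb.pV_le
  have hp2 : b.pV ^ 2 ≤ 1 / 4 := by nlinarith
  have h4 : b.γ * b.pV ^ 3 ≤ 1 * b.pV ^ 3 := by
    gcongr; exact hb.γ_le
  have : b.pV ^ 3 ≤ b.pV * (1 / 4) := by
    have : b.pV ^ 3 = b.pV * b.pV ^ 2 := by ring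
    rw [this]; gcongr
  linarith

lemma ξ_lt_pV : b.ξ < b.pV := by
  have := hb.ξ_le_pV
  have := hb.pV_pos
  linarith

lemma widths_add :
    b.ξ / (b.pV * (b.pV - b.ξ)) + b.ξ / (b.pV * (b.pV + b.ξ)) = b.γ * b.pV / 2 := by
  have h := hb.ξ_eq
  have h1 := hb.pV_pos
  have h2 := hb.ξ_pos
  have h3 : b.pV - b.ξ ≠ 0 := (sub_pos.2 hb.ξ_lt_pV).ne'
  have h4 : b.pV + b.ξ ≠ 0 := by positivity
  field_simp
  linear_combination b.pV * h

lemma lowWidth_nonneg : 0 ≤ b.ξ / (b.pV * (b.pV - b.ξ)) :=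
  div_nonneg hb.ξ_pos.le (mul_nonneg hb.pV_pos.le (sub_nonneg.2 hb.ξ_lt_pV.le))

lemma lowWidth_le : b.ξ / (b.pV * (b.pV - b.ξ)) ≤ 2 / 15 := by
  have h := hb.ξ_le
  have h1 := hb.pV_pos
  have h2 := hb.ξ_le_pV
  have h3 := hb.pV_le
  have h4 := hb.γ_le
  have h5 := hb.γ_pos
  rw [div_le_iff₀ (mul_pos h1 (sub_pos.2 hb.ξ_lt_pV))]
  have : b.γ * b.pV ^ 3 ≤ b.pV ^ 2 * (1 / 2) := by
    have e : b.γ * b.pV ^ 3 = b.pV ^ 2 * (b.γ * b.pV) := by ring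
    have : b.γ * b.pV ≤ 1 * (1 / 2) := mul_le_mul h4 h3 h1.le zero_le_one
    rw [e]; gcongr; linarith
  nlinarith

lemma γ_mul_pV_le : b.γ * b.pV ≤ 1 / 2 := by
  have := mul_le_mul hb.γ_le hb.pV_le hb.pV_pos.le zero_le_one
  linarith

lemma γ_mul_pV_pos : 0 < b.γ * b.pV := mul_pos hb.γ_pos hb.pV_pos

lemma mul_M_le_C : 32 * b.M ≤ b.C := by
  have h1 := hb.pV_pos
  have h2 := hb.pV_le
  have h3 := hb.γ_pos
  have h4 := hb.γ_le
  have h5 := hb.one_le_M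
  unfold Params.C
  rw [le_div_iff₀ (mul_pos h3 (by linarith))]
  have : b.γ * (1 - b.pV) ≤ 1 * 1 := mul_le_mul h4 (by linarith) (by linarith) zero_le_one
  nlinarith

lemma C_ge : 32 ≤ b.C := by linarith [hb.mul_M_le_C, hb.one_le_M]

lemma C_pos : 0 < b.C := by linarith [hb.C_ge]

end Params.Admissible

lemma two_mul_sub_one_le_f₁ {x : ℝ} : 2 * (x - 1) ≤ f₁ x := by
  unfold f₁
  have h := Real.add_one_le_exp (x - 1)
  rcases le_total 0 x with hx | hx
  · nlinarith [sq_nonneg (x - 1)]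
  · have : Real.exp (x - 1) ≤ 1 := Real.exp_le_one_iff.2 (by linarith)
    nlinarith

lemma f₁_le_f₁ {x y : ℝ} (hxy : x ≤ y) (hy : 0 ≤ y) : f₁ x ≤ f₁ y := by
  unfold f₁
  rcases le_total 0 x with hx | hx
  · gcongr
  · have : x * Real.exp (x - 1) ≤ 0 := mul_nonpos_of_nonpos_of_nonneg hx (Real.exp_pos _).le
    have : 0 ≤ y * Real.exp (y - 1) := by positivity
    linarith

/-- Policies bounded away from `0` and `1`. -/
structure PolicyBounds {X V : Type*} [Fintype X] [Fintype V] {N : ℕ} (b : Params)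
    (π : Fin N → X → V → ℝ) : Prop where
  mem : ∀ i x, π i x ∈ stdSimplex ℝ V
  ge : ∀ i x v, b.pV ≤ π i x v
  le : ∀ i x v, π i x v ≤ 1 - b.pV
  pX_mul_card : b.pX * Fintype.card X ≤ 1

lemma rUp_eq {X V : Type*} {N : ℕ} {b : Params} {ph : Fin N → X → V → ℝ} (hb : b.Admissible)
    (i j : Fin N) (x : X) (v : V) :
    rUp b ph i j x v = rLow b ph i j x v + b.γ * b.pV / 2 := by
  unfold rUp rLow
  rw [← hb.widths_add]; ring

section Ratio

variable {X V : Type*} [Fintype X] [Fintype V] {N : ℕ} {b : Params} {π ph : Fin N → X → V → ℝ}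

lemma Accurate.ge (hπ : PolicyBounds b π) (h : Accurate b π ph) (i : Fin N) (x : X) (v : V) :
    b.pV - b.ξ ≤ ph i x v := by
  have h1 := abs_le.1 ((h i x).2 v)
  have h2 := hπ.ge i x v
  linarith

lemma rHat_sub_ratio {p q s r : ℝ} (hs : s ≠ 0) (hr : r ≠ 0) :
    p / s - q / r = ((p - q) * r + q * (r - s)) / (s * r) := by
  field_simp; ring

lemma rLow_le_ratio (hb : b.Admissible) (hπ : PolicyBounds b π) (h : Accurate b π ph)
    (i j : Fin N) (x : X) (v : V) : rLow b ph i j x v ≤ π i x v / π j x v := by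
  have hs := h.ge hπ j x v
  have hξ := hb.ξ_lt_pV
  have hξ0 := hb.ξ_pos
  have hp := hb.pV_pos
  have hr := hπ.ge j x v
  have hq := hπ.le i x v
  have hq0 := hπ.ge i x v
  have a1 := abs_le.1 ((h i x).2 v)
  have a2 := abs_le.1 ((h j x).2 v)
  unfold rLow rHat
  set p := ph i x v
  set s := ph j x v
  set q := π i x v
  set r := π j x v
  have hs0 : 0 < s := by linarith
  have hr0 : 0 < r := by linarith
  suffices p / s - q / r ≤ b.ξ / (b.pV * (b.pV - b.ξ)) by linarith
  rw [rHat_sub_ratio hs0.ne' hr0.ne', div_le_div_iff₀ (mul_pos hs0 hr0)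
    (mul_pos hp (by linarith))]
  have e1 : (p - q) * r + q * (r - s) ≤ b.ξ * (r + q) := by nlinarith
  have e2 : (r + q) * b.pV ≤ r := by nlinarith
  have e3 : (r + q) * b.pV * (b.pV - b.ξ) ≤ r * s :=
    mul_le_mul e2 hs (by linarith) hr0.le
  calc ((p - q) * r + q * (r - s)) * (b.pV * (b.pV - b.ξ))
      ≤ b.ξ * (r + q) * (b.pV * (b.pV - b.ξ)) :=
        mul_le_mul_of_nonneg_right e1 (mul_nonneg hp.le (by linarith))
    _ = b.ξ * ((r + q) * b.pV * (b.pV - b.ξ)) := by ring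
    _ ≤ b.ξ * (r * s) := by gcongr
    _ = b.ξ * (s * r) := by ring

lemma ratio_le_rUp (hb : b.Admissible) (hπ : PolicyBounds b π) (h : Accurate b π ph)
    (i j : Fin N) (x : X) (v : V) : π i x v / π j x v ≤ rUp b ph i j x v := by
  have hs := h.ge hπ j x v
  have hξ := hb.ξ_lt_pV
  have hξ0 := hb.ξ_pos
  have hp := hb.pV_pos
  have hr := hπ.ge j x v
  have hq := hπ.le i x v
  have hq0 := hπ.ge i x v
  have a1 := abs_le.1 ((h i x).2 v)
  have a2 := abs_le.1 ((h j x).2 v)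
  unfold rUp rHat
  set p := ph i x v
  set s := ph j x v
  set q := π i x v
  set r := π j x v
  have hs0 : 0 < s := by linarith
  have hr0 : 0 < r := by linarith
  have hq1 : 0 < q := by linarith
  -- the left side grows with `s`, so that `s` may be replaced by `r + ξ`
  have e0 : (q - b.ξ) / (r + b.ξ) ≤ p / s := by
    rw [div_le_div_iff₀ (by linarith) hs0]
    have := hb.ξ_le_pV
    nlinarith
  suffices q / r - (q - b.ξ) / (r + b.ξ) ≤ b.ξ / (b.pV * (b.pV + b.ξ)) by linarith
  have e1 : q / r - (q - b.ξ) / (r + b.ξ) = b.ξ * (r + q) / (r * (r + b.ξ)) := by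
    field_simp; ring
  rw [e1, div_le_div_iff₀ (mul_pos hr0 (by linarith)) (mul_pos hp (by linarith))]
  have e2 : (r + q) * b.pV ≤ r := by nlinarith
  have e3 : (r + q) * b.pV * (b.pV + b.ξ) ≤ r * (r + b.ξ) :=
    mul_le_mul e2 (by linarith) (by linarith) hr0.le
  calc b.ξ * (r + q) * (b.pV * (b.pV + b.ξ))
      = b.ξ * ((r + q) * b.pV * (b.pV + b.ξ)) := by ring
    _ ≤ b.ξ * (r * (r + b.ξ)) := by gcongr

lemma ratio_le (hb : b.Admissible) (hπ : PolicyBounds b π) (i j : Fin N) (x : X) (v : V) :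
    π i x v / π j x v ≤ (1 - b.pV) / b.pV := by
  have := hb.pV_le
  exact div_le_div₀ (by linarith) (hπ.le i x v) hb.pV_pos (hπ.ge j x v)

lemma ratio_pos (hb : b.Admissible) (hπ : PolicyBounds b π) (i j : Fin N) (x : X) (v : V) :
    0 < π i x v / π j x v :=
  div_pos (hb.pV_pos.trans_le (hπ.ge i x v)) (hb.pV_pos.trans_le (hπ.ge j x v))

lemma ratio_sub_le_rLow (hb : b.Admissible) (hπ : PolicyBounds b π) (h : Accurate b π ph)
    (i j : Fin N) (x : X) (v : V) :
    π i x v / π j x v - b.γ * b.pV / 2 ≤ rLow b ph i j x v := by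
  have := ratio_le_rUp hb hπ h i j x v
  rw [rUp_eq hb] at this
  linarith

lemma rLow_ge (hb : b.Admissible) (hπ : PolicyBounds b π) (h : Accurate b π ph)
    (i j : Fin N) (x : X) (v : V) : -(1 / 4) ≤ rLow b ph i j x v := by
  have := ratio_sub_le_rLow hb hπ h i j x v
  have := ratio_pos hb hπ i j x v
  have := hb.γ_mul_pV_le
  linarith

lemma rLow_le (hb : b.Admissible) (hπ : PolicyBounds b π) (h : Accurate b π ph)
    (i j : Fin N) (x : X) (v : V) : rLow b ph i j x v ≤ (1 - b.pV) / b.pV :=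
  (rLow_le_ratio hb hπ h i j x v).trans (ratio_le hb hπ i j x v)

lemma DLow_le (hb : b.Admissible) (hπ : PolicyBounds b π) (h : Accurate b π ph) (i j : Fin N) :
    DLow b ph i j ≤ f₁ ((1 - b.pV) / b.pV) := by
  set ρ := (1 - b.pV) / b.pV with hρ
  have hρ1 : 1 ≤ ρ := hb.one_le_ρ
  have hf : 0 ≤ f₁ ρ := le_trans (by linarith) (two_mul_sub_one_le_f₁ (x := ρ))
  have key : ∀ x, ∑ v, (ph i x v - b.ξ) * f₁ (rLow b ph i j x v) ≤ f₁ ρ := by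
    intro x
    calc ∑ v, (ph i x v - b.ξ) * f₁ (rLow b ph i j x v) ≤ ∑ v, ph i x v * f₁ ρ := by
          refine Finset.sum_le_sum fun v _ => ?_
          have h1 := h.ge hπ i x v
          have h2 := hb.ξ_le_pV
          have h3 := hb.ξ_pos
          have h4 := f₁_le_f₁ (rLow_le hb hπ h i j x v) (by linarith)
          calc (ph i x v - b.ξ) * f₁ (rLow b ph i j x v) ≤ (ph i x v - b.ξ) * f₁ ρ :=
                mul_le_mul_of_nonneg_left h4 (by linarith)
            _ ≤ ph i x v * f₁ ρ := by gcongr; linarith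
      _ = f₁ ρ := by rw [← Finset.sum_mul, (h i x).1.2, one_mul]
  unfold DLow
  calc b.pX * ∑ x, ∑ v, (ph i x v - b.ξ) * f₁ (rLow b ph i j x v)
      ≤ b.pX * ∑ _x : X, f₁ ρ := by
        have := hb.pX_pos
        gcongr with x
        exact key x
    _ = (b.pX * Fintype.card X) * f₁ ρ := by simp; ring
    _ ≤ 1 * f₁ ρ := by gcongr; exact hπ.pX_mul_card
    _ = _ := one_mul _

lemma DLow_ge (hb : b.Admissible) (hπ : PolicyBounds b π) (h : Accurate b π ph) (i j : Fin N) :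
    -(1 / 2) ≤ DLow b ph i j := by
  set δ := b.ξ / (b.pV * (b.pV - b.ξ)) with hδ
  have hδ0 : 0 ≤ δ := hb.lowWidth_nonneg
  have hδ1 : δ ≤ 2 / 15 := hb.lowWidth_le
  have hξ0 := hb.ξ_pos
  have hξp := hb.ξ_lt_pV
  have hp := hb.pV_pos
  have key : ∀ x, -(2 / 5 : ℝ) ≤ ∑ v, (ph i x v - b.ξ) * f₁ (rLow b ph i j x v) := by
    intro x
    have hq : ∑ v, ph i x v = 1 := (h i x).1.2
    have hs : ∑ v, ph j x v = 1 := (h j x).1.2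
    have hpos : ∀ v, 0 < ph j x v := fun v => by linarith [h.ge hπ j x v]
    have hposi : ∀ v, b.ξ ≤ ph i x v := fun v => by linarith [h.ge hπ i x v, hb.ξ_le_pV]
    have step : ∀ v, 2 * (ph i x v - ph j x v) - 2 * δ * ph i x v - 2 * b.pV * δ * ph i x v
        ≤ (ph i x v - b.ξ) * f₁ (rLow b ph i j x v) := by
      intro v
      have h1 : (ph i x v - b.ξ) * (2 * (rLow b ph i j x v - 1))
          ≤ (ph i x v - b.ξ) * f₁ (rLow b ph i j x v) :=
        mul_le_mul_of_nonneg_left two_mul_sub_one_le_f₁ (by linarith [hposi v])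
      refine le_trans ?_ h1
      have hr : rLow b ph i j x v = ph i x v / ph j x v - δ := rfl
      rw [hr]
      set q := ph i x v
      set s := ph j x v
      have hs0 : 0 < s := hpos v
      have hq0 : 0 < q := by linarith [hposi v]
      have e1 : q * (q / s) ≥ 2 * q - s := by
        rw [ge_iff_le, ← mul_div_assoc, le_div_iff₀ hs0]; nlinarith [sq_nonneg (q - s)]
      have e2 : b.ξ * (q / s) ≤ b.pV * δ * q := by
        have hsl : b.pV - b.ξ ≤ s := h.ge hπ j x v
        have hd : b.pV * δ = b.ξ / (b.pV - b.ξ) := by rw [hδ]; field_simp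
        rw [hd, mul_div_assoc', div_mul_eq_mul_div]
        exact div_le_div_of_nonneg_left (by positivity) (by linarith) hsl
      nlinarith
    refine le_trans ?_ (Finset.sum_le_sum fun v _ => step v)
    simp only [Finset.sum_sub_distrib, ← Finset.mul_sum, hq, hs]
    nlinarith [hb.pV_le]
  unfold DLow
  have : b.pX * ∑ _x : X, -(2 / 5 : ℝ) ≤ b.pX * ∑ x, ∑ v, (ph i x v - b.ξ) * f₁ (rLow b ph i j x v) := by
    have := hb.pX_pos
    gcongr with x
    exact key x
  simp only [Finset.sum_const, Finset.card_univ, nsmul_eq_mul] at this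
  have h2 := hπ.pX_mul_card
  nlinarith

/-- A lower bound for all divergence estimates. -/
noncomputable def mMin : ℝ := 1 - Real.log 2

lemma mMin_gt : (0.3 : ℝ) < mMin := by
  unfold mMin; linarith [Real.log_two_lt_d9]

lemma mMin_pos : 0 < mMin := by linarith [mMin_gt]

lemma MLow_le (hb : b.Admissible) (hπ : PolicyBounds b π) (h : Accurate b π ph) (i j : Fin N) :
    MLow b ph i j ≤ b.M := by
  refine le_trans ?_ hb.le_M
  have h1 := DLow_ge hb hπ h i j
  have h2 := DLow_le hb hπ h i j
  unfold MLow
  gcongr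
  linarith

lemma mMin_le_MLow (hb : b.Admissible) (hπ : PolicyBounds b π) (h : Accurate b π ph)
    (i j : Fin N) : mMin ≤ MLow b ph i j := by
  have h1 := DLow_ge hb hπ h i j
  unfold MLow mMin
  have : Real.log (1 / 2) ≤ Real.log (1 + DLow b ph i j) :=
    Real.log_le_log (by norm_num) (by linarith)
  rw [one_div, Real.log_inv] at this
  linarith

lemma MLow_pos (hb : b.Admissible) (hπ : PolicyBounds b π) (h : Accurate b π ph)
    (i j : Fin N) : 0 < MLow b ph i j := mMin_pos.trans_le (mMin_le_MLow hb hπ h i j)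

lemma div_M_le_Z (hb : b.Admissible) (hπ : PolicyBounds b π) (h : Accurate b π ph)
    (ks : ℕ → Fin N) (t : ℕ) (i : Fin N) : t / b.M ≤ Z b ph ks t i := by
  unfold Z
  calc (t : ℝ) / b.M = ∑ _s ∈ Finset.range t, b.M⁻¹ := by simp [div_eq_mul_inv]
    _ ≤ _ := Finset.sum_le_sum fun s _ =>
      inv_anti₀ (MLow_pos hb hπ h _ _) (MLow_le hb hπ h _ _)

lemma Z_pos (hb : b.Admissible) (hπ : PolicyBounds b π) (h : Accurate b π ph)
    (ks : ℕ → Fin N) {t : ℕ} (ht : 0 < t) (i : Fin N) : 0 < Z b ph ks t i :=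
  lt_of_lt_of_le (div_pos (by exact_mod_cast ht) (by linarith [hb.one_le_M]))
    (div_M_le_Z hb hπ h ks t i)

end Ratio

/-! ### The function `w` and the times -/

lemma div_log_lt {y z : ℝ} (hy : 0 < y) (hyz : y < z) (hz : z < 2) :
    y / Real.log (2 / y) < z / Real.log (2 / z) := by
  have hlz : 0 < Real.log (2 / z) := Real.log_pos (by rw [lt_div_iff₀ (by linarith)]; linarith)
  have hlt : Real.log (2 / z) < Real.log (2 / y) :=
    Real.log_lt_log (div_pos two_pos (by linarith)) (div_lt_div_of_pos_left two_pos hy hyz)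
  exact div_lt_div₀ hyz hlt.le (by linarith) hlz

lemma exists_div_log_eq {x : ℝ} (hx : 0 < x) :
    ∃ y, 0 < y ∧ y < 2 ∧ y / Real.log (2 / y) = x := by
  -- substitute `y = 2 exp (-u)` and solve `2 exp (-u) = x u`
  have hc : ContinuousOn (fun u : ℝ => x * u - 2 * Real.exp (-u)) (Set.Icc 0 (2 / x)) := by
    fun_prop
  have h0 : x * 0 - 2 * Real.exp (-0) ≤ 0 := by simp
  have h1 : 0 ≤ x * (2 / x) - 2 * Real.exp (-(2 / x)) := by
    have : Real.exp (-(2 / x)) ≤ 1 := Real.exp_le_one_iff.2 (by simp; positivity)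
    rw [mul_div_cancel₀ _ hx.ne']; linarith
  obtain ⟨u, hu, hu0⟩ := intermediate_value_Icc (by positivity) hc ⟨h0, h1⟩
  simp only at hu0
  have hupos : 0 < u := by
    rcases hu.1.lt_or_eq with h | h
    · exact h
    · exfalso; rw [← h] at hu0; norm_num at hu0
  refine ⟨2 * Real.exp (-u), by positivity, ?_, ?_⟩
  · have : Real.exp (-u) < 1 := Real.exp_lt_one_iff.2 (by linarith)
    linarith
  · have : 2 / (2 * Real.exp (-u)) = Real.exp u := by rw [Real.exp_neg]; field_simp
    rw [this, Real.log_exp, div_eq_iff hupos.ne']; linarith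

lemma w_spec {x : ℝ} (hx : 0 < x) :
    0 < w x ∧ w x < 2 ∧ w x / Real.log (2 / w x) = x := by
  obtain ⟨y, h0, h2, hy⟩ := exists_div_log_eq hx
  have : {y : ℝ | 0 < y ∧ y < 2 ∧ y / Real.log (2 / y) = x} = {y} := by
    ext z
    simp only [Set.mem_ofPred_eq, Set.mem_singleton_iff]
    refine ⟨fun ⟨z0, z2, hz⟩ => ?_, fun h => h ▸ ⟨h0, h2, hy⟩⟩
    rcases lt_trichotomy z y with h | h | h
    · have := div_log_lt z0 h h2; linarith
    · exact h
    · have := div_log_lt h0 h z2; linarith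
  have hw : w x = y := by unfold w; rw [this, csSup_singleton]
  rw [hw]; exact ⟨h0, h2, hy⟩

lemma w_le {x y : ℝ} (hx : 0 < x) (hy : 0 < y) (hxy : x ≤ y / Real.log (2 / y)) :
    w x ≤ y := by
  obtain ⟨h0, h2, h⟩ := w_spec hx
  by_contra hlt
  have := div_log_lt hy (not_le.1 hlt) h2
  linarith

lemma mul_log_two_le_w {x : ℝ} (hx : 0 < x) (hw : w x ≤ 1) : x * Real.log 2 ≤ w x := by
  obtain ⟨h0, h2, h⟩ := w_spec hx
  have hl : Real.log 2 ≤ Real.log (2 / w x) :=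
    Real.log_le_log two_pos (by rw [le_div_iff₀ h0]; linarith)
  have hl2 := Real.log_pos (one_lt_two (α := ℝ))
  have : w x = x * Real.log (2 / w x) := by
    rw [div_eq_iff (by linarith)] at h; exact h
  calc x * Real.log 2 ≤ x * Real.log (2 / w x) := by gcongr
    _ = w x := this.symm

section Eps

variable {X V : Type*} [Fintype X] [Fintype V] {N : ℕ} {b : Params} {π ph : Fin N → X → V → ℝ}

lemma eps_arg_pos (hb : b.Admissible) (hπ : PolicyBounds b π) (h : Accurate b π ph)
    (ks : ℕ → Fin N) {t : ℕ} (ht : 2 ≤ t) (i : Fin N) :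
    0 < √(t * Real.log t) / Z b ph ks t i := by
  have ht' : (2 : ℝ) ≤ t := by exact_mod_cast ht
  have := Real.log_pos (show (1 : ℝ) < t by linarith)
  exact div_pos (Real.sqrt_pos.2 (by positivity)) (Z_pos hb hπ h ks (by omega) i)

lemma eps_pos (hb : b.Admissible) (hπ : PolicyBounds b π) (h : Accurate b π ph)
    (ks : ℕ → Fin N) {t : ℕ} (ht : 2 ≤ t) (i : Fin N) : 0 < eps b ph ks t i :=
  mul_pos hb.C_pos (w_spec (eps_arg_pos hb hπ h ks ht i)).1

lemma sqrt_mul_log (t : ℕ) (ht : 2 ≤ t) :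
    √(t * Real.log t) = t * √(Real.log t / t) := by
  have ht' : (2 : ℝ) ≤ t := by exact_mod_cast ht
  have : (t : ℝ) * Real.log t = t ^ 2 * (Real.log t / t) := by field_simp
  rw [this, Real.sqrt_mul (by positivity), Real.sqrt_sq (by positivity)]

lemma w_arg_le (hb : b.Admissible) (hπ : PolicyBounds b π) (h : Accurate b π ph)
    (ks : ℕ → Fin N) {t : ℕ} (ht : 2 ≤ t) (i : Fin N) {y : ℝ} (hy : 0 < y)
    (hty : b.M * √(Real.log t / t) ≤ y / Real.log (2 / y)) :
    w (√(t * Real.log t) / Z b ph ks t i) ≤ y := by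
  refine w_le (eps_arg_pos hb hπ h ks ht i) hy (le_trans ?_ hty)
  have hZ := div_M_le_Z hb hπ h ks t i
  have hM : 0 < b.M := by linarith [hb.one_le_M]
  have ht' : (2 : ℝ) ≤ t := by exact_mod_cast ht
  rw [div_le_iff₀ (Z_pos hb hπ h ks (by omega) i), sqrt_mul_log t ht]
  calc (t : ℝ) * √(Real.log t / t) = b.M * √(Real.log t / t) * (t / b.M) := by field_simp
    _ ≤ _ := by gcongr

end Eps

lemma tendsto_sqrt_log_div :
    Filter.Tendsto (fun t : ℕ => √(Real.log t / t)) Filter.atTop (nhds 0) := by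
  have h : Filter.Tendsto (fun t : ℝ => Real.log t / t) Filter.atTop (nhds 0) :=
    Real.isLittleO_log_id_atTop.tendsto_div_nhds_zero
  simpa using (h.comp tendsto_natCast_atTop_atTop).sqrt

/-- The clippers are inactive after a time that depends on the parameters only. -/
theorem exists_unclipped_time {b : Params} (hb : b.Admissible) :
    ∃ t₀ : ℕ, ∀ {X V : Type*} [Fintype X] [Fintype V] {N : ℕ} (π : Fin N → X → V → ℝ),
      PolicyBounds b π → ∀ t ≥ t₀, ∀ ph, Accurate b π ph → ∀ (ks : ℕ → Fin N) (i j : Fin N)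
        (x : X) (v : V), Unclipped b ph ks t i j x v := by
  set ρ := (1 - b.pV) / b.pV with hρ
  have hρ1 : 1 ≤ ρ := hb.one_le_ρ
  set Q := (ρ + 1) / (2 * mMin) with hQ
  have hm := mMin_pos
  have hQ0 : 0 < Q := by positivity
  have hC := hb.C_ge
  have hM := hb.one_le_M
  set y := 2 * Real.exp (-Q) / b.C with hy
  have hy0 : 0 < y := by have := hb.C_pos; positivity
  have he1 : Real.exp (-Q) < 1 := Real.exp_lt_one_iff.2 (by linarith)
  have hy2 : y < 2 := by rw [hy, div_lt_iff₀ hb.C_pos]; linarith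
  have hly : 0 < y / Real.log (2 / y) :=
    div_pos hy0 (Real.log_pos (by rw [lt_div_iff₀ hy0]; linarith))
  have hlim : Filter.Tendsto (fun t : ℕ => b.M * √(Real.log t / t)) Filter.atTop (nhds 0) := by
    simpa using tendsto_sqrt_log_div.const_mul b.M
  obtain ⟨t₀, ht₀⟩ := Filter.eventually_atTop.1 (hlim.eventually_le_const hly)
  refine ⟨max 2 t₀, fun {X V} _ _ {N} π hπ t ht ph h ks i j x v => Or.inr ?_⟩
  have ht2 : 2 ≤ t := le_trans (le_max_left _ _) ht
  have hw := w_arg_le hb hπ h ks ht2 i hy0 (ht₀ t (le_trans (le_max_right _ _) ht))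
  have he : eps b ph ks t i ≤ 2 * Real.exp (-Q) := by
    unfold eps
    calc b.C * _ ≤ b.C * y := by have := hb.C_pos; gcongr
      _ = _ := by rw [hy]; field_simp
  have hQe : Q ≤ Real.log (2 / eps b ph ks t i) := by
    rw [Real.le_log_iff_exp_le (div_pos two_pos (eps_pos hb hπ h ks ht2 i)),
      le_div_iff₀ (eps_pos hb hπ h ks ht2 i)]
    calc Real.exp Q * eps b ph ks t i ≤ Real.exp Q * (2 * Real.exp (-Q)) := by gcongr
      _ = 2 := by rw [Real.exp_neg]; field_simp
  calc rUp b ph i j x v ≤ ρ + 1 := by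
        rw [rUp_eq hb]; linarith [rLow_le hb hπ h i j x v, hb.γ_mul_pV_le]
    _ = 2 * Q * mMin := by rw [hQ]; field_simp
    _ ≤ _ := by
      have := mMin_le_MLow hb hπ h i j
      have := hQ0.le.trans hQe
      gcongr

lemma unclipped_of_tClip_le {X V : Type*} [Fintype X] [Fintype V] {N : ℕ} {b : Params}
    {π ph : Fin N → X → V → ℝ} (hb : b.Admissible) (hπ : PolicyBounds b π) {t : ℕ}
    (ht : tClip b π ≤ t) (h : Accurate b π ph) (ks : ℕ → Fin N) (i j : Fin N) (x : X) (v : V) :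
    Unclipped b ph ks t i j x v := by
  obtain ⟨t₀, ht₀⟩ := exists_unclipped_time hb
  exact (Nat.sInf_mem (s := {t₀ : ℕ | ∀ t ≥ t₀, ∀ ph, Accurate b π ph → ∀ (ks : ℕ → Fin N)
    (i j : Fin N) (x : X) (v : V), Unclipped b ph ks t i j x v}) ⟨t₀, ht₀ π hπ⟩) t ht ph h ks i j x v

/-- The threshold for `t / log t` in the definition of `tau`. -/
noncomputable def tauLevel (b : Params) (Δ : ℝ) : ℝ :=
  9 * b.C ^ 2 * b.M ^ 2 * Real.log (6 * b.C / (Δ - b.γ * b.pV)) ^ 2 / (Δ - b.γ * b.pV) ^ 2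

lemma exists_tauLevel_le (b : Params) (Δ : ℝ) :
    ∃ t : ℕ, 2 ≤ t ∧ tauLevel b Δ ≤ t / Real.log t := by
  have h : Filter.Tendsto (fun t : ℝ => t / Real.log t) Filter.atTop Filter.atTop := by
    have h0 : Filter.Tendsto (fun t : ℝ => Real.log t / t) Filter.atTop (nhdsWithin 0 (Set.Ioi 0)) := by
      refine tendsto_nhdsWithin_iff.2
        ⟨Real.isLittleO_log_id_atTop.tendsto_div_nhds_zero, ?_⟩
      filter_upwards [Filter.eventually_gt_atTop 1] with t ht
      exact div_pos (Real.log_pos ht) (by linarith)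
    refine h0.inv_tendsto_nhdsGT_zero.congr fun t => ?_
    simp
  obtain ⟨t, ht⟩ := (((h.comp tendsto_natCast_atTop_atTop).eventually_ge_atTop
    (tauLevel b Δ)).and (Filter.eventually_ge_atTop 2)).exists
  exact ⟨t, ht.2, ht.1⟩

lemma tau_spec (b : Params) (Δ : ℝ) :
    2 ≤ tau b Δ ∧ tauLevel b Δ ≤ tau b Δ / Real.log (tau b Δ) :=
  Nat.sInf_mem (exists_tauLevel_le b Δ)

section Tau

variable {b : Params} (hb : b.Admissible) {Δ Δ' : ℝ}
include hb

lemma log_ge_one (hΔ : b.γ * b.pV < Δ) (hΔ1 : Δ ≤ 1) :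
    1 ≤ Real.log (6 * b.C / (Δ - b.γ * b.pV)) := by
  have h1 := hb.C_ge
  have h2 := hb.γ_mul_pV_pos
  rw [Real.le_log_iff_exp_le (div_pos (by linarith) (by linarith)), le_div_iff₀ (by linarith)]
  nlinarith [Real.exp_one_lt_d9, Real.exp_pos 1]

lemma tauLevel_anti (hΔ : b.γ * b.pV < Δ) (h : Δ ≤ Δ') (h1 : Δ' ≤ 1) :
    tauLevel b Δ' ≤ tauLevel b Δ := by
  have h2 : 0 < Δ - b.γ * b.pV := by linarith
  have h3 := log_ge_one hb (lt_of_lt_of_le hΔ h) h1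
  have h4 : Real.log (6 * b.C / (Δ' - b.γ * b.pV)) ≤ Real.log (6 * b.C / (Δ - b.γ * b.pV)) := by
    have := hb.C_pos
    refine Real.log_le_log (div_pos (by linarith) (by linarith)) ?_
    gcongr
  unfold tauLevel
  gcongr

lemma tau_anti (hΔ : b.γ * b.pV < Δ) (h : Δ ≤ Δ') (h1 : Δ' ≤ 1) : tau b Δ' ≤ tau b Δ :=
  Nat.sInf_le ⟨(tau_spec b Δ).1, (tauLevel_anti hb hΔ h h1).trans (tau_spec b Δ).2⟩

lemma le_tauLevel (hΔ : b.γ * b.pV < Δ) (h1 : Δ ≤ 1) : 9 * b.C ^ 2 * b.M ^ 2 ≤ tauLevel b Δ := by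
  have h2 := log_ge_one hb hΔ h1
  have h3 := hb.γ_mul_pV_pos
  unfold tauLevel
  rw [le_div_iff₀ (by have : 0 < Δ - b.γ * b.pV := by linarith
                      positivity)]
  have h4 : (Δ - b.γ * b.pV) ^ 2 ≤ 1 := pow_le_one₀ (by linarith) (by linarith)
  have h5 : 1 ≤ Real.log (6 * b.C / (Δ - b.γ * b.pV)) ^ 2 := one_le_pow₀ h2
  have : 0 ≤ 9 * b.C ^ 2 * b.M ^ 2 := by positivity
  nlinarith

lemma tauLevel_le_of_tau_le (hΔ : b.γ * b.pV < Δ) (h1 : Δ ≤ 1) {t : ℕ} (ht : tau b Δ ≤ t) :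
    tauLevel b Δ ≤ t / Real.log t := by
  obtain ⟨h2, hs⟩ := tau_spec b Δ
  have h9 : 9 ≤ tauLevel b Δ := by
    refine le_trans ?_ (le_tauLevel hb hΔ h1)
    have hC : (1 : ℝ) ≤ b.C ^ 2 := one_le_pow₀ (by linarith [hb.C_ge])
    have hM : (1 : ℝ) ≤ b.M ^ 2 := one_le_pow₀ hb.one_le_M
    nlinarith
  have h3 : 3 ≤ tau b Δ := by
    by_contra hlt
    have he : tau b Δ = 2 := by omega
    rw [he] at hs
    have : ((2 : ℕ) : ℝ) / Real.log (2 : ℕ) < 9 := by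
      push_cast
      rw [div_lt_iff₀ (Real.log_pos one_lt_two)]
      linarith [Real.log_two_gt_d9]
    linarith
  refine hs.trans ?_
  have he : Real.exp 1 ≤ tau b Δ := by
    have : (3 : ℝ) ≤ tau b Δ := by exact_mod_cast h3
    linarith [Real.exp_one_lt_d9]
  have hle : (tau b Δ : ℝ) ≤ t := by exact_mod_cast ht
  have hanti := Real.log_div_self_antitoneOn (a := tau b Δ) (b := t) he (he.trans hle) hle
  have hlt : 0 < Real.log t / t := by
    have : (1 : ℝ) < t := by
      have : (3 : ℝ) ≤ tau b Δ := by exact_mod_cast h3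
      linarith
    exact div_pos (Real.log_pos this) (by linarith)
  have := inv_anti₀ hlt hanti
  simpa using this

lemma w_level_of_tau_le (hΔ : b.γ * b.pV < Δ) (h1 : Δ ≤ 1) {t : ℕ} (ht : tau b Δ ≤ t) :
    b.M * √(Real.log t / t) ≤ ((Δ - b.γ * b.pV) / (3 * b.C)) /
      Real.log (2 / ((Δ - b.γ * b.pV) / (3 * b.C))) := by
  have h := tauLevel_le_of_tau_le hb hΔ h1 ht
  have hl := log_ge_one hb hΔ h1
  have hC := hb.C_pos
  have hM := hb.one_le_M
  set d := Δ - b.γ * b.pV with hd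
  have hd0 : 0 < d := by rw [hd]; linarith
  have e : 2 / (d / (3 * b.C)) = 6 * b.C / d := by field_simp; norm_num
  rw [e]
  unfold tauLevel at h
  rw [← hd] at h
  set L := Real.log (6 * b.C / d)
  have ht2 : (2 : ℝ) ≤ t := by exact_mod_cast (tau_spec b Δ).1.trans ht
  have hlt := Real.log_pos (show (1 : ℝ) < t by linarith)
  have : √(Real.log t / t) ≤ d / (3 * b.C * b.M * L) := by
    refine Real.sqrt_le_iff.2 ⟨by positivity, ?_⟩
    have hpos : 0 < 9 * b.C ^ 2 * b.M ^ 2 * L ^ 2 / d ^ 2 := by positivity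
    have := inv_anti₀ hpos h
    rw [inv_div, inv_div] at this
    refine this.trans (le_of_eq ?_)
    rw [div_pow]; congr 1; ring
  calc b.M * √(Real.log t / t) ≤ b.M * (d / (3 * b.C * b.M * L)) := by gcongr
    _ = _ := by field_simp

end Tau

lemma eps_le_of_tau_le {X V : Type*} [Fintype X] [Fintype V] {N : ℕ} {b : Params}
    {π ph : Fin N → X → V → ℝ} (hb : b.Admissible) (hπ : PolicyBounds b π) (h : Accurate b π ph)
    {Δ : ℝ} (hΔ : b.γ * b.pV < Δ) (h1 : Δ ≤ 1) {t : ℕ} (ht : tau b Δ ≤ t)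
    (ks : ℕ → Fin N) (i : Fin N) :
    eps b ph ks t i ≤ (Δ - b.γ * b.pV) / 3 ∧
      b.C * Real.log 2 * (√(t * Real.log t) / Z b ph ks t i) ≤ eps b ph ks t i := by
  have hC := hb.C_ge
  have hg := hb.γ_mul_pV_pos
  have ht2 := (tau_spec b Δ).1.trans ht
  have hy0 : 0 < (Δ - b.γ * b.pV) / (3 * b.C) := div_pos (by linarith) (by linarith)
  have hy1 : (Δ - b.γ * b.pV) / (3 * b.C) ≤ 1 := by
    rw [div_le_one (by linarith)]; linarith
  have hw := w_arg_le hb hπ h ks ht2 i hy0 (w_level_of_tau_le hb hΔ h1 ht)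
  have hC0 := hb.C_pos
  constructor
  · calc eps b ph ks t i ≤ b.C * ((Δ - b.γ * b.pV) / (3 * b.C)) := by unfold eps; gcongr
      _ = _ := by field_simp
  · have := mul_log_two_le_w (eps_arg_pos hb hπ h ks ht2 i) (hw.trans hy1)
    unfold eps
    rw [mul_assoc]
    gcongr
    linarith

/-! ### Comparison of indices -/

/-- A bound for the oscillation of one summand of the index. -/
noncomputable def osc (b : Params) : ℝ := ((1 - b.pV) / b.pV + 1 / 4) / mMin

lemma osc_pos {b : Params} (hb : b.Admissible) : 0 < osc b :=
  div_pos (by linarith [hb.one_le_ρ]) mMin_pos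

lemma osc_le {b : Params} (hb : b.Admissible) : osc b ≤ 3 / 2 * (b.C * Real.log 2) := by
  have h1 := hb.ρ_le_M
  have h2 := hb.one_le_M
  have h3 := hb.mul_M_le_C
  have h4 := mMin_gt
  have h5 := Real.log_two_gt_d9
  unfold osc
  rw [div_le_iff₀ mMin_pos]
  have h6 : 32 * b.M * (1 / 2) ≤ b.C * Real.log 2 := by
    refine mul_le_mul h3 (by linarith) (by norm_num) (by linarith)
  have h7 : 24 * b.M * 0.3 ≤ 3 / 2 * (b.C * Real.log 2) * mMin := by
    refine mul_le_mul (by linarith) (by linarith) (by norm_num) (by linarith)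
  linarith

section Index

variable {X V : Type*} [Fintype X] [Fintype V] {N : ℕ} {b : Params} {π ph : Fin N → X → V → ℝ}

/-- The centred sum by which the index overestimates. -/
noncomputable def overSum (b : Params) (ph : Fin N → X → V → ℝ) (μ : ℝ) (i : Fin N)
    (ks : ℕ → Fin N) (xs : ℕ → X) (vs : ℕ → V) (ys : ℕ → ℝ) (t : ℕ) : ℝ :=
  ∑ s ∈ Finset.range t, (ys s * rLow b ph i (ks s) (xs s) (vs s) - μ) / MLow b ph i (ks s)

/-- The centred sum by which the index underestimates. -/
noncomputable def underSum (b : Params) (ph : Fin N → X → V → ℝ) (μ : ℝ) (i : Fin N)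
    (ks : ℕ → Fin N) (xs : ℕ → X) (vs : ℕ → V) (ys : ℕ → ℝ) (t : ℕ) : ℝ :=
  ∑ s ∈ Finset.range t, (μ - b.γ * b.pV / 2 - ys s * rLow b ph i (ks s) (xs s) (vs s)) /
    MLow b ph i (ks s)

lemma err_eq [Nonempty X] [Nonempty V] [NeZero N] (hb : b.Admissible) {ks : ℕ → Fin N} {t : ℕ}
    {i : Fin N} (hu : ∀ j x v, Unclipped b ph ks t i j x v) :
    err b ph ks t i = b.γ * b.pV / 2 := by
  unfold err
  have : ∀ a : Fin N × X × V, (rUp b ph i a.1 a.2.1 a.2.2 - rLow b ph i a.1 a.2.1 a.2.2 *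
      (open Classical in if Unclipped b ph ks t i a.1 a.2.1 a.2.2 then 1 else 0)) =
      b.γ * b.pV / 2 := fun a => by
    rw [if_pos (hu _ _ _), rUp_eq hb]; ring
  simp_rw [this]
  have : Nonempty (Fin N) := ⟨0⟩
  exact ciSup_const

lemma Ytilde_eq {ks : ℕ → Fin N} {xs : ℕ → X} {vs : ℕ → V} {ys : ℕ → ℝ} {t : ℕ}
    {i : Fin N} (hu : ∀ j x v, Unclipped b ph ks t i j x v) :
    Ytilde b ph ks xs vs ys t i = (∑ s ∈ Finset.range t,
      ys s * rLow b ph i (ks s) (xs s) (vs s) / MLow b ph i (ks s)) / Z b ph ks t i := by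
  unfold Ytilde
  rw [div_eq_inv_mul]
  congr 1
  refine Finset.sum_congr rfl fun s _ => ?_
  rw [if_pos (hu _ _ _)]; ring

lemma sum_const_div (μ : ℝ) (ks : ℕ → Fin N) (t : ℕ) (i : Fin N) :
    ∑ s ∈ Finset.range t, μ / MLow b ph i (ks s) = μ * Z b ph ks t i := by
  simp only [Z, Finset.mul_sum, div_eq_mul_inv]

/-- If neither estimator deviates, a suboptimal expert has a smaller index than the best one. -/
theorem U_lt_U [Nonempty X] [Nonempty V] (hb : b.Admissible) (hπ : PolicyBounds b π)
    (h : Accurate b π ph) {t : ℕ} {ks : ℕ → Fin N} {xs : ℕ → X} {vs : ℕ → V} {ys : ℕ → ℝ}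
    {i j : Fin N} {μ Δ : ℝ} (hΔ : b.γ * b.pV < Δ) (h1 : Δ ≤ 1) (htc : tClip b π ≤ t)
    (ht : tau b Δ ≤ t)
    (hi : underSum b ph μ i ks xs vs ys t < osc b * √(t * Real.log t))
    (hj : overSum b ph (μ - Δ) j ks xs vs ys t < osc b * √(t * Real.log t)) :
    U b ph ks xs vs ys t j < U b ph ks xs vs ys t i := by
  have : NeZero N := ⟨by have := i.pos; omega⟩
  have hui := fun j x v => unclipped_of_tClip_le hb hπ htc h ks i j x v
  have huj := fun j' x v => unclipped_of_tClip_le hb hπ htc h ks j j' x v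
  have ht2 := (tau_spec b Δ).1.trans ht
  have hZi := Z_pos hb hπ h ks (show 0 < t by omega) i
  have hZj := Z_pos hb hπ h ks (show 0 < t by omega) j
  have hg := hb.γ_mul_pV_pos
  have dev : ∀ l, osc b * √(t * Real.log t) ≤ 3 / 2 * eps b ph ks t l * Z b ph ks t l := by
    intro l
    have hZ := Z_pos hb hπ h ks (show 0 < t by omega) l
    have h2 := (eps_le_of_tau_le hb hπ h hΔ h1 ht ks l).2
    rw [← mul_div_assoc, div_le_iff₀ hZ] at h2
    have := mul_le_mul_of_nonneg_right (osc_le hb) (Real.sqrt_nonneg (t * Real.log t))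
    linarith
  have hYi : μ - b.γ * b.pV / 2 - 3 / 2 * eps b ph ks t i < Ytilde b ph ks xs vs ys t i := by
    rw [Ytilde_eq hui, lt_div_iff₀ hZi]
    unfold underSum at hi
    simp only [sub_div, Finset.sum_sub_distrib] at hi
    rw [sum_const_div, sum_const_div] at hi
    linarith [dev i]
  have hYj : Ytilde b ph ks xs vs ys t j < μ - Δ + 3 / 2 * eps b ph ks t j := by
    rw [Ytilde_eq huj, div_lt_iff₀ hZj]
    unfold overSum at hj
    simp only [sub_div, Finset.sum_sub_distrib] at hj
    rw [sum_const_div, sum_const_div] at hj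
    linarith [dev j]
  have hej := (eps_le_of_tau_le hb hπ h hΔ h1 ht ks j).1
  unfold U
  rw [err_eq hb hui, err_eq hb huj]
  linarith

end Index

/-! ### Exponential supermartingales -/

lemma finite_hoeffding {ι : Type*} [Fintype ι] {p z : ι → ℝ} (hp0 : ∀ i, 0 ≤ p i)
    (hp1 : ∑ i, p i = 1) {lo hi c : ℝ} (hlo : ∀ i, lo ≤ z i) (hhi : ∀ i, z i ≤ hi)
    (hc : hi - lo ≤ c) (hmean : ∑ i, p i * z i ≤ 0) {l : ℝ} (hl : 0 ≤ l) :
    ∑ i, p i * Real.exp (l * z i - l ^ 2 * c ^ 2 / 8) ≤ 1 := by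
  let _ : MeasurableSpace ι := ⊤
  set μ : Measure ι := ∑ i, ENNReal.ofReal (p i) • Measure.dirac i with hμ
  have hint : ∀ f : ι → ℝ, ∫ i, f i ∂μ = ∑ i, p i * f i := by
    intro f
    rw [hμ, integral_finsetSum_measure fun i _ => by
      refine Integrable.smul_measure ?_ ENNReal.ofReal_ne_top
      exact integrable_dirac (by simp)]
    refine Finset.sum_congr rfl fun i _ => ?_
    rw [integral_smul_measure, integral_dirac, ENNReal.toReal_ofReal (hp0 i), smul_eq_mul]
  have hprob : IsProbabilityMeasure μ := ⟨by
    rw [hμ, Measure.finsetSum_apply]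
    simp only [Measure.smul_apply, measure_univ, smul_eq_mul, mul_one]
    rw [← ENNReal.ofReal_sum_of_nonneg fun i _ => hp0 i, hp1, ENNReal.ofReal_one]⟩
  have hne : Nonempty ι := by
    by_contra h
    rw [not_nonempty_iff] at h
    simp at hp1
  have hle : lo ≤ hi := (hlo hne.some).trans (hhi _)
  have h := (ProbabilityTheory.hasSubgaussianMGF_of_mem_Icc (μ := μ) (X := z) (a := lo) (b := hi)
    (Measurable.of_discrete).aemeasurable (Filter.Eventually.of_forall fun i => ⟨hlo i, hhi i⟩)).mgf_le l
  rw [ProbabilityTheory.mgf, hint, hint] at h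
  set m := ∑ i, p i * z i
  have hexp : (((‖hi - lo‖₊ / 2) ^ 2 : NNReal) : ℝ) * l ^ 2 / 2 ≤ l ^ 2 * c ^ 2 / 8 := by
    push_cast
    rw [Real.norm_of_nonneg (by linarith)]
    have : (hi - lo) ^ 2 ≤ c ^ 2 := pow_le_pow_left₀ (by linarith) hc 2
    nlinarith [mul_le_mul_of_nonneg_left this (sq_nonneg l)]
  calc ∑ i, p i * Real.exp (l * z i - l ^ 2 * c ^ 2 / 8)
      ≤ ∑ i, p i * (Real.exp (l * (z i - m)) * Real.exp (-(l ^ 2 * c ^ 2 / 8))) := by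
        gcongr with i
        · exact hp0 i
        · rw [← Real.exp_add]
          have : l * m ≤ 0 := mul_nonpos_of_nonneg_of_nonpos hl hmean
          exact Real.exp_le_exp.2 (by linarith)
    _ = (∑ i, p i * Real.exp (l * (z i - m))) * Real.exp (-(l ^ 2 * c ^ 2 / 8)) := by
        rw [Finset.sum_mul]; simp only [mul_assoc]
    _ ≤ Real.exp (l ^ 2 * c ^ 2 / 8) * Real.exp (-(l ^ 2 * c ^ 2 / 8)) := by
        gcongr; exact h.trans (Real.exp_le_exp.2 hexp)
    _ = 1 := by rw [← Real.exp_add]; simp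

/-- `exp ∘ Ψ` has conditional expectation at most `1` given `m`. -/
def ExpLeOne {Ω : Type*} {mΩ : MeasurableSpace Ω} (P : Measure Ω) (m : MeasurableSpace Ω)
    (Ψ : Ω → ℝ) : Prop :=
  ∀ H : Ω → ENNReal, Measurable[m] H →
    ∫⁻ ω, H ω * ENNReal.ofReal (Real.exp (Ψ ω)) ∂P ≤ ∫⁻ ω, H ω ∂P

section Chernoff

variable {Ω : Type*} {mΩ : MeasurableSpace Ω} {P : Measure Ω} [IsProbabilityMeasure P]
  {F : Filtration ℕ mΩ}

/-- The Chernoff bound for a sum with conditional exponential moments at most `1`. -/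
theorem measure_sum_ge_le {Ψ : ℕ → Ω → ℝ} {s₀ t : ℕ}
    (hm : ∀ r < t, Measurable[F (s₀ + r + 1)] (Ψ r))
    (hle : ∀ r < t, ExpLeOne P (F (s₀ + r)) (Ψ r)) (u : ℝ) :
    P {ω | u ≤ ∑ r ∈ Finset.range t, Ψ r ω} ≤ ENNReal.ofReal (Real.exp (-u)) := by
  have hmeas : ∀ r ≤ t, Measurable[F (s₀ + r)]
      fun ω => ENNReal.ofReal (Real.exp (∑ q ∈ Finset.range r, Ψ q ω)) := by
    intro r hr
    have : Measurable[F (s₀ + r)] fun ω => ∑ q ∈ Finset.range r, Ψ q ω :=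
      Finset.measurable_sum _ fun q hq =>
        (hm q (by have := Finset.mem_range.1 hq; omega)).mono
          (F.mono (by have := Finset.mem_range.1 hq; omega)) le_rfl
    exact ENNReal.measurable_ofReal.comp (Real.measurable_exp.comp this)
  have hint : ∀ r ≤ t,
      ∫⁻ ω, ENNReal.ofReal (Real.exp (∑ q ∈ Finset.range r, Ψ q ω)) ∂P ≤ 1 := by
    intro r
    induction r with
    | zero => intro _; simp
    | succ r ih =>
      intro hr
      refine le_trans (le_of_eq ?_) ((hle r (by omega) _ (hmeas r (by omega))).trans (ih (by omega)))
      refine lintegral_congr fun ω => ?_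
      rw [Finset.sum_range_succ, Real.exp_add, ENNReal.ofReal_mul (Real.exp_pos _).le]
  have hsub : {ω | u ≤ ∑ r ∈ Finset.range t, Ψ r ω} ⊆ {ω | ENNReal.ofReal (Real.exp u) ≤
      ENNReal.ofReal (Real.exp (∑ q ∈ Finset.range t, Ψ q ω))} := fun ω hω =>
    ENNReal.ofReal_le_ofReal (Real.exp_le_exp.2 hω)
  refine (measure_mono hsub).trans ((meas_ge_le_lintegral_div
    ((hmeas t le_rfl).mono (F.le _) le_rfl).aemeasurable
    (by simp [Real.exp_pos]) ENNReal.ofReal_ne_top).trans ?_)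
  rw [Real.exp_neg, ENNReal.ofReal_inv_of_pos (Real.exp_pos _), ENNReal.div_eq_inv_mul]
  exact mul_le_of_le_one_right zero_le (hint t le_rfl)

end Chernoff

/-! ### Integration along a run -/

section Rew

variable {X V : Type*} [Fintype X] [Fintype V] {N E : ℕ}

/-- The mean reward given context and action. -/
noncomputable def Bandit.rewMean (I : Bandit X V N E) (e : Fin E) (a : X) (c : V) : ℝ :=
  ∫ z, z ∂(I.rew e a c)

lemma integrable_rew (I : Bandit X V N E) (e : Fin E) (a : X) (c : V) :
    Integrable (fun z : ℝ => z) (I.rew e a c) := by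
  have := I.rew_prob e a c
  refine Integrable.of_bound (C := 1) measurable_id.aestronglyMeasurable ?_
  filter_upwards [I.rew_supp e a c] with z hz
  rw [Real.norm_of_nonneg hz.1]; exact hz.2

lemma rewMean_nonneg (I : Bandit X V N E) (e : Fin E) (a : X) (c : V) : 0 ≤ I.rewMean e a c :=
  integral_nonneg_of_ae ((I.rew_supp e a c).mono fun _ hz => hz.1)

lemma rewMean_le_one (I : Bandit X V N E) (e : Fin E) (a : X) (c : V) : I.rewMean e a c ≤ 1 := by
  have := I.rew_prob e a c
  calc I.rewMean e a c ≤ ∫ _z, (1 : ℝ) ∂(I.rew e a c) :=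
        integral_mono_ae (integrable_rew I e a c) (integrable_const _)
          ((I.rew_supp e a c).mono fun _ hz => hz.2)
    _ = 1 := by simp

lemma lintegral_rew (I : Bandit X V N E) (e : Fin E) (a : X) (c : V) :
    ∫⁻ z, ENNReal.ofReal z ∂(I.rew e a c) = ENNReal.ofReal (I.rewMean e a c) :=
  (ofReal_integral_eq_lintegral_ofReal (integrable_rew I e a c)
    ((I.rew_supp e a c).mono fun _ hz => hz.1)).symm

lemma lintegral_one_sub_rew (I : Bandit X V N E) (e : Fin E) (a : X) (c : V) :
    ∫⁻ z, ENNReal.ofReal (1 - z) ∂(I.rew e a c) = ENNReal.ofReal (1 - I.rewMean e a c) := by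
  have := I.rew_prob e a c
  have hint : Integrable (fun z : ℝ => 1 - z) (I.rew e a c) :=
    (integrable_const _).sub (integrable_rew I e a c)
  rw [← ofReal_integral_eq_lintegral_ofReal hint
    ((I.rew_supp e a c).mono fun _ hz => sub_nonneg.2 hz.2),
    integral_sub (integrable_const _) (integrable_rew I e a c)]
  simp [Bandit.rewMean]

end Rew

section Run

variable {X V : Type*} [Fintype X] [Fintype V] [DecidableEq X] [DecidableEq V] {N E : ℕ}
  {b : Params} {I : Bandit X V N E} {T m : ℕ} {Ω : Type*} {mΩ : MeasurableSpace Ω}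
  {P : Measure Ω} {F : Filtration ℕ mΩ} {k : ℕ → Ω → Fin N} {x : ℕ → Ω → X} {v : ℕ → Ω → V}
  {y : ℕ → Ω → ℝ}

/-- The episode of step `s`. -/
def episode {E T s : ℕ} (hs : s < E * T) : Fin E := ⟨s / T, Nat.div_lt_of_lt_mul (by rwa [mul_comm])⟩

namespace IsOnlineRun

variable (hr : IsOnlineRun b I T m P F k x v y)
include hr

lemma law_step {s : ℕ} (hs : s < E * T) {G : Set Ω} (hG : MeasurableSet[F s] G) (i : Fin N)
    (a : X) (c : V) {B : Set ℝ} (hB : MeasurableSet B) :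
    P (G ∩ {ω | k s ω = i ∧ x s ω = a ∧ v s ω = c ∧ y s ω ∈ B})
      = P (G ∩ {ω | k s ω = i}) *
        ENNReal.ofReal (I.ctx (episode hs) a * I.pol i a c) * I.rew (episode hs) a c B := by
  have hT : 0 < T := Nat.pos_of_ne_zero (by rintro rfl; simp at hs)
  have e : (episode hs : ℕ) * T + s % T = s := by
    simp only [episode]; rw [mul_comm]; exact Nat.div_add_mod s T
  have := hr.law (episode hs) (s % T) (Nat.mod_lt _ hT) G (by rwa [e]) i a c B hB
  rwa [e] at this

lemma measurable_choice (τ s : ℕ) (h : s ≤ τ) (i : Fin N) : MeasurableSet[F τ] {ω | k s ω = i} :=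
  F.mono h _ (hr.choice_meas s i)

lemma measurableSet_step (s : ℕ) (i : Fin N) (a : X) (c : V) :
    MeasurableSet {ω | k s ω = i ∧ x s ω = a ∧ v s ω = c} :=
  (F.le s _ (hr.choice_meas s i)).inter
    ((F.le (s + 1) _ (hr.ctx_meas (s + 1) s (by omega) a)).inter
      (F.le (s + 1) _ (hr.act_meas (s + 1) s (by omega) c)))

lemma measurable_rew (s : ℕ) : Measurable (y s) :=
  (hr.rew_meas (s + 1) s (by omega)).mono (F.le _) le_rfl

lemma setLIntegral_step {s : ℕ} (hs : s < E * T) {H : Ω → ENNReal} (hH : Measurable[F s] H)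
    {g : ℝ → ENNReal} (hg : Measurable g) (i : Fin N) (a : X) (c : V) :
    ∫⁻ ω in {ω | k s ω = i ∧ x s ω = a ∧ v s ω = c}, H ω * g (y s ω) ∂P =
      ENNReal.ofReal (I.ctx (episode hs) a * I.pol i a c) *
        (∫⁻ z, g z ∂(I.rew (episode hs) a c)) * ∫⁻ ω in {ω | k s ω = i}, H ω ∂P := by
  set S := {ω | k s ω = i ∧ x s ω = a ∧ v s ω = c} with hS
  set κ := ENNReal.ofReal (I.ctx (episode hs) a * I.pol i a c) with hκ
  have hSm : MeasurableSet S := hr.measurableSet_step s i a c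
  have hy := hr.measurable_rew s
  have hgy : Measurable fun ω => g (y s ω) := hg.comp hy
  have key : ∀ G, MeasurableSet[F s] G → ∫⁻ ω in G, g (y s ω) ∂(P.restrict S) =
      κ * (∫⁻ z, g z ∂(I.rew (episode hs) a c)) * P (G ∩ {ω | k s ω = i}) := by
    intro G hG
    have hGm := F.le s _ hG
    have hmap : ((P.restrict S).restrict G).map (y s) =
        (P (G ∩ {ω | k s ω = i}) * κ) • I.rew (episode hs) a c := by
      ext B hB
      rw [Measure.map_apply hy hB, Measure.restrict_apply (hy hB),
        Measure.restrict_apply ((hy hB).inter hGm), Measure.smul_apply, smul_eq_mul,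
        ← hr.law_step hs hG i a c hB]
      congr 1
      ext ω
      simp only [hS, Set.mem_inter_iff, Set.mem_preimage, Set.mem_ofPred_eq]
      tauto
    rw [← lintegral_map hg hy, hmap, lintegral_smul_measure, smul_eq_mul]
    ring
  have hmeas : ((P.restrict S).withDensity fun ω => g (y s ω)).trim (F.le s) =
      (κ * (∫⁻ z, g z ∂(I.rew (episode hs) a c))) •
        (P.restrict {ω | k s ω = i}).trim (F.le s) := by
    refine @Measure.ext _ (F s) _ _ fun G hG => ?_
    rw [trim_measurableSet_eq _ hG, withDensity_apply _ (F.le s _ hG), key G hG,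
      Measure.smul_apply, trim_measurableSet_eq _ hG, Measure.restrict_apply (F.le s _ hG),
      smul_eq_mul]
  have h1 := lintegral_trim (μ := (P.restrict S).withDensity fun ω => g (y s ω)) (F.le s) hH
  rw [hmeas, lintegral_withDensity_eq_lintegral_mul _ hgy (hH.mono (F.le s) le_rfl),
    lintegral_smul_measure, lintegral_trim (F.le s) hH, smul_eq_mul] at h1
  rw [h1]
  refine lintegral_congr fun ω => ?_
  simp [mul_comm]

lemma ae_rew_mem {s : ℕ} (hs : s < E * T) : ∀ᵐ ω ∂P, y s ω ∈ Set.Icc (0 : ℝ) 1 := by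
  have h : ∀ i a c, P {ω | k s ω = i ∧ x s ω = a ∧ v s ω = c ∧ y s ω ∈ (Set.Icc (0 : ℝ) 1)ᶜ} = 0 := by
    intro i a c
    have := hr.law_step hs (@MeasurableSet.univ _ (F s)) i a c (B := (Set.Icc (0 : ℝ) 1)ᶜ)
      measurableSet_Icc.compl
    rw [Set.univ_inter] at this
    rw [this, show I.rew (episode hs) a c (Set.Icc (0 : ℝ) 1)ᶜ = 0 from I.rew_supp _ a c, mul_zero]
  have h' : P (⋃ i, ⋃ a, ⋃ c,
      {ω | k s ω = i ∧ x s ω = a ∧ v s ω = c ∧ y s ω ∈ (Set.Icc (0 : ℝ) 1)ᶜ}) = 0 :=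
    measure_iUnion_null fun i => measure_iUnion_null fun a => measure_iUnion_null fun c => h i a c
  refine measure_mono_null (fun ω hω => ?_) h'
  simp only [Set.mem_iUnion]
  exact ⟨k s ω, x s ω, v s ω, rfl, rfl, rfl, hω⟩

lemma lintegral_eq_sum (s : ℕ) (f : Ω → ENNReal) :
    ∫⁻ ω, f ω ∂P = ∑ i, ∑ a, ∑ c,
      ∫⁻ ω in {ω | k s ω = i ∧ x s ω = a ∧ v s ω = c}, f ω ∂P := by
  have hU : (Set.univ : Set Ω) = ⋃ q : Fin N × X × V,
      {ω | k s ω = q.1 ∧ x s ω = q.2.1 ∧ v s ω = q.2.2} := by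
    ext ω
    simp only [Set.mem_univ, Set.mem_iUnion, true_iff]
    exact ⟨(k s ω, x s ω, v s ω), rfl, rfl, rfl⟩
  rw [← setLIntegral_univ, hU, lintegral_iUnion (fun q => hr.measurableSet_step s _ _ _)]
  · rw [tsum_fintype, Fintype.sum_prod_type]
    simp only [Fintype.sum_prod_type]
  · intro q q' hqq
    refine Set.disjoint_left.2 fun ω h h' => hqq ?_
    exact Prod.ext (h.1.symm.trans h'.1) (Prod.ext (h.2.1.symm.trans h'.2.1) (h.2.2.symm.trans h'.2.2))

/-- A criterion for `ExpLeOne` at a step of a run, for exponents that are affine in the reward. -/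
theorem expLeOne {s : ℕ} (hs : s < E * T) {A B : Fin N → X → V → Ω → ℝ}
    (hA : ∀ i a c, Measurable[F s] (A i a c)) (hB : ∀ i a c, Measurable[F s] (B i a c))
    (hle : ∀ i ω, ∑ a, ∑ c, I.ctx (episode hs) a * I.pol i a c *
      ((1 - I.rewMean (episode hs) a c) * Real.exp (B i a c ω)
        + I.rewMean (episode hs) a c * Real.exp (A i a c ω + B i a c ω)) ≤ 1) :
    ExpLeOne P (F s) fun ω =>
      A (k s ω) (x s ω) (v s ω) ω * y s ω + B (k s ω) (x s ω) (v s ω) ω := by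
  intro H hH
  set e := episode hs
  have hmE : ∀ f : Ω → ℝ, Measurable[F s] f →
      Measurable[F s] fun ω => ENNReal.ofReal (Real.exp (f ω)) := fun f hf =>
    ENNReal.measurable_ofReal.comp (Real.measurable_exp.comp hf)
  have hw : ∀ i a c, 0 ≤ I.ctx e a * I.pol i a c := fun i a c =>
    mul_nonneg ((I.ctx_mem e).1 a) ((I.pol_mem i a).1 c)
  have hcell : ∀ i a c, ∫⁻ ω in {ω | k s ω = i ∧ x s ω = a ∧ v s ω = c}, H ω *
      ENNReal.ofReal (Real.exp (A (k s ω) (x s ω) (v s ω) ω * y s ω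
        + B (k s ω) (x s ω) (v s ω) ω)) ∂P ≤
      ∫⁻ ω in {ω | k s ω = i}, H ω * ENNReal.ofReal (I.ctx e a * I.pol i a c *
      ((1 - I.rewMean e a c) * Real.exp (B i a c ω)
        + I.rewMean e a c * Real.exp (A i a c ω + B i a c ω))) ∂P := by
    intro i a c
    have hHB : Measurable[F s] fun ω => H ω * ENNReal.ofReal (Real.exp (B i a c ω)) :=
      hH.mul (hmE _ (hB i a c))
    have hHAB : Measurable[F s] fun ω =>
        H ω * ENNReal.ofReal (Real.exp (A i a c ω + B i a c ω)) :=
      hH.mul (hmE _ ((hA i a c).add (hB i a c)))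
    have e1 := hr.setLIntegral_step hs hHB
      (g := fun z => ENNReal.ofReal (1 - z)) (by fun_prop) i a c
    have e2 := hr.setLIntegral_step hs hHAB
      (g := fun z => ENNReal.ofReal z) (by fun_prop) i a c
    rw [lintegral_one_sub_rew] at e1
    rw [lintegral_rew] at e2
    have hy := hr.measurable_rew s
    calc _ ≤ ∫⁻ ω in {ω | k s ω = i ∧ x s ω = a ∧ v s ω = c},
          (H ω * ENNReal.ofReal (Real.exp (B i a c ω)) * ENNReal.ofReal (1 - y s ω)
          + H ω * ENNReal.ofReal (Real.exp (A i a c ω + B i a c ω)) * ENNReal.ofReal (y s ω)) ∂P := by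
          refine lintegral_mono_ae ?_
          filter_upwards [ae_restrict_of_ae (hr.ae_rew_mem hs),
            ae_restrict_mem (hr.measurableSet_step s i a c)] with ω hyω hω
          obtain ⟨rfl, rfl, rfl⟩ := hω
          rw [mul_assoc, mul_assoc, ← mul_add, ← ENNReal.ofReal_mul (Real.exp_pos _).le,
            ← ENNReal.ofReal_mul (Real.exp_pos _).le, ← ENNReal.ofReal_add
              (mul_nonneg (Real.exp_pos _).le (sub_nonneg.2 hyω.2))
              (mul_nonneg (Real.exp_pos _).le hyω.1)]
          gcongr
          set α := A (k s ω) (x s ω) (v s ω) ω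
          set β := B (k s ω) (x s ω) (v s ω) ω
          have hconv := convexOn_exp.2 (Set.mem_univ β) (Set.mem_univ (α + β))
            (sub_nonneg.2 hyω.2) hyω.1 (by ring)
          simp only [smul_eq_mul] at hconv
          calc Real.exp (α * y s ω + β) = Real.exp ((1 - y s ω) * β + y s ω * (α + β)) := by
                congr 1; ring
            _ ≤ _ := hconv
            _ = _ := by ring
      _ = _ := by
          have hB' : Measurable fun ω => H ω * ENNReal.ofReal (Real.exp (B i a c ω)) :=
            hHB.mono (F.le s) le_rfl
          have hAB' : Measurable fun ω => H ω * ENNReal.ofReal (Real.exp (A i a c ω + B i a c ω)) :=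
            hHAB.mono (F.le s) le_rfl
          have hBy : Measurable fun ω =>
              H ω * ENNReal.ofReal (Real.exp (B i a c ω)) * ENNReal.ofReal (1 - y s ω) :=
            hB'.mul (by fun_prop)
          rw [lintegral_add_left hBy, e1, e2, ← lintegral_const_mul _ hB',
            ← lintegral_const_mul _ hAB', ← lintegral_add_left (hB'.const_mul _)]
          refine lintegral_congr fun ω => ?_
          have h0 := rewMean_nonneg I e a c
          have h1 := sub_nonneg.2 (rewMean_le_one I e a c)
          rw [ENNReal.ofReal_mul (hw i a c), ENNReal.ofReal_add (mul_nonneg h1 (Real.exp_pos _).le)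
            (mul_nonneg h0 (Real.exp_pos _).le), ENNReal.ofReal_mul h1, ENNReal.ofReal_mul h0]
          ring
  have hmt : ∀ i a c, Measurable[F s] fun ω => H ω * ENNReal.ofReal (I.ctx e a * I.pol i a c *
      ((1 - I.rewMean e a c) * Real.exp (B i a c ω)
        + I.rewMean e a c * Real.exp (A i a c ω + B i a c ω))) := by
    intro i a c
    refine hH.mul (ENNReal.measurable_ofReal.comp ?_)
    exact (((Real.measurable_exp.comp (hB i a c)).const_mul _).add
      ((Real.measurable_exp.comp ((hA i a c).add (hB i a c))).const_mul _)).const_mul _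
  rw [hr.lintegral_eq_sum s]
  calc _ ≤ ∑ i, ∑ a, ∑ c, ∫⁻ ω in {ω | k s ω = i}, H ω *
        ENNReal.ofReal (I.ctx e a * I.pol i a c *
      ((1 - I.rewMean e a c) * Real.exp (B i a c ω)
        + I.rewMean e a c * Real.exp (A i a c ω + B i a c ω))) ∂P :=
        Finset.sum_le_sum fun i _ => Finset.sum_le_sum fun a _ => Finset.sum_le_sum fun c _ =>
          hcell i a c
    _ ≤ ∑ i, ∫⁻ ω in {ω | k s ω = i}, H ω ∂P := by
        refine Finset.sum_le_sum fun i _ => ?_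
        have hmt' := fun a c => (hmt i a c).mono (F.le s) le_rfl
        simp_rw [← lintegral_finsetSum _ fun c _ => hmt' _ c]
        rw [← lintegral_finsetSum _ fun a _ => Finset.measurable_sum _ fun c _ => hmt' a c]
        refine lintegral_mono fun ω => ?_
        simp only [← Finset.mul_sum]
        refine mul_le_of_le_one_right zero_le ?_
        have hn : ∀ a c, 0 ≤ I.ctx e a * I.pol i a c *
            ((1 - I.rewMean e a c) * Real.exp (B i a c ω)
            + I.rewMean e a c * Real.exp (A i a c ω + B i a c ω)) := fun a c => by
          have h0 := rewMean_nonneg I e a c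
          have h1 := sub_nonneg.2 (rewMean_le_one I e a c)
          have := hw i a c
          positivity
        simp_rw [← ENNReal.ofReal_sum_of_nonneg fun c (_ : c ∈ Finset.univ) => hn _ c]
        rw [← ENNReal.ofReal_sum_of_nonneg fun a _ => Finset.sum_nonneg fun c _ => hn a c]
        exact ENNReal.ofReal_le_one.2 (hle i ω)
    _ = ∫⁻ ω, H ω ∂P := by
        have hU : (Set.univ : Set Ω) = ⋃ i, {ω | k s ω = i} := by
          ext ω; simp
        rw [← setLIntegral_univ (μ := P), hU,
          lintegral_iUnion (fun i => F.le s _ (hr.choice_meas s i)), tsum_fintype]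
        intro i j hij
        exact Set.disjoint_left.2 fun ω h h' => hij (h.symm.trans h')

end IsOnlineRun

end Run

section Bernoulli

variable {X V : Type*} [Fintype X] [Fintype V] {N E : ℕ}

lemma mean_eq (I : Bandit X V N E) (e : Fin E) (i : Fin N) :
    I.mean e i = ∑ a, ∑ d, I.ctx e a * I.pol i a d * I.rewMean e a d := by
  unfold Bandit.mean Bandit.rewMean
  simp only [Finset.mul_sum, mul_assoc]

lemma sum_ctx_mul_pol (I : Bandit X V N E) (e : Fin E) (i : Fin N) :
    ∑ a, ∑ c, I.ctx e a * I.pol i a c = 1 := by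
  simp only [← Finset.mul_sum, (I.pol_mem i _).2, mul_one]
  exact (I.ctx_mem e).2

lemma bernoulli_hoeffding (I : Bandit X V N E) (e : Fin E) (i : Fin N) {α β : X → V → ℝ}
    {lo hi c : ℝ} (h1 : ∀ a d, lo ≤ β a d) (h2 : ∀ a d, β a d ≤ hi)
    (h3 : ∀ a d, lo ≤ α a d + β a d) (h4 : ∀ a d, α a d + β a d ≤ hi) (hc : hi - lo ≤ c)
    (hmean : ∑ a, ∑ d, I.ctx e a * I.pol i a d * (β a d + I.rewMean e a d * α a d) ≤ 0)
    {l : ℝ} (hl : 0 ≤ l) :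
    ∑ a, ∑ d, I.ctx e a * I.pol i a d *
      ((1 - I.rewMean e a d) * Real.exp (l * β a d - l ^ 2 * c ^ 2 / 8)
        + I.rewMean e a d * Real.exp (l * α a d + (l * β a d - l ^ 2 * c ^ 2 / 8))) ≤ 1 := by
  have h := finite_hoeffding (ι := X × V × Bool)
    (p := fun q => I.ctx e q.1 * I.pol i q.1 q.2.1 *
      (bif q.2.2 then I.rewMean e q.1 q.2.1 else 1 - I.rewMean e q.1 q.2.1))
    (z := fun q => bif q.2.2 then α q.1 q.2.1 + β q.1 q.2.1 else β q.1 q.2.1)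
    (lo := lo) (hi := hi) (c := c) ?_ ?_ ?_ ?_ hc ?_ hl
  · simp only [Fintype.sum_prod_type, Fintype.sum_bool, cond_true, cond_false] at h
    refine le_trans (le_of_eq ?_) h
    refine Finset.sum_congr rfl fun a _ => Finset.sum_congr rfl fun d _ => ?_
    rw [show l * (α a d + β a d) - l ^ 2 * c ^ 2 / 8
      = l * α a d + (l * β a d - l ^ 2 * c ^ 2 / 8) by ring]
    ring
  · rintro ⟨a, d, _ | _⟩
    · exact mul_nonneg (mul_nonneg ((I.ctx_mem e).1 a) ((I.pol_mem i a).1 d))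
        (sub_nonneg.2 (rewMean_le_one I e a d))
    · exact mul_nonneg (mul_nonneg ((I.ctx_mem e).1 a) ((I.pol_mem i a).1 d))
        (rewMean_nonneg I e a d)
  · simp only [Fintype.sum_prod_type, Fintype.sum_bool, cond_true, cond_false, ← mul_add,
      add_sub_cancel, mul_one]
    exact sum_ctx_mul_pol I e i
  · rintro ⟨a, d, _ | _⟩
    exacts [h1 a d, h3 a d]
  · rintro ⟨a, d, _ | _⟩
    exacts [h2 a d, h4 a d]
  · simp only [Fintype.sum_prod_type, Fintype.sum_bool, cond_true, cond_false]
    refine le_trans (le_of_eq ?_) hmean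
    refine Finset.sum_congr rfl fun a _ => Finset.sum_congr rfl fun d _ => ?_
    ring

end Bernoulli

/-- Empirical policies as a function of the finitely many steps used. -/
lemma exists_empirical_eq {X V : Type*} [DecidableEq X] [DecidableEq V] {N : ℕ} (n : ℕ) : ∃ g : (Fin n → Fin N × X × V) → Fin N → X → V → ℝ,
    ∀ ks xs vs, empirical n ks xs vs = g fun s => (ks s, xs s, vs s) := by
  refine ⟨fun d i a c =>
    (∑ s, if (d s).1 = i ∧ (d s).2.1 = a ∧ (d s).2.2 = c then (1 : ℝ) else 0) /
      ∑ s, if (d s).1 = i ∧ (d s).2.1 = a then (1 : ℝ) else 0, fun ks xs vs => ?_⟩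
  funext i a c
  simp only [empirical, Finset.card_filter, Nat.cast_sum, Nat.cast_ite, Nat.cast_one,
    Nat.cast_zero]
  rw [Finset.sum_range, Finset.sum_range]

section Concentration

variable {X V : Type*} [Fintype X] [Fintype V] [DecidableEq X] [DecidableEq V] {N E : ℕ}
  {b : Params} {I : Bandit X V N E} {T m : ℕ} {Ω : Type*} {mΩ : MeasurableSpace Ω}
  {P : Measure Ω} {F : Filtration ℕ mΩ} {k : ℕ → Ω → Fin N} {x : ℕ → Ω → X} {v : ℕ → Ω → V}
  {y : ℕ → Ω → ℝ}

namespace IsOnlineRun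

variable (hr : IsOnlineRun b I T m P F k x v y)
include hr

lemma measurable_select {s τ : ℕ} (hs : s < τ) {β : Type*} [MeasurableSpace β]
    {A : Fin N → X → V → Ω → β}
    (hA : ∀ i a c, Measurable[F τ] (A i a c)) :
    Measurable[F τ] fun ω => A (k s ω) (x s ω) (v s ω) ω := by
  intro S hS
  have : (fun ω => A (k s ω) (x s ω) (v s ω) ω) ⁻¹' S = ⋃ i, ⋃ a, ⋃ c,
      ({ω | k s ω = i} ∩ ({ω | x s ω = a} ∩ ({ω | v s ω = c} ∩ A i a c ⁻¹' S))) := by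
    ext ω
    simp
  rw [this]
  exact MeasurableSet.iUnion fun i => MeasurableSet.iUnion fun a => MeasurableSet.iUnion fun c =>
    (hr.measurable_choice τ s hs.le i).inter ((hr.ctx_meas τ s hs a).inter
      ((hr.act_meas τ s hs c).inter (hA i a c hS)))

lemma measurable_past {n τ : ℕ} (hn : n ≤ τ) {β : Type*} [MeasurableSpace β]
    (f : (Fin n → Fin N × X × V) → β) :
    Measurable[F τ] fun ω => f fun s => (k s ω, x s ω, v s ω) := by
  intro S _
  have : (fun ω => f fun s => (k s ω, x s ω, v s ω)) ⁻¹' S = ⋃ d : {d // f d ∈ S}, ⋂ s : Fin n,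
      ({ω | k s ω = (d.1 s).1} ∩ ({ω | x s ω = (d.1 s).2.1} ∩ {ω | v s ω = (d.1 s).2.2})) := by
    ext ω
    simp only [Set.mem_preimage, Set.mem_iUnion, Set.mem_iInter, Set.mem_inter_iff,
      Set.mem_ofPred_eq]
    constructor
    · intro h
      exact ⟨⟨_, h⟩, fun s => ⟨rfl, rfl, rfl⟩⟩
    · rintro ⟨⟨d, hd⟩, h⟩
      have : (fun s : Fin n => (k s ω, x s ω, v s ω)) = d := by
        funext s
        exact Prod.ext (h s).1 (Prod.ext (h s).2.1 (h s).2.2)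
      rwa [this]
  rw [this]
  refine MeasurableSet.iUnion fun d => MeasurableSet.iInter fun s => ?_
  have hs : (s : ℕ) < τ := lt_of_lt_of_le s.2 hn
  exact (hr.measurable_choice τ s hs.le _).inter ((hr.ctx_meas τ s hs _).inter
    (hr.act_meas τ s hs _))

lemma measurable_empirical {n τ : ℕ} (hn : n ≤ τ) {β : Type*} [MeasurableSpace β]
    (f : (Fin N → X → V → ℝ) → β) :
    Measurable[F τ] fun ω =>
      f (empirical n (fun s => k s ω) (fun s => x s ω) (fun s => v s ω)) := by
  obtain ⟨g, hg⟩ := exists_empirical_eq (N := N) (X := X) (V := V) n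
  simp only [hg]
  exact hr.measurable_past hn (f ∘ g)

end IsOnlineRun

namespace IsOnlineRun

variable [IsProbabilityMeasure P] (hr : IsOnlineRun b I T m P F k x v y)
include hr

/-- Deviation of a sum along an episode whose increments depend on the empirical policies. -/
theorem deviation_le {e : Fin E} {n s₀ t : ℕ} (hn : n ≤ s₀) (hs₀ : (e : ℕ) * T ≤ s₀)
    (hst : s₀ + t ≤ (e + 1) * T) (ht : 1 ≤ t) {c : ℝ} (hc : 0 < c)
    {α β : (Fin N → X → V → ℝ) → Fin N → X → V → ℝ}
    (hb : ∀ ph, Accurate b I.pol ph → ∀ i, ∃ lo hi, hi - lo ≤ c ∧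
      (∀ a d, lo ≤ β ph i a d ∧ β ph i a d ≤ hi ∧ lo ≤ α ph i a d + β ph i a d ∧
        α ph i a d + β ph i a d ≤ hi) ∧
      ∑ a, ∑ d, I.ctx e a * I.pol i a d * (β ph i a d + I.rewMean e a d * α ph i a d) ≤ 0) :
    P {ω | Accurate b I.pol (empirical n (fun s => k s ω) (fun s => x s ω) (fun s => v s ω)) ∧
      c * √(t * Real.log t) ≤ ∑ r ∈ Finset.range t,
        (α (empirical n (fun s => k s ω) (fun s => x s ω) (fun s => v s ω))
            (k (s₀ + r) ω) (x (s₀ + r) ω) (v (s₀ + r) ω) * y (s₀ + r) ω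
          + β (empirical n (fun s => k s ω) (fun s => x s ω) (fun s => v s ω))
            (k (s₀ + r) ω) (x (s₀ + r) ω) (v (s₀ + r) ω))}
      ≤ ENNReal.ofReal (1 / (t : ℝ) ^ 2) := by
  classical
  set ph : Ω → Fin N → X → V → ℝ :=
    fun ω => empirical n (fun s => k s ω) (fun s => x s ω) (fun s => v s ω) with hph
  have ht0 : (0 : ℝ) < t := by exact_mod_cast ht
  have hlog : 0 ≤ Real.log t := Real.log_nonneg (by exact_mod_cast ht)
  set u := c * √(t * Real.log t) with hu
  have hu2 : u ^ 2 = c ^ 2 * (t * Real.log t) := by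
    rw [hu, mul_pow, Real.sq_sqrt (by positivity)]
  set l := 4 * u / (t * c ^ 2) with hl
  have hl0 : 0 ≤ l := by positivity
  let A : Fin N → X → V → Ω → ℝ := fun i a d ω =>
    if Accurate b I.pol (ph ω) then l * α (ph ω) i a d else 0
  let B : Fin N → X → V → Ω → ℝ := fun i a d ω =>
    if Accurate b I.pol (ph ω) then l * β (ph ω) i a d - l ^ 2 * c ^ 2 / 8 else 0
  have hA : ∀ τ, n ≤ τ → ∀ i a d, Measurable[F τ] (A i a d) := fun τ hτ i a d =>
    hr.measurable_empirical hτ fun q => if Accurate b I.pol q then l * α q i a d else 0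
  have hB : ∀ τ, n ≤ τ → ∀ i a d, Measurable[F τ] (B i a d) := fun τ hτ i a d =>
    hr.measurable_empirical hτ fun q =>
      if Accurate b I.pol q then l * β q i a d - l ^ 2 * c ^ 2 / 8 else 0
  have hlt : ∀ r < t, s₀ + r < E * T := fun r hrt => by
    have : ((e : ℕ) + 1) * T ≤ E * T := Nat.mul_le_mul_right _ e.2
    omega
  have hep : ∀ r (hrt : r < t), episode (hlt r hrt) = e := fun r hrt => by
    apply Fin.ext
    simp only [episode]
    exact Nat.div_eq_of_lt_le (by omega) (by omega)
  have hmain := measure_sum_ge_le (P := P) (F := F) (s₀ := s₀) (t := t)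
    (Ψ := fun r ω => A (k (s₀ + r) ω) (x (s₀ + r) ω) (v (s₀ + r) ω) ω * y (s₀ + r) ω
      + B (k (s₀ + r) ω) (x (s₀ + r) ω) (v (s₀ + r) ω) ω) ?_ ?_ (2 * Real.log t)
  · have he : Real.exp (-(2 * Real.log t)) = 1 / (t : ℝ) ^ 2 := by
      rw [Real.exp_neg, mul_comm, Real.exp_mul, Real.exp_log ht0, one_div]
      norm_cast
    rw [he] at hmain
    refine (measure_mono ?_).trans hmain
    rintro ω ⟨hacc, hω⟩
    simp only [Set.mem_ofPred_eq, A, B]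
    change Accurate b I.pol (ph ω) at hacc
    change u ≤ ∑ r ∈ Finset.range t, (α (ph ω) _ _ _ * _ + β (ph ω) _ _ _) at hω
    simp only [if_pos hacc]
    have e1 : ∀ r, l * α (ph ω) (k (s₀ + r) ω) (x (s₀ + r) ω) (v (s₀ + r) ω) * y (s₀ + r) ω
        + (l * β (ph ω) (k (s₀ + r) ω) (x (s₀ + r) ω) (v (s₀ + r) ω) - l ^ 2 * c ^ 2 / 8)
        = l * (α (ph ω) (k (s₀ + r) ω) (x (s₀ + r) ω) (v (s₀ + r) ω) * y (s₀ + r) ω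
          + β (ph ω) (k (s₀ + r) ω) (x (s₀ + r) ω) (v (s₀ + r) ω)) - l ^ 2 * c ^ 2 / 8 :=
      fun r => by ring
    simp only [e1, Finset.sum_sub_distrib, ← Finset.mul_sum, Finset.sum_const, Finset.card_range,
      nsmul_eq_mul]
    have e2 : 2 * Real.log t = l * u - t * (l ^ 2 * c ^ 2 / 8) := by
      rw [hl]
      field_simp
      rw [hu2]
      ring
    rw [e2]
    gcongr
  · intro r hrt
    exact ((hr.measurable_select (by omega) (hA _ (by omega))).mul
      (hr.rew_meas _ _ (by omega))).add (hr.measurable_select (by omega) (hB _ (by omega)))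
  · intro r hrt
    refine hr.expLeOne (hlt r hrt) (hA _ (by omega)) (hB _ (by omega)) fun i ω => ?_
    rw [hep r hrt]
    by_cases hacc : Accurate b I.pol (ph ω)
    · obtain ⟨lo, hi, h1, h2, h3⟩ := hb _ hacc i
      simp only [A, B, if_pos hacc]
      exact bernoulli_hoeffding I e i (fun a d => (h2 a d).1) (fun a d => (h2 a d).2.1)
        (fun a d => (h2 a d).2.2.1) (fun a d => (h2 a d).2.2.2) h1 h3 hl0
    · simp only [A, B, if_neg hacc, add_zero, Real.exp_zero, mul_one, sub_add_cancel]
      exact (sum_ctx_mul_pol I e i).le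

/-- The optimistic estimate of the mean reward of an expert rarely exceeds it much. -/
theorem overSum_le (hadm : b.Admissible) (hπ : PolicyBounds b I.pol) {e : Fin E} {n s₀ t : ℕ}
    (hn : n ≤ s₀) (hs₀ : (e : ℕ) * T ≤ s₀) (hst : s₀ + t ≤ (e + 1) * T) (ht : 1 ≤ t)
    (j : Fin N) :
    P {ω | Accurate b I.pol (empirical n (fun s => k s ω) (fun s => x s ω) (fun s => v s ω)) ∧
      osc b * √(t * Real.log t) ≤
        overSum b (empirical n (fun s => k s ω) (fun s => x s ω) (fun s => v s ω)) (I.mean e j) j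
          (fun s => k (s₀ + s) ω) (fun s => x (s₀ + s) ω) (fun s => v (s₀ + s) ω)
          (fun s => y (s₀ + s) ω) t}
      ≤ ENNReal.ofReal (1 / (t : ℝ) ^ 2) := by
  have := hr.deviation_le (e := e) hn hs₀ hst ht (osc_pos hadm)
    (α := fun ph i a d => rLow b ph j i a d / MLow b ph j i)
    (β := fun ph i a d => -I.mean e j / MLow b ph j i) ?_
  · refine le_trans (measure_mono fun ω hω => ?_) this
    refine ⟨hω.1, hω.2.trans (le_of_eq ?_)⟩
    refine Finset.sum_congr rfl fun r _ => ?_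
    ring
  · intro ph hph i
    have hM := MLow_pos hadm hπ hph j i
    have hρ := hadm.one_le_ρ
    refine ⟨(-(1 / 4) - I.mean e j) / MLow b ph j i,
      ((1 - b.pV) / b.pV - I.mean e j) / MLow b ph j i, ?_, fun a d => ⟨?_, ?_, ?_, ?_⟩, ?_⟩
    · rw [← sub_div]
      unfold osc
      exact div_le_div₀ (by linarith) (by linarith) mMin_pos (mMin_le_MLow hadm hπ hph j i)
    · exact div_le_div_of_nonneg_right (by linarith) hM.le
    · exact div_le_div_of_nonneg_right (by linarith) hM.le
    · rw [← add_div]; exact div_le_div_of_nonneg_right (by linarith [rLow_ge hadm hπ hph j i a d]) hM.le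
    · rw [← add_div]; exact div_le_div_of_nonneg_right (by linarith [rLow_le hadm hπ hph j i a d]) hM.le
    · have key : ∀ a d, I.ctx e a * I.pol i a d *
          (-I.mean e j / MLow b ph j i + I.rewMean e a d * (rLow b ph j i a d / MLow b ph j i))
          ≤ (I.ctx e a * I.pol j a d * I.rewMean e a d
            - I.mean e j * (I.ctx e a * I.pol i a d)) / MLow b ph j i := by
        intro a d
        have h0 : 0 < I.pol i a d := hadm.pV_pos.trans_le (hπ.ge i a d)
        have h1 : I.pol i a d * rLow b ph j i a d ≤ I.pol j a d := by
          have := rLow_le_ratio hadm hπ hph j i a d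
          rw [le_div_iff₀ h0] at this; linarith
        have h2 := mul_nonneg ((I.ctx_mem e).1 a) (rewMean_nonneg I e a d)
        rw [le_div_iff₀ hM]
        field_simp
        nlinarith
      refine (Finset.sum_le_sum fun a _ => Finset.sum_le_sum fun d _ => key a d).trans ?_
      simp only [← Finset.sum_div, Finset.sum_sub_distrib, ← Finset.mul_sum]
      have hs := sum_ctx_mul_pol I e i
      simp only [← Finset.mul_sum] at hs
      have hm := mean_eq I e j
      rw [hs, ← hm]
      simp

/-- The index of an expert rarely underestimates its mean reward. -/
theorem underSum_le (hadm : b.Admissible) (hπ : PolicyBounds b I.pol) {e : Fin E} {n s₀ t : ℕ}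
    (hn : n ≤ s₀) (hs₀ : (e : ℕ) * T ≤ s₀) (hst : s₀ + t ≤ (e + 1) * T) (ht : 1 ≤ t)
    (j : Fin N) :
    P {ω | Accurate b I.pol (empirical n (fun s => k s ω) (fun s => x s ω) (fun s => v s ω)) ∧
      osc b * √(t * Real.log t) ≤
        underSum b (empirical n (fun s => k s ω) (fun s => x s ω) (fun s => v s ω)) (I.mean e j) j
          (fun s => k (s₀ + s) ω) (fun s => x (s₀ + s) ω) (fun s => v (s₀ + s) ω)
          (fun s => y (s₀ + s) ω) t}
      ≤ ENNReal.ofReal (1 / (t : ℝ) ^ 2) := by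
  set δ := b.γ * b.pV / 2 with hδ
  have hδ0 : 0 ≤ δ := by have := hadm.γ_mul_pV_pos; positivity
  have := hr.deviation_le (e := e) hn hs₀ hst ht (osc_pos hadm)
    (α := fun ph i a d => -rLow b ph j i a d / MLow b ph j i)
    (β := fun ph i a d => (I.mean e j - δ) / MLow b ph j i) ?_
  · refine le_trans (measure_mono fun ω hω => ?_) this
    refine ⟨hω.1, hω.2.trans (le_of_eq ?_)⟩
    refine Finset.sum_congr rfl fun r _ => ?_
    ring
  · intro ph hph i
    have hM := MLow_pos hadm hπ hph j i
    have hρ := hadm.one_le_ρ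
    refine ⟨(I.mean e j - δ - (1 - b.pV) / b.pV) / MLow b ph j i,
      (I.mean e j - δ + 1 / 4) / MLow b ph j i, ?_, fun a d => ⟨?_, ?_, ?_, ?_⟩, ?_⟩
    · rw [← sub_div]
      unfold osc
      exact div_le_div₀ (by linarith) (by linarith) mMin_pos (mMin_le_MLow hadm hπ hph j i)
    · exact div_le_div_of_nonneg_right (by linarith) hM.le
    · exact div_le_div_of_nonneg_right (by linarith) hM.le
    · rw [← add_div]; exact div_le_div_of_nonneg_right (by linarith [rLow_le hadm hπ hph j i a d]) hM.le
    · rw [← add_div]; exact div_le_div_of_nonneg_right (by linarith [rLow_ge hadm hπ hph j i a d]) hM.le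
    · have key : ∀ a d, I.ctx e a * I.pol i a d *
          ((I.mean e j - δ) / MLow b ph j i
            + I.rewMean e a d * (-rLow b ph j i a d / MLow b ph j i))
          ≤ (I.mean e j * (I.ctx e a * I.pol i a d)
            - I.ctx e a * I.pol j a d * I.rewMean e a d) / MLow b ph j i := by
        intro a d
        have h0 : 0 < I.pol i a d := hadm.pV_pos.trans_le (hπ.ge i a d)
        have h1 : I.pol j a d - I.pol i a d * δ ≤ I.pol i a d * rLow b ph j i a d := by
          have := ratio_sub_le_rLow hadm hπ hph j i a d
          have h3 := mul_le_mul_of_nonneg_left this h0.le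
          rw [mul_sub, mul_div_cancel₀ _ h0.ne'] at h3
          exact h3
        have h2 := mul_nonneg ((I.ctx_mem e).1 a) (rewMean_nonneg I e a d)
        have h4 : I.ctx e a * I.pol i a d * I.rewMean e a d * δ ≤ I.ctx e a * I.pol i a d * 1 * δ := by
          have := (I.ctx_mem e).1 a
          gcongr
          exact rewMean_le_one I e a d
        have h5 := mul_le_mul_of_nonneg_left h1 h2
        rw [le_div_iff₀ hM]
        field_simp
        linarith
      refine (Finset.sum_le_sum fun a _ => Finset.sum_le_sum fun d _ => key a d).trans ?_
      simp only [← Finset.sum_div, Finset.sum_sub_distrib, ← Finset.mul_sum]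
      have hs := sum_ctx_mul_pol I e i
      simp only [← Finset.mul_sum] at hs
      have hm := mean_eq I e j
      rw [hs, ← hm]
      simp

/-- With accurate empirical policies, a suboptimal expert is rarely played late in an episode. -/
theorem measure_play_le (hadm : b.Admissible) (hπ : PolicyBounds b I.pol) {e : Fin E} {t : ℕ}
    (hst : max (e * T) (N * m) + t < (e + 1) * T) {i : Fin N} (hi : b.γ * b.pV < I.gap e i)
    (hi1 : I.gap e i ≤ 1) (htc : tClip b I.pol ≤ t) (htau : tau b (I.gap e i) ≤ t) :
    P {ω | Accurate b I.pol
        (empirical (N * m) (fun s => k s ω) (fun s => x s ω) (fun s => v s ω)) ∧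
        k (max (e * T) (N * m) + t) ω = i} ≤ ENNReal.ofReal (2 / (t : ℝ) ^ 2) := by
  have ht2 := (tau_spec b _).1.trans htau
  have : Nonempty (Fin N) := ⟨i⟩
  obtain ⟨j, hj⟩ := exists_eq_ciSup_of_finite (f := I.mean e)
  have hgap : I.mean e i = I.mean e j - I.gap e i := by
    unfold Bandit.gap Bandit.best; rw [hj]; ring
  set s₀ := max (e * T) (N * m) with hs₀
  have h1 := hr.underSum_le hadm hπ (e := e) (n := N * m) (s₀ := s₀) (t := t)
    (le_max_right _ _) (le_max_left _ _) hst.le (by omega) j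
  have h2 := hr.overSum_le hadm hπ (e := e) (n := N * m) (s₀ := s₀) (t := t)
    (le_max_right _ _) (le_max_left _ _) hst.le (by omega) i
  have h3 : ENNReal.ofReal (2 / (t : ℝ) ^ 2) =
      ENNReal.ofReal (1 / (t : ℝ) ^ 2) + ENNReal.ofReal (1 / (t : ℝ) ^ 2) := by
    rw [← ENNReal.ofReal_add (by positivity) (by positivity)]; congr 1; ring
  rw [h3]
  refine le_trans (measure_mono fun ω hω => ?_)
    ((measure_union_le _ _).trans (add_le_add h1 h2))
  by_contra hnot
  simp only [Set.mem_union, Set.mem_ofPred_eq, not_or, not_and, not_le] at hnot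
  have hX : Nonempty X := ⟨x 0 ω⟩
  have hV : Nonempty V := ⟨v 0 ω⟩
  have hlt := U_lt_U hadm hπ hω.1 hi hi1 htc htau (hnot.1 hω.1) (hgap ▸ hnot.2 hω.1)
  have hle : (e : ℕ) * T ≤ s₀ := le_max_left _ _
  have he : (e : ℕ) * T + (s₀ + t - e * T) = s₀ + t := by omega
  have hb : s₀ + t - e * T < T := by rw [add_mul, one_mul] at hst; omega
  have hucb := hr.ucb e (s₀ + t - e * T) hb (by rw [he]; omega) ω j
  simp only [he] at hucb
  rw [← hs₀, hω.2, Nat.add_sub_cancel_left] at hucb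
  exact absurd hlt (not_lt.2 hucb)

end IsOnlineRun

end Concentration

/-! ### The sampling phase -/

lemma accurate_of_sums {X V : Type*} [Fintype X] [Fintype V] [DecidableEq X] [DecidableEq V]
    {N E : ℕ} {b : Params} {I : Bandit X V N E} {n : ℕ} {ks : ℕ → Fin N} {xs : ℕ → X} {vs : ℕ → V}
    (hpos : ∀ i a, 0 < ∑ s ∈ Finset.range n, (if ks s = i ∧ xs s = a then (1 : ℝ) else 0))
    (h1 : ∀ i a c, ∑ s ∈ Finset.range n, (if ks s = i ∧ xs s = a then
      ((if vs s = c then 1 else 0) - I.pol i a c) else 0) ≤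
        b.ξ * ∑ s ∈ Finset.range n, (if ks s = i ∧ xs s = a then (1 : ℝ) else 0))
    (h2 : ∀ i a c, ∑ s ∈ Finset.range n, (if ks s = i ∧ xs s = a then
      (I.pol i a c - (if vs s = c then 1 else 0)) else 0) ≤
        b.ξ * ∑ s ∈ Finset.range n, (if ks s = i ∧ xs s = a then (1 : ℝ) else 0)) :
    Accurate b I.pol (empirical n ks xs vs) := by
  have hemp : ∀ i a c, empirical n ks xs vs i a c =
      (∑ s ∈ Finset.range n, (if ks s = i ∧ xs s = a then (if vs s = c then (1 : ℝ) else 0) else 0)) /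
        ∑ s ∈ Finset.range n, (if ks s = i ∧ xs s = a then (1 : ℝ) else 0) := by
    intro i a c
    simp only [empirical, Finset.card_filter, Nat.cast_sum, Nat.cast_ite, Nat.cast_one,
      Nat.cast_zero, ← ite_and, and_assoc]
  have hsub : ∀ i a c, ∑ s ∈ Finset.range n, (if ks s = i ∧ xs s = a then
      ((if vs s = c then (1 : ℝ) else 0) - I.pol i a c) else 0) =
      (∑ s ∈ Finset.range n, (if ks s = i ∧ xs s = a then (if vs s = c then (1 : ℝ) else 0) else 0))
      - I.pol i a c * ∑ s ∈ Finset.range n, (if ks s = i ∧ xs s = a then (1 : ℝ) else 0) := by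
    intro i a c
    rw [Finset.mul_sum, ← Finset.sum_sub_distrib]
    refine Finset.sum_congr rfl fun s _ => ?_
    split_ifs <;> ring
  have hsub' : ∀ i a c, ∑ s ∈ Finset.range n, (if ks s = i ∧ xs s = a then
      (I.pol i a c - (if vs s = c then (1 : ℝ) else 0)) else 0) =
      -((∑ s ∈ Finset.range n, (if ks s = i ∧ xs s = a then (if vs s = c then (1 : ℝ) else 0) else 0))
      - I.pol i a c * ∑ s ∈ Finset.range n, (if ks s = i ∧ xs s = a then (1 : ℝ) else 0)) := by
    intro i a c
    rw [← hsub, ← Finset.sum_neg_distrib]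
    refine Finset.sum_congr rfl fun s _ => ?_
    split_ifs <;> ring
  intro i a
  have hp := hpos i a
  refine ⟨⟨fun c => ?_, ?_⟩, fun c => ?_⟩
  · unfold empirical; positivity
  · simp only [hemp, ← Finset.sum_div]
    rw [div_eq_one_iff_eq hp.ne', Finset.sum_comm]
    refine Finset.sum_congr rfl fun s _ => ?_
    split_ifs <;> simp
  · have e1 := h1 i a c
    have e2 := h2 i a c
    rw [hsub] at e1
    rw [hsub'] at e2
    rw [hemp, abs_le]
    constructor
    · rw [le_sub_iff_add_le, le_div_iff₀ hp]; linarith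
    · rw [sub_le_iff_le_add, div_le_iff₀ hp]; linarith

section Sampling

variable {X V : Type*} [Fintype X] [Fintype V] [DecidableEq X] [DecidableEq V] {N E : ℕ}
  {b : Params} {I : Bandit X V N E} {T m : ℕ} {Ω : Type*} {mΩ : MeasurableSpace Ω}
  {P : Measure Ω} {F : Filtration ℕ mΩ} {k : ℕ → Ω → Fin N} {x : ℕ → Ω → X} {v : ℕ → Ω → V}
  {y : ℕ → Ω → ℝ}

namespace IsOnlineRun

variable (hr : IsOnlineRun b I T m P F k x v y)
include hr

lemma sum_choice_eq (hm : 0 < m) (i : Fin N) (ω : Ω) :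
    ∑ s ∈ Finset.range (N * m), (if k s ω = i then (1 : ℝ) else 0) = m := by
  have h : ∀ s ∈ Finset.range (N * m), (k s ω = i ↔ s ∈ Finset.Ico (i * m) ((i + 1) * m)) := by
    intro s hs
    rw [← Fin.val_inj, hr.sampling s (Finset.mem_range.1 hs) ω, Nat.div_eq_iff hm,
      Finset.mem_Ico, add_mul]
    omega
  rw [← Finset.sum_filter, Finset.filter_congr h]
  have hsub : Finset.Ico ((i : ℕ) * m) ((i + 1) * m) ⊆ Finset.range (N * m) := by
    intro s hs
    have := (Finset.mem_Ico.1 hs).2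
    have h2 : ((i : ℕ) + 1) * m ≤ N * m := Nat.mul_le_mul_right _ i.2
    exact Finset.mem_range.2 (by omega)
  rw [Finset.filter_mem_eq_inter, Finset.inter_eq_right.2 hsub]
  simp [add_mul]

variable [IsProbabilityMeasure P]

/-- The Chernoff bound for sums of functions of expert, context and action. -/
lemma measure_discrete_sum_ge_le {n : ℕ} (hn : n ≤ E * T) {B : Fin N → X → V → ℝ}
    (hB : ∀ e i, ∑ a, ∑ c, I.ctx e a * I.pol i a c * Real.exp (B i a c) ≤ 1) (u : ℝ) :
    P {ω | u ≤ ∑ s ∈ Finset.range n, B (k s ω) (x s ω) (v s ω)} ≤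
      ENNReal.ofReal (Real.exp (-u)) := by
  have h := measure_sum_ge_le (P := P) (F := F) (s₀ := 0) (t := n)
    (Ψ := fun s ω => 0 * y (0 + s) ω + B (k (0 + s) ω) (x (0 + s) ω) (v (0 + s) ω)) ?_ ?_ u
  · simpa only [zero_mul, zero_add] using h
  · intro r _
    exact ((hr.rew_meas _ _ (by omega)).const_mul 0).add
      (hr.measurable_select (A := fun i a c _ => B i a c) (by omega)
        fun i a c => @measurable_const _ _ _ (F (0 + r + 1)) _)
  · intro r hrn
    refine hr.expLeOne (by omega : 0 + r < E * T) (A := fun _ _ _ _ => 0)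
      (B := fun i a c _ => B i a c) (fun i a c => @measurable_const _ _ _ (F (0 + r)) _)
      (fun i a c => @measurable_const _ _ _ (F (0 + r)) _) fun i ω => ?_
    simp only [zero_add, ← add_mul, sub_add_cancel, one_mul]
    exact hB _ i

/-- Few visits to a context are unlikely. -/
lemma measure_count_le (hI : I.Bounded b) (hm : 0 < m) (hn : N * m ≤ E * T) (i : Fin N) (a₀ : X)
    {n : ℝ} (hnm : n ≤ m * b.pX) :
    P {ω | ∑ s ∈ Finset.range (N * m), (if k s ω = i ∧ x s ω = a₀ then (1 : ℝ) else 0) ≤ n} ≤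
      ENNReal.ofReal (Real.exp (-(2 * (m * b.pX - n) ^ 2 / m))) := by
  have hm0 : (0 : ℝ) < m := by exact_mod_cast hm
  set l := 4 * (m * b.pX - n) / m with hl
  have hl0 : 0 ≤ l := div_nonneg (by linarith) hm0.le
  have h := hr.measure_discrete_sum_ge_le hn
    (B := fun i' a _ => if i' = i then l * (b.pX - if a = a₀ then 1 else 0) - l ^ 2 * 1 ^ 2 / 8 else 0)
    ?_ (2 * (m * b.pX - n) ^ 2 / m)
  · refine (measure_mono fun ω hω => ?_).trans h
    simp only [Set.mem_ofPred_eq] at hω ⊢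
    have e : ∀ s, (if k s ω = i then l * (b.pX - if x s ω = a₀ then 1 else 0) - l ^ 2 * 1 ^ 2 / 8
        else 0) = (l * b.pX - l ^ 2 / 8) * (if k s ω = i then (1 : ℝ) else 0)
          - l * (if k s ω = i ∧ x s ω = a₀ then (1 : ℝ) else 0) := by
      intro s
      by_cases h1 : k s ω = i <;> by_cases h2 : x s ω = a₀ <;> simp [h1, h2]; ring
    simp only [e, Finset.sum_sub_distrib, ← Finset.mul_sum]
    rw [hr.sum_choice_eq hm i ω]
    have := mul_le_mul_of_nonneg_left hω hl0
    have e2 : 2 * (m * b.pX - n) ^ 2 / m = (l * b.pX - l ^ 2 / 8) * m - l * n := by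
      rw [hl]; field_simp; ring
    rw [e2]
    linarith
  · intro e i'
    by_cases hi : i' = i
    · subst hi
      simp only [if_true]
      have h := finite_hoeffding (ι := X × V) (p := fun q => I.ctx e q.1 * I.pol i' q.1 q.2)
        (z := fun q => b.pX - if q.1 = a₀ then 1 else 0) (lo := b.pX - 1) (hi := b.pX) (c := 1)
        (fun q => mul_nonneg ((I.ctx_mem e).1 _) ((I.pol_mem i' _).1 _)) ?_ ?_ ?_ (by linarith) ?_ hl0
      · simpa only [Fintype.sum_prod_type] using h
      · simpa only [Fintype.sum_prod_type] using sum_ctx_mul_pol I e i'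
      · intro q; split_ifs <;> linarith
      · intro q; split_ifs <;> linarith
      · simp only [Fintype.sum_prod_type, mul_sub, Finset.sum_sub_distrib, ← Finset.sum_mul,
          sum_ctx_mul_pol I e i', one_mul]
        have : ∑ a, ∑ c, I.ctx e a * I.pol i' a c * (if a = a₀ then 1 else 0) = I.ctx e a₀ := by
          simp only [← Finset.sum_mul, ← Finset.mul_sum, (I.pol_mem i' _).2]
          simp
        rw [this]
        linarith [hI.ctx_le e a₀]
    · simp only [if_neg hi, Real.exp_zero, mul_one]
      exact (sum_ctx_mul_pol I e i').le

/-- With many visits, a one-sided deviation of an empirical frequency is unlikely. -/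
lemma measure_frequency_le (hn : N * m ≤ E * T) (i : Fin N) (a₀ : X)
    {B : V → ℝ} {lo hi : ℝ} (hlo : ∀ c, lo ≤ B c) (hhi : ∀ c, B c ≤ hi) (hlh : hi - lo ≤ 1)
    (hmean : ∑ c, I.pol i a₀ c * B c ≤ 0) {ξ : ℝ} (hξ : 0 ≤ ξ) {n : ℝ} :
    P {ω | n ≤ ∑ s ∈ Finset.range (N * m), (if k s ω = i ∧ x s ω = a₀ then (1 : ℝ) else 0) ∧
      ξ * ∑ s ∈ Finset.range (N * m), (if k s ω = i ∧ x s ω = a₀ then (1 : ℝ) else 0) ≤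
        ∑ s ∈ Finset.range (N * m), (if k s ω = i ∧ x s ω = a₀ then B (v s ω) else 0)} ≤
      ENNReal.ofReal (Real.exp (-(2 * ξ ^ 2 * n))) := by
  have h := hr.measure_discrete_sum_ge_le hn
    (B := fun i' a c => if i' = i ∧ a = a₀ then 4 * ξ * B c - (4 * ξ) ^ 2 * 1 ^ 2 / 8 else 0)
    ?_ (2 * ξ ^ 2 * n)
  · refine (measure_mono fun ω hω => ?_).trans h
    obtain ⟨h1, h2⟩ := hω
    simp only [Set.mem_ofPred_eq]
    have e : ∀ s, (if k s ω = i ∧ x s ω = a₀ then 4 * ξ * B (v s ω) - (4 * ξ) ^ 2 * 1 ^ 2 / 8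
        else 0) = 4 * ξ * (if k s ω = i ∧ x s ω = a₀ then B (v s ω) else 0)
          - 2 * ξ ^ 2 * (if k s ω = i ∧ x s ω = a₀ then (1 : ℝ) else 0) := by
      intro s
      split_ifs <;> ring
    simp only [e, Finset.sum_sub_distrib, ← Finset.mul_sum]
    have h3 := mul_le_mul_of_nonneg_left h2 (show 0 ≤ 4 * ξ by linarith)
    have h4 := mul_le_mul_of_nonneg_left h1 (show 0 ≤ 2 * ξ ^ 2 by positivity)
    linarith
  · intro e i'
    have key : ∀ a, ∑ c, I.pol i' a c *
        Real.exp (if i' = i ∧ a = a₀ then 4 * ξ * B c - (4 * ξ) ^ 2 * 1 ^ 2 / 8 else 0) ≤ 1 := by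
      intro a
      by_cases hi' : i' = i ∧ a = a₀
      · obtain ⟨rfl, rfl⟩ := hi'
        simp only [and_self, if_true]
        exact finite_hoeffding (I.pol_mem i' a).1 (I.pol_mem i' a).2 hlo hhi hlh hmean
          (by linarith)
      · simp only [if_neg hi', Real.exp_zero, mul_one, (I.pol_mem i' a).2, le_refl]
    simp only [mul_assoc (I.ctx _ _), ← Finset.mul_sum]
    calc _ ≤ ∑ a, I.ctx e a * 1 := Finset.sum_le_sum fun a _ =>
          mul_le_mul_of_nonneg_left (key a) ((I.ctx_mem e).1 a)
      _ = 1 := by simpa using (I.ctx_mem e).2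

/-- The empirical policies are accurate with high probability. -/
theorem measure_not_accurate_le (hadm : b.Admissible) (hI : I.Bounded b) (hm : 0 < m)
    (hNm : N * m ≤ E * T) {n : ℝ} (hn : 0 < n) (hnm : n ≤ m * b.pX) :
    P.real {ω | ¬ Accurate b I.pol
        (empirical (N * m) (fun s => k s ω) (fun s => x s ω) (fun s => v s ω))} ≤
      N * Fintype.card X * (Real.exp (-(2 * (m * b.pX - n) ^ 2 / m))
        + Fintype.card V * (2 * Real.exp (-(2 * b.ξ ^ 2 * n)))) := by
  let cnt : Fin N → X → Ω → ℝ := fun i a ω =>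
    ∑ s ∈ Finset.range (N * m), (if k s ω = i ∧ x s ω = a then (1 : ℝ) else 0)
  let B₁ : Fin N → X → V → V → ℝ := fun i a c c' => (if c' = c then 1 else 0) - I.pol i a c
  let B₂ : Fin N → X → V → V → ℝ := fun i a c c' => I.pol i a c - (if c' = c then 1 else 0)
  let Dev : (V → ℝ) → Fin N → X → Set Ω := fun B i a => {ω | n ≤ cnt i a ω ∧
    b.ξ * cnt i a ω ≤ ∑ s ∈ Finset.range (N * m), (if k s ω = i ∧ x s ω = a then B (v s ω) else 0)}
  have hfin : ∀ {S : Set Ω} {r : ℝ}, P S ≤ ENNReal.ofReal (Real.exp r) → P.real S ≤ Real.exp r :=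
    fun h => ENNReal.toReal_le_of_le_ofReal (Real.exp_pos _).le h
  have hmass : ∀ i a c, ∑ c', I.pol i a c' * (if c' = c then (1 : ℝ) else 0) = I.pol i a c := by
    intro i a c; simp
  have hd1 : ∀ i a c, P.real (Dev (B₁ i a c) i a) ≤ Real.exp (-(2 * b.ξ ^ 2 * n)) := by
    intro i a c
    refine hfin (hr.measure_frequency_le hNm i a (lo := -I.pol i a c) (hi := 1 - I.pol i a c)
      ?_ ?_ (by linarith) ?_ hadm.ξ_pos.le)
    · intro c'; simp only [B₁]; split_ifs <;> linarith
    · intro c'; simp only [B₁]; split_ifs <;> linarith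
    · simp only [B₁, mul_sub, Finset.sum_sub_distrib, hmass, ← Finset.sum_mul, (I.pol_mem i a).2]
      linarith
  have hd2 : ∀ i a c, P.real (Dev (B₂ i a c) i a) ≤ Real.exp (-(2 * b.ξ ^ 2 * n)) := by
    intro i a c
    refine hfin (hr.measure_frequency_le hNm i a (lo := I.pol i a c - 1) (hi := I.pol i a c)
      ?_ ?_ (by linarith) ?_ hadm.ξ_pos.le)
    · intro c'; simp only [B₂]; split_ifs <;> linarith
    · intro c'; simp only [B₂]; split_ifs <;> linarith
    · simp only [B₂, mul_sub, Finset.sum_sub_distrib, hmass, ← Finset.sum_mul, (I.pol_mem i a).2]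
      linarith
  have hsub : {ω | ¬ Accurate b I.pol
        (empirical (N * m) (fun s => k s ω) (fun s => x s ω) (fun s => v s ω))} ⊆
      ⋃ q : Fin N × X, ({ω | cnt q.1 q.2 ω ≤ n} ∪
        ⋃ c, (Dev (B₁ q.1 q.2 c) q.1 q.2 ∪ Dev (B₂ q.1 q.2 c) q.1 q.2)) := by
    intro ω hω
    by_contra hnot
    simp only [Set.mem_iUnion, Set.mem_union, Set.mem_ofPred_eq, not_exists, not_or, not_le,
      Prod.forall, Dev, not_and] at hnot
    refine hω (accurate_of_sums (fun i a => hn.trans (hnot i a).1) ?_ ?_)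
    · exact fun i a c => (((hnot i a).2 c).1 (hnot i a).1.le).le
    · exact fun i a c => (((hnot i a).2 c).2 (hnot i a).1.le).le
  refine (measureReal_mono hsub).trans ((measureReal_iUnion_fintype_le _).trans ?_)
  calc _ ≤ ∑ _q : Fin N × X, (Real.exp (-(2 * (m * b.pX - n) ^ 2 / m))
        + Fintype.card V * (2 * Real.exp (-(2 * b.ξ ^ 2 * n)))) := by
        refine Finset.sum_le_sum fun q _ => (measureReal_union_le _ _).trans ?_
        refine add_le_add (hfin (hr.measure_count_le hI hm hNm q.1 q.2 hnm)) ?_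
        refine (measureReal_iUnion_fintype_le _).trans ?_
        calc _ ≤ ∑ _c : V, 2 * Real.exp (-(2 * b.ξ ^ 2 * n)) :=
              Finset.sum_le_sum fun c _ => (measureReal_union_le _ _).trans
                (by linarith [hd1 q.1 q.2 c, hd2 q.1 q.2 c])
          _ = _ := by simp
    _ = _ := by simp; ring

end IsOnlineRun

end Sampling

/-! ### Gaps -/

section Facts

variable {X V : Type*} [Fintype X] [Fintype V] {N E : ℕ} {b : Params} {I : Bandit X V N E}

lemma mean_nonneg (I : Bandit X V N E) (e : Fin E) (i : Fin N) : 0 ≤ I.mean e i := by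
  rw [mean_eq]
  exact Finset.sum_nonneg fun a _ => Finset.sum_nonneg fun c _ =>
    mul_nonneg (mul_nonneg ((I.ctx_mem e).1 a) ((I.pol_mem i a).1 c)) (rewMean_nonneg I e a c)

lemma mean_le_one (I : Bandit X V N E) (e : Fin E) (i : Fin N) : I.mean e i ≤ 1 := by
  rw [mean_eq, ← sum_ctx_mul_pol I e i]
  exact Finset.sum_le_sum fun a _ => Finset.sum_le_sum fun c _ => mul_le_of_le_one_right
    (mul_nonneg ((I.ctx_mem e).1 a) ((I.pol_mem i a).1 c)) (rewMean_le_one I e a c)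

lemma gap_nonneg (I : Bandit X V N E) (e : Fin E) (i : Fin N) : 0 ≤ I.gap e i :=
  sub_nonneg.2 (le_ciSup (Set.finite_range _).bddAbove i)

lemma gap_le_one (I : Bandit X V N E) (e : Fin E) (i : Fin N) : I.gap e i ≤ 1 := by
  have : Nonempty (Fin N) := ⟨i⟩
  have h : I.best e ≤ 1 := ciSup_le fun j => mean_le_one I e j
  have := mean_nonneg I e i
  unfold Bandit.gap
  linarith

lemma gap_eq_of_best {e : Fin E} {i₀ : Fin N} (h : ∀ i, i ≠ i₀ → I.mean e i ≤ I.mean e i₀)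
    (i : Fin N) : I.gap e i = I.mean e i₀ - I.mean e i := by
  have : Nonempty (Fin N) := ⟨i⟩
  unfold Bandit.gap
  congr 1
  refine le_antisymm (ciSup_le fun j => ?_) (le_ciSup (Set.finite_range _).bddAbove i₀)
  by_cases hj : j = i₀
  · rw [hj]
  · exact h j hj

/-- In each episode some expert has gap `0`, and the other gaps exceed `γ p_V`. -/
def Separated (b : Params) (I : Bandit X V N E) : Prop :=
  ∀ e, ∃ i₀, I.gap e i₀ = 0 ∧ ∀ i, i ≠ i₀ → b.γ * b.pV < I.gap e i

lemma separated_of_best (hγ : 0 < b.γ) (hpV : 0 < b.pV)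
    (h : ∀ e, ∃ i₀, ∀ i, i ≠ i₀ → I.mean e i + b.γ * b.pV < I.mean e i₀) : Separated b I := by
  intro e
  obtain ⟨i₀, hi₀⟩ := h e
  have hp : 0 < b.γ * b.pV := mul_pos hγ hpV
  have hg := gap_eq_of_best (I := I) (e := e) (i₀ := i₀) fun i hi => by linarith [hi₀ i hi]
  exact ⟨i₀, by rw [hg, sub_self], fun i hi => by rw [hg]; linarith [hi₀ i hi]⟩

variable (hI : I.Bounded b) (hsep : Separated b I) (hE : 0 < E)
include hE

include I in
lemma nonempty_ctx : Nonempty X := by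
  by_contra h
  rw [not_nonempty_iff] at h
  have := (I.ctx_mem ⟨0, hE⟩).2
  simp at this

include hsep in
lemma one_lt_card_act (hpp : 0 < b.γ * b.pV) (hN : 2 ≤ N) : 1 < Fintype.card V := by
  obtain ⟨i₀, h0, hi₀⟩ := hsep ⟨0, hE⟩
  have : Nontrivial (Fin N) := Fin.nontrivial_iff_two_le.2 hN
  obtain ⟨i, hi⟩ := exists_ne i₀
  have hgap := hi₀ i hi
  by_contra hV
  have hsub : Subsingleton V := Fintype.card_le_one_iff_subsingleton.1 (not_lt.1 hV)
  have hone : ∀ j x v, I.pol j x v = 1 := fun j x v => by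
    have h := (I.pol_mem j x).2
    have hu : (Finset.univ : Finset V) = {v} := by
      ext w; simp [Subsingleton.elim w v]
    rwa [hu, Finset.sum_singleton] at h
  have : I.gap ⟨0, hE⟩ i = I.gap ⟨0, hE⟩ i₀ := by
    unfold Bandit.gap Bandit.mean
    simp only [hone]
  linarith

include hI

lemma pX_mul_card_le : b.pX * Fintype.card X ≤ 1 := by
  rw [← (I.ctx_mem ⟨0, hE⟩).2, mul_comm, ← nsmul_eq_mul, ← Finset.card_univ,
    ← Finset.sum_const]
  exact Finset.sum_le_sum fun x _ => hI.ctx_le _ x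

include hsep in
lemma admissible_and_policyBounds (hpX : 0 < b.pX) (hpV : 0 < b.pV) (hγ : 0 < b.γ)
    (hM : 1 + Real.log (1 + f₁ ((1 - b.pV) / b.pV)) ≤ b.M) (hN : 2 ≤ N) :
    b.Admissible ∧ PolicyBounds b I.pol := by
  have hcard := one_lt_card_act hsep hE (mul_pos hγ hpV) hN
  have hX := nonempty_ctx (I := I) hE
  have hle : ∀ i x v, I.pol i x v ≤ 1 - b.pV := by
    intro i x v
    have : Nontrivial V := Fintype.one_lt_card_iff_nontrivial.1 hcard
    obtain ⟨v', hv'⟩ := exists_ne v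
    have h1 := (I.pol_mem i x).2
    have h2 : ∑ c ∈ ({v, v'} : Set V).toFinite.toFinset, I.pol i x c ≤ ∑ c, I.pol i x c :=
      Finset.sum_le_univ_sum_of_nonneg (I.pol_mem i x).1
    classical
    have h3 : ({v, v'} : Set V).toFinite.toFinset = {v, v'} := by ext; simp
    rw [h3, Finset.sum_pair hv'.symm, h1] at h2
    linarith [hI.pol_le i x v']
  refine ⟨⟨hpX, hpV, ?_, hγ, (hI.mean_le ⟨0, hE⟩ ⟨0, by omega⟩).trans (mean_le_one _ _ _), hM⟩,
    ⟨I.pol_mem, hI.pol_le, hle, pX_mul_card_le hI hE⟩⟩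
  have hV : Nonempty V := Fintype.card_pos_iff.1 (by omega)
  have h1 := hI.pol_le ⟨0, by omega⟩ (Classical.arbitrary X) (Classical.arbitrary V)
  have h2 := hle ⟨0, by omega⟩ (Classical.arbitrary X) (Classical.arbitrary V)
  linarith

end Facts

/-! ### Sorted gaps -/

section Times

variable {X V : Type*} [Fintype X] [Fintype V] {N E : ℕ} {b : Params} {I : Bandit X V N E}

lemma time_anti (hb : b.Admissible) {Δ Δ' : ℝ} (hΔ : b.γ * b.pV < Δ) (h : Δ ≤ Δ') (h1 : Δ' ≤ 1) :
    time b I Δ' ≤ time b I Δ :=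
  max_le_max_left _ (tau_anti hb hΔ h h1)

lemma sortedGap_eq (e : Fin E) {k : ℕ} (h : k - 1 < N) :
    sortedGap I e k = I.gap e (Tuple.sort (I.gap e) ⟨k - 1, h⟩) := dif_pos h

lemma sortedGap_mono (e : Fin E) {k l : ℕ} (hkl : k ≤ l) (hl : l - 1 < N) :
    sortedGap I e k ≤ sortedGap I e l := by
  rw [sortedGap_eq e hl, sortedGap_eq e (show k - 1 < N by omega)]
  exact Tuple.monotone_sort (I.gap e) (Fin.mk_le_mk.2 (by omega))

lemma sortedGap_le_one (e : Fin E) (k : ℕ) : sortedGap I e k ≤ 1 := by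
  unfold sortedGap
  split_ifs
  · exact gap_le_one _ _ _
  · exact zero_le_one

lemma sortedGap_one (hsep : Separated b I) (e : Fin E) : sortedGap I e 1 = 0 := by
  obtain ⟨i₀, h0, -⟩ := hsep e
  have hN : 1 - 1 < N := by have := i₀.pos; omega
  rw [sortedGap_eq e hN]
  refine le_antisymm ?_ (gap_nonneg _ _ _)
  obtain ⟨j, hj⟩ := (Tuple.sort (I.gap e)).surjective i₀
  have : I.gap e (Tuple.sort (I.gap e) ⟨1 - 1, hN⟩) ≤ I.gap e (Tuple.sort (I.gap e) j) :=
    Tuple.monotone_sort (I.gap e) (Fin.mk_le_of_le_val (by simp))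
  rwa [hj, h0] at this

lemma lt_sortedGap (hγ : 0 < b.γ * b.pV) (hsep : Separated b I) (e : Fin E) {k : ℕ} (hk : 2 ≤ k)
    (hkN : k ≤ N) : b.γ * b.pV < sortedGap I e k := by
  have h1 := sortedGap_one hsep e
  obtain ⟨i₀, h0, hi₀⟩ := hsep e
  have hN1 : 1 - 1 < N := by omega
  have hNk : k - 1 < N := by omega
  rw [sortedGap_eq e hN1] at h1
  rw [sortedGap_eq e hNk]
  refine hi₀ _ fun hcontra => ?_
  have h2 : Tuple.sort (I.gap e) ⟨1 - 1, hN1⟩ = i₀ := by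
    by_contra hne
    linarith [hi₀ _ hne]
  have := (Tuple.sort (I.gap e)).injective (h2.trans hcontra.symm)
  rw [Fin.mk.injEq] at this
  omega

lemma exists_sortedGap_eq (hsep : Separated b I) (e : Fin E) {i : Fin N} (hi : 0 < I.gap e i) :
    ∃ k, 2 ≤ k ∧ k ≤ N ∧ sortedGap I e k = I.gap e i := by
  obtain ⟨j, hj⟩ := (Tuple.sort (I.gap e)).surjective i
  have hj1 : (j : ℕ) + 1 - 1 < N := by have := j.2; omega
  have he : sortedGap I e (j + 1) = I.gap e i := by
    rw [sortedGap_eq e hj1, ← hj]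
    congr 2
  refine ⟨j + 1, ?_, j.2, he⟩
  by_contra hlt
  have : (j : ℕ) + 1 = 1 := by omega
  rw [this, sortedGap_one hsep e] at he
  linarith

lemma sum_sortedGap (hsep : Separated b I) (e : Fin E) :
    ∑ k ∈ Finset.Icc 2 N, sortedGap I e k = ∑ i, I.gap e i := by
  have hN : 0 < N := by obtain ⟨i₀, -⟩ := hsep e; exact i₀.pos
  have h1 : ∑ i, I.gap e i = ∑ j ∈ Finset.range N, sortedGap I e (j + 1) := by
    rw [← Equiv.sum_comp (Tuple.sort (I.gap e)), Finset.sum_range]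
    refine Finset.sum_congr rfl fun j _ => ?_
    rw [sortedGap_eq e (show (j : ℕ) + 1 - 1 < N by have := j.2; omega)]
    congr 2
  obtain ⟨n, rfl⟩ := Nat.exists_eq_add_of_lt hN
  rw [h1, Finset.sum_range_succ', sortedGap_one hsep e, add_zero,
    ← Finset.Ico_add_one_right_eq_Icc, Finset.sum_Ico_eq_sum_range]
  refine Finset.sum_congr (by congr 1) fun j _ => ?_
  congr 1; omega

lemma abel_sum (t d : ℕ → ℝ) {n : ℕ} (hn : 2 ≤ n) :
    t n * d n + ∑ k ∈ Finset.Icc 2 (n - 1), (t k - t (k + 1)) * d k =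
      ∑ k ∈ Finset.Icc 2 n, t k * (d k - d (k - 1)) + t 2 * d 1 := by
  induction n, hn using Nat.le_induction with
  | base => simp; ring
  | succ n hn ih =>
    rw [Finset.sum_Icc_succ_top (by omega : 2 ≤ n + 1), Nat.add_sub_cancel]
    obtain ⟨m, rfl⟩ : ∃ m, n = m + 1 := ⟨n - 1, by omega⟩
    rw [Finset.sum_Icc_succ_top hn]
    rw [Nat.add_sub_cancel] at ih
    linarith

lemma telescope (d : ℕ → ℝ) {n : ℕ} (hn : 1 ≤ n) :
    ∑ k ∈ Finset.Icc 2 n, (d k - d (k - 1)) = d n - d 1 := by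
  induction n, hn using Nat.le_induction with
  | base => simp
  | succ n hn ih =>
    rw [Finset.sum_Icc_succ_top (by omega : 2 ≤ n + 1), ih, Nat.add_sub_cancel]
    ring

/-- The regret constant as a sum over the increments of the sorted gaps. -/
lemma regretConst_eq (hN : 2 ≤ N) (hsep : Separated b I) (e : Fin E) :
    regretConst b I e = Real.pi ^ 2 / 3 * ∑ i, I.gap e i +
      ∑ k ∈ Finset.Icc 2 N, (time b I (sortedGap I e k) : ℝ) *
        (sortedGap I e k - sortedGap I e (k - 1)) := by
  have := abel_sum (fun k => (time b I (sortedGap I e k) : ℝ)) (sortedGap I e) hN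
  rw [sortedGap_one hsep e, mul_zero, add_zero] at this
  unfold regretConst
  rw [← this, sum_sortedGap hsep e]
  ring

lemma sortedGap_sub_nonneg (e : Fin E) {k : ℕ} (hk : k ∈ Finset.Icc 2 N) :
    0 ≤ sortedGap I e k - sortedGap I e (k - 1) := by
  have := Finset.mem_Icc.1 hk
  exact sub_nonneg.2 (sortedGap_mono e (Nat.sub_le _ _) (by omega))

lemma regretConst_nonneg (hN : 1 ≤ N) (hsep : Separated b I) (e : Fin E) :
    0 ≤ regretConst b I e := by
  rcases hN.lt_or_eq with h | rfl
  · rw [regretConst_eq h hsep]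
    have h1 : 0 ≤ ∑ i, I.gap e i := Finset.sum_nonneg fun i _ => gap_nonneg I e i
    have h2 := Finset.sum_nonneg fun k hk => mul_nonneg
      (Nat.cast_nonneg (α := ℝ) (time b I (sortedGap I e k))) (sortedGap_sub_nonneg (I := I) e hk)
    have := Real.pi_pos
    positivity
  · simp [regretConst, sortedGap_one hsep e]

/-- The largest gap of an expert that may still be played often after `t` steps. -/
noncomputable def gapProfile (b : Params) (I : Bandit X V N E) (e : Fin E) (t : ℕ) : ℝ :=
  ∑ k ∈ Finset.Icc 2 N, if t < time b I (sortedGap I e k) then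
    sortedGap I e k - sortedGap I e (k - 1) else 0

lemma gapProfile_nonneg (e : Fin E) (t : ℕ) : 0 ≤ gapProfile b I e t :=
  Finset.sum_nonneg fun k hk => by
    split_ifs
    · exact sortedGap_sub_nonneg e hk
    · exact le_rfl

lemma gap_le_gapProfile (hb : b.Admissible) (hsep : Separated b I) (e : Fin E) {i : Fin N} {t : ℕ}
    (ht : t < time b I (I.gap e i)) : I.gap e i ≤ gapProfile b I e t := by
  rcases (gap_nonneg I e i).eq_or_lt with h0 | hpos
  · rw [← h0]; exact gapProfile_nonneg e t
  obtain ⟨l, hl2, hlN, hl⟩ := exists_sortedGap_eq hsep e hpos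
  rw [← hl] at ht ⊢
  have hsub : Finset.Icc 2 l ⊆ Finset.Icc 2 N := Finset.Icc_subset_Icc_right hlN
  unfold gapProfile
  calc sortedGap I e l = ∑ k ∈ Finset.Icc 2 l, (sortedGap I e k - sortedGap I e (k - 1)) := by
        rw [telescope _ (by omega), sortedGap_one hsep e, sub_zero]
    _ = ∑ k ∈ Finset.Icc 2 l, if t < time b I (sortedGap I e k) then
          sortedGap I e k - sortedGap I e (k - 1) else 0 := by
        refine Finset.sum_congr rfl fun k hk => (if_pos (lt_of_lt_of_le ht ?_)).symm
        have hk' := Finset.mem_Icc.1 hk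
        exact time_anti hb (lt_sortedGap hb.γ_mul_pV_pos hsep e hk'.1 (by omega))
          (sortedGap_mono e hk'.2 (by omega)) (sortedGap_le_one e l)
    _ ≤ _ := Finset.sum_le_sum_of_subset_of_nonneg hsub fun k hk _ => by
        split_ifs
        · exact sortedGap_sub_nonneg e hk
        · exact le_rfl

lemma sum_gapProfile_le (e : Fin E) (n : ℕ) :
    ∑ t ∈ Finset.range n, gapProfile b I e t ≤
      ∑ k ∈ Finset.Icc 2 N, (time b I (sortedGap I e k) : ℝ) *
        (sortedGap I e k - sortedGap I e (k - 1)) := by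
  unfold gapProfile
  rw [Finset.sum_comm]
  refine Finset.sum_le_sum fun k hk => ?_
  rw [← Finset.sum_filter, Finset.sum_const, nsmul_eq_mul]
  refine mul_le_mul_of_nonneg_right ?_ (sortedGap_sub_nonneg e hk)
  have : (Finset.range n).filter (fun t => t < time b I (sortedGap I e k)) ⊆
      Finset.range (time b I (sortedGap I e k)) := fun t ht =>
    Finset.mem_range.2 (Finset.mem_filter.1 ht).2
  exact_mod_cast (Finset.card_le_card this).trans_eq (Finset.card_range _)

lemma sum_two_div_sq_le (n : ℕ) :
    ∑ t ∈ Finset.range n, 2 / (t : ℝ) ^ 2 ≤ Real.pi ^ 2 / 3 := by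
  have h := sum_le_hasSum (Finset.range n) (fun t _ => by positivity) hasSum_zeta_two
  calc ∑ t ∈ Finset.range n, 2 / (t : ℝ) ^ 2 = 2 * ∑ t ∈ Finset.range n, 1 / (t : ℝ) ^ 2 := by
        rw [Finset.mul_sum]; exact Finset.sum_congr rfl fun t _ => by ring
    _ ≤ _ := by linarith

end Times

/-! ### Expected regret -/

section Regret

variable {X V : Type*} [Fintype X] [Fintype V] [DecidableEq X] [DecidableEq V] {N E : ℕ}
  {b : Params} {I : Bandit X V N E} {T m : ℕ} {Ω : Type*} {mΩ : MeasurableSpace Ω}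
  {P : Measure Ω} {F : Filtration ℕ mΩ} {k : ℕ → Ω → Fin N} {x : ℕ → Ω → X} {v : ℕ → Ω → V}
  {y : ℕ → Ω → ℝ}

lemma sum_episodes (f : ℕ → ℝ) (E T : ℕ) :
    ∑ e : Fin E, ∑ t ∈ Finset.range T, f (e * T + t) = ∑ s ∈ Finset.range (E * T), f s := by
  rw [Fin.sum_univ_eq_sum_range (fun e => ∑ t ∈ Finset.range T, f (e * T + t)) E]
  induction E with
  | zero => simp
  | succ E ih => rw [Finset.sum_range_succ, ih, add_mul, one_mul, Finset.sum_range_add]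

namespace IsOnlineRun

variable (hr : IsOnlineRun b I T m P F k x v y)
include hr

lemma measurable_gap (e : Fin E) (s : ℕ) : Measurable fun ω => I.gap e (k s ω) := by
  have : Measurable (k s) := measurable_to_countable' fun i => F.le s _ (hr.choice_meas s i)
  exact (Measurable.of_discrete (f := I.gap e)).comp this

variable [IsProbabilityMeasure P]

lemma integrable_gap (e : Fin E) (s : ℕ) : Integrable (fun ω => I.gap e (k s ω)) P :=
  Integrable.of_bound (hr.measurable_gap e s).aestronglyMeasurable 1
    (Filter.Eventually.of_forall fun ω => by
      rw [Real.norm_of_nonneg (gap_nonneg _ _ _)]; exact gap_le_one _ _ _)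

lemma integral_gap_le_one (e : Fin E) (s : ℕ) : ∫ ω, I.gap e (k s ω) ∂P ≤ 1 := by
  calc ∫ ω, I.gap e (k s ω) ∂P ≤ ∫ _ω, (1 : ℝ) ∂P :=
        integral_mono (hr.integrable_gap e s) (integrable_const _) fun ω => gap_le_one _ _ _
    _ = 1 := by simp

lemma integral_regret_eq : ∫ ω, regret I T k ω ∂P =
    ∑ e : Fin E, ∑ t ∈ Finset.range T, ∫ ω, I.gap e (k (e * T + t) ω) ∂P := by
  change ∫ ω, ∑ e : Fin E, ∑ t ∈ Finset.range T, I.gap e (k (e * T + t) ω) ∂P = _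
  rw [integral_finsetSum _ fun e _ => integrable_finsetSum _ fun t _ => hr.integrable_gap e _]
  refine Finset.sum_congr rfl fun e _ => ?_
  rw [integral_finsetSum _ fun t _ => hr.integrable_gap e _]

lemma integral_regret_le_card : ∫ ω, regret I T k ω ∂P ≤ E * T := by
  rw [hr.integral_regret_eq]
  calc _ ≤ ∑ e : Fin E, ∑ t ∈ Finset.range T, (1 : ℝ) :=
        Finset.sum_le_sum fun e _ => Finset.sum_le_sum fun t _ => hr.integral_gap_le_one e _
    _ = E * T := by simp

/-- Expected regret at one step of an instance of the index policy. -/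
lemma integral_gap_le (hadm : b.Admissible) (hπ : PolicyBounds b I.pol) (hsep : Separated b I)
    (e : Fin E) {t : ℕ} (ht : max (e * T) (N * m) + t < (e + 1) * T) :
    ∫ ω, I.gap e (k (max (e * T) (N * m) + t) ω) ∂P ≤
      P.real {ω | ¬ Accurate b I.pol
        (empirical (N * m) (fun s => k s ω) (fun s => x s ω) (fun s => v s ω))}
      + (gapProfile b I e t + ∑ i, I.gap e i * (2 / (t : ℝ) ^ 2)) := by
  classical
  set s := max (e * T) (N * m) + t with hs
  set acc : Ω → Prop := fun ω => Accurate b I.pol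
    (empirical (N * m) (fun s => k s ω) (fun s => x s ω) (fun s => v s ω)) with hacc
  have haccm : MeasurableSet {ω | acc ω} := by
    have h := hr.measurable_empirical (n := N * m) le_rfl (fun q => Accurate b I.pol q)
    exact measurableSet_setOfPred.2 (h.mono (F.le _) le_rfl)
  have hbad : MeasurableSet {ω | ¬ acc ω} := haccm.compl
  let S : Fin N → Set Ω := fun i => {ω | acc ω ∧ k s ω = i}
  have hS : ∀ i, MeasurableSet (S i) := fun i => haccm.inter (F.le s _ (hr.choice_meas s i))
  let c : Fin N → ℝ := fun i => if time b I (I.gap e i) ≤ t then I.gap e i else 0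
  have hpt : ∀ ω, I.gap e (k s ω) ≤ {ω | ¬ acc ω}.indicator 1 ω +
      (gapProfile b I e t + ∑ i, (S i).indicator (fun _ => c i) ω) := by
    intro ω
    have h0 := gapProfile_nonneg (b := b) (I := I) e t
    have hc0 : ∀ i, 0 ≤ (S i).indicator (fun _ => c i) ω := fun i =>
      Set.indicator_nonneg (fun _ _ => by
        simp only [c]; split_ifs; exacts [gap_nonneg _ _ _, le_rfl]) _
    have hsum := Finset.sum_nonneg fun i (_ : i ∈ Finset.univ) => hc0 i
    by_cases ha : acc ω
    · rw [Set.indicator_of_notMem (by simpa using ha), zero_add]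
      by_cases ht : time b I (I.gap e (k s ω)) ≤ t
      · have h1 := Finset.single_le_sum (fun i _ => hc0 i) (Finset.mem_univ (k s ω))
        rw [Set.indicator_of_mem (show ω ∈ S (k s ω) from ⟨ha, rfl⟩)] at h1
        simp only [c, if_pos ht] at h1
        linarith
      · have := gap_le_gapProfile hadm hsep e (not_le.1 ht)
        linarith
    · rw [Set.indicator_of_mem (by simpa using ha), Pi.one_apply]
      have := gap_le_one I e (k s ω)
      linarith
  have hi1 : Integrable ({ω | ¬ acc ω}.indicator (1 : Ω → ℝ)) P :=
    (integrable_const (1 : ℝ)).indicator hbad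
  have hi2 : ∀ i, Integrable ((S i).indicator fun _ => c i) P := fun i =>
    (integrable_const _).indicator (hS i)
  have hi3 : Integrable (fun ω => ∑ i, (S i).indicator (fun _ => c i) ω) P :=
    integrable_finsetSum _ fun i _ => hi2 i
  have hi4 : Integrable (fun ω => gapProfile b I e t + ∑ i, (S i).indicator (fun _ => c i) ω) P :=
    (integrable_const _).add hi3
  have hSi : ∀ i, P.real (S i) * c i ≤ I.gap e i * (2 / (t : ℝ) ^ 2) := by
    intro i
    have hg0 := gap_nonneg I e i
    simp only [c]
    split_ifs with hti
    · rcases hg0.eq_or_lt with h0 | hpos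
      · rw [← h0]; simp
      have hgap : b.γ * b.pV < I.gap e i := by
        obtain ⟨i₀, h0, hi₀⟩ := hsep e
        exact hi₀ i fun h => by rw [h, h0] at hpos; exact lt_irrefl _ hpos
      have := ENNReal.toReal_le_of_le_ofReal (by positivity) (hr.measure_play_le hadm hπ ht hgap
        (gap_le_one I e i) ((le_max_left _ _).trans ((le_max_left _ _).trans hti))
        ((le_max_right _ _).trans hti))
      rw [mul_comm]
      exact mul_le_mul_of_nonneg_left this hg0
    · rw [mul_zero]; positivity
  calc ∫ ω, I.gap e (k s ω) ∂P ≤ ∫ ω, ({ω | ¬ acc ω}.indicator 1 ω +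
      (gapProfile b I e t + ∑ i, (S i).indicator (fun _ => c i) ω)) ∂P :=
        integral_mono (hr.integrable_gap e s) (hi1.add hi4) hpt
    _ = P.real {ω | ¬ acc ω} + (gapProfile b I e t + ∑ i, P.real (S i) * c i) := by
        rw [integral_add hi1 hi4, integral_add (integrable_const _) hi3,
          integral_finsetSum _ fun i _ => hi2 i, integral_indicator_one hbad]
        simp only [integral_indicator_const _ (hS _), integral_const, probReal_univ, smul_eq_mul,
          one_mul]
    _ ≤ _ := by
        have := Finset.sum_le_sum fun i (_ : i ∈ Finset.univ) => hSi i
        linarith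

/-- Expected regret in terms of the probability of inaccurate empirical policies. -/
theorem integral_regret_le (hadm : b.Admissible) (hπ : PolicyBounds b I.pol)
    (hsep : Separated b I) (hN : 2 ≤ N) :
    ∫ ω, regret I T k ω ∂P ≤ m * N + (E * T * P.real {ω | ¬ Accurate b I.pol
        (empirical (N * m) (fun s => k s ω) (fun s => x s ω) (fun s => v s ω))}
      + ∑ e, regretConst b I e) := by
  set δ := P.real {ω | ¬ Accurate b I.pol
        (empirical (N * m) (fun s => k s ω) (fun s => x s ω) (fun s => v s ω))} with hδ
  have hδ0 : 0 ≤ δ := measureReal_nonneg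
  let f : Fin E → ℕ → ℝ := fun e t => gapProfile b I e t + ∑ i, I.gap e i * (2 / (t : ℝ) ^ 2)
  have hf0 : ∀ e t, 0 ≤ f e t := fun e t => add_nonneg (gapProfile_nonneg e t)
    (Finset.sum_nonneg fun i _ => mul_nonneg (gap_nonneg I e i) (by positivity))
  have hf : ∀ e n, ∑ t ∈ Finset.range n, f e t ≤ regretConst b I e := by
    intro e n
    simp only [f, Finset.sum_add_distrib, ← Finset.sum_mul, ← Finset.mul_sum]
    rw [regretConst_eq hN hsep, add_comm, mul_comm (Real.pi ^ 2 / 3)]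
    have h1 : 0 ≤ ∑ i, I.gap e i := Finset.sum_nonneg fun i _ => gap_nonneg I e i
    exact add_le_add (mul_le_mul_of_nonneg_left (sum_two_div_sq_le n) h1) (sum_gapProfile_le e n)
  have hstep : ∀ (e : Fin E) (t : ℕ), t ∈ Finset.range T → ∫ ω, I.gap e (k (e * T + t) ω) ∂P ≤
      (if (e : ℕ) * T + t < N * m then (1 : ℝ) else 0) + (δ +
        if max (e * T) (N * m) - e * T ≤ t then f e (t - (max (e * T) (N * m) - e * T)) else 0) := by
    intro e t ht
    have ht' := Finset.mem_range.1 ht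
    by_cases h : (e : ℕ) * T + t < N * m
    · rw [if_pos h]
      have h1 := hr.integral_gap_le_one e (e * T + t)
      have h2 : 0 ≤ if max (e * T) (N * m) - e * T ≤ t then
          f e (t - (max (e * T) (N * m) - e * T)) else 0 := by
        split_ifs; exacts [hf0 _ _, le_rfl]
      linarith
    · have hle : max ((e : ℕ) * T) (N * m) ≤ e * T + t := max_le (by omega) (by omega)
      have hge : (e : ℕ) * T ≤ max ((e : ℕ) * T) (N * m) := le_max_left _ _
      rw [if_neg h, zero_add, if_pos (by omega)]
      have := hr.integral_gap_le hadm hπ hsep e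
        (t := t - (max (e * T) (N * m) - e * T)) (by rw [add_mul, one_mul]; omega)
      rwa [show max ((e : ℕ) * T) (N * m) + (t - (max (e * T) (N * m) - e * T)) = e * T + t by
        omega] at this
  rw [hr.integral_regret_eq]
  have h1 : ∑ e : Fin E, ∑ t ∈ Finset.range T, (if (e : ℕ) * T + t < N * m then (1 : ℝ) else 0)
      ≤ m * N := by
    rw [sum_episodes (fun s => if s < N * m then (1 : ℝ) else 0), ← Finset.sum_filter,
      Finset.sum_const, nsmul_eq_mul, mul_one]
    have hsub : (Finset.range (E * T)).filter (· < N * m) ⊆ Finset.range (N * m) := fun s hs =>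
      Finset.mem_range.2 (Finset.mem_filter.1 hs).2
    have := (Finset.card_le_card hsub).trans_eq (Finset.card_range _)
    rw [mul_comm (m : ℝ)]
    exact_mod_cast this
  have h2 : ∀ e : Fin E, ∑ t ∈ Finset.range T, (if max (e * T) (N * m) - e * T ≤ t then
      f e (t - (max (e * T) (N * m) - e * T)) else 0) ≤ regretConst b I e := by
    intro e
    set a := max (e * T) (N * m) - e * T
    have hfil : (Finset.range T).filter (a ≤ ·) = Finset.Ico a T := by
      ext t; simp [and_comm]
    rw [← Finset.sum_filter, hfil, Finset.sum_Ico_eq_sum_range]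
    simp only [Nat.add_sub_cancel_left]
    exact hf e _
  calc _ ≤ ∑ e : Fin E, ∑ t ∈ Finset.range T,
        ((if (e : ℕ) * T + t < N * m then (1 : ℝ) else 0) + (δ +
        if max (e * T) (N * m) - e * T ≤ t then f e (t - (max (e * T) (N * m) - e * T)) else 0)) :=
        Finset.sum_le_sum fun e _ => Finset.sum_le_sum fun t ht => hstep e t ht
    _ = ∑ e : Fin E, ∑ t ∈ Finset.range T, (if (e : ℕ) * T + t < N * m then (1 : ℝ) else 0)
        + (E * T * δ + ∑ e : Fin E, ∑ t ∈ Finset.range T, (if max (e * T) (N * m) - e * T ≤ t then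
          f e (t - (max (e * T) (N * m) - e * T)) else 0)) := by
        simp only [Finset.sum_add_distrib]
        simp [mul_assoc]
    _ ≤ _ := by
        gcongr with e
        exact h2 e

end IsOnlineRun

end Regret

/-! ### Size of the problem compared with the horizon -/

section Sizes

variable {X V : Type*} [Fintype X] [Fintype V] {N E : ℕ} {b : Params} {I : Bandit X V N E}

lemma le_tau {b : Params} (hb : b.Admissible) {Δ : ℝ} (hΔ : b.γ * b.pV < Δ) (h1 : Δ ≤ 1) :
    6 * b.C ^ 2 * b.M ^ 2 ≤ tau b Δ := by
  obtain ⟨h2, hs⟩ := tau_spec b Δ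
  have h9 := (le_tauLevel hb hΔ h1).trans hs
  have h2' : (2 : ℝ) ≤ tau b Δ := by exact_mod_cast h2
  have hl : Real.log 2 ≤ Real.log (tau b Δ) := Real.log_le_log two_pos h2'
  have hl2 := Real.log_two_gt_d9
  rw [le_div_iff₀ (by linarith)] at h9
  have : 0 ≤ 9 * b.C ^ 2 * b.M ^ 2 := by positivity
  nlinarith

lemma Params.Admissible.le_C_mul {b : Params} (hb : b.Admissible) :
    32 ≤ b.C * (b.γ * b.pV) := by
  have h1 := hb.ρ_le_M
  have h2 := hb.pV_le
  have h3 := hb.γ_pos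
  have hp : 0 < 1 - b.pV := by linarith
  rw [div_le_iff₀ hb.pV_pos] at h1
  have : b.C * (b.γ * b.pV) = 32 * (b.M * b.pV) / (1 - b.pV) := by
    unfold Params.C; field_simp
  rw [this, le_div_iff₀ hp]
  linarith

lemma gap_le_ratio_sub_one (hb : b.Admissible) (hπ : PolicyBounds b I.pol) (e : Fin E)
    (i : Fin N) : I.gap e i ≤ (1 - b.pV) / b.pV - 1 := by
  have : Nonempty (Fin N) := ⟨i⟩
  obtain ⟨j, hj⟩ := exists_eq_ciSup_of_finite (f := I.mean e)
  have hρ := hb.one_le_ρ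
  have h : I.mean e j ≤ (1 - b.pV) / b.pV * I.mean e i := by
    rw [mean_eq, mean_eq, Finset.mul_sum]
    refine Finset.sum_le_sum fun a _ => ?_
    rw [Finset.mul_sum]
    refine Finset.sum_le_sum fun c _ => ?_
    have h1 := ratio_le hb hπ j i a c
    rw [div_le_iff₀ (hb.pV_pos.trans_le (hπ.ge i a c))] at h1
    have h2 := mul_le_mul_of_nonneg_left h1
      (mul_nonneg ((I.ctx_mem e).1 a) (rewMean_nonneg I e a c))
    linarith
  have h1 := mean_le_one I e i
  unfold Bandit.gap Bandit.best
  rw [← hj]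
  nlinarith

lemma card_ctx_le (hb : b.Admissible) (hπ : PolicyBounds b I.pol) (hV : 1 < Fintype.card V)
    (hM₂ : (1 - b.pX) * Fintype.card X * Fintype.card V * f₁ ((1 - b.pV) / b.pV) ≤ b.M)
    {e : Fin E} {i : Fin N} (hi : b.γ * b.pV < I.gap e i) :
    (Fintype.card X : ℝ) ≤ b.C * b.M := by
  have hC := hb.C_ge
  have hM := hb.one_le_M
  have hg := hb.γ_mul_pV_pos
  by_cases hX : Fintype.card X ≤ 1
  · have : (Fintype.card X : ℝ) ≤ 1 := by exact_mod_cast hX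
    nlinarith
  · have hX2 : (2 : ℝ) ≤ Fintype.card X := by exact_mod_cast not_le.1 hX
    have hV2 : (2 : ℝ) ≤ Fintype.card V := by exact_mod_cast hV
    have hpX : b.pX ≤ 1 / 2 := by nlinarith [hπ.pX_mul_card, hb.pX_pos]
    have hf : 2 * (b.γ * b.pV) ≤ f₁ ((1 - b.pV) / b.pV) :=
      le_trans (by linarith [gap_le_ratio_sub_one hb hπ e i]) two_mul_sub_one_le_f₁
    have h1 : 1 / 2 * Fintype.card X * 2 * (2 * (b.γ * b.pV)) ≤ b.M := by
      refine le_trans ?_ hM₂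
      have h0 : 0 < 1 - b.pX := by linarith
      gcongr
      linarith
    have h2 := mul_le_mul_of_nonneg_left h1 hb.C_pos.le
    have h3 := hb.le_C_mul
    nlinarith

lemma card_experts_le (hb : b.Admissible) {T : ℝ} (hT : 6 * b.C ^ 2 * b.M ^ 2 ≤ T)
    (hN : 3 * ((N - 1) * (b.γ * b.pV)) < T) : (N : ℝ) ≤ T ^ 2 := by
  have hC := hb.C_ge
  have hM : 1 ≤ b.M ^ 2 := one_le_pow₀ hb.one_le_M
  have hCT : b.C ≤ T := by
    have : b.C ^ 2 * 1 ≤ b.C ^ 2 * b.M ^ 2 := by gcongr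
    nlinarith
  have h3 := hb.le_C_mul
  rcases Nat.eq_zero_or_pos N with rfl | hpos
  · simpa using sq_nonneg T
  have hN1 : (1 : ℝ) ≤ N := by exact_mod_cast hpos
  have h4 : ((N : ℝ) - 1) * 32 ≤ ((N : ℝ) - 1) * (b.C * (b.γ * b.pV)) :=
    mul_le_mul_of_nonneg_left h3 (by linarith)
  have h5 : b.C * (3 * ((N - 1) * (b.γ * b.pV))) ≤ T * T :=
    mul_le_mul hCT hN.le (by have := hb.γ_mul_pV_pos; nlinarith) (by linarith)
  nlinarith

lemma two_mul_card_mul_pow_le {T : ℝ} (hT : 1 ≤ T) {n : ℕ} (hn : 1 ≤ n) :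
    2 * n * T ^ 4 ≤ (2 * T) ^ (4 * n) := by
  have h1 : (2 * n : ℝ) ≤ 2 ^ (4 * n) := by
    have h : 2 * n ≤ 2 ^ (4 * n) :=
      calc 2 * n ≤ 2 * 2 ^ n := by have := (Nat.lt_two_pow_self (n := n)).le; omega
        _ = 2 ^ (n + 1) := by rw [pow_succ]; ring
        _ ≤ _ := Nat.pow_le_pow_right two_pos (by omega)
    exact_mod_cast h
  have h2 : T ^ 4 ≤ T ^ (4 * n) := pow_le_pow_right₀ hT (by omega)
  rw [mul_pow]
  gcongr

lemma nSamples_pos {b : Params} (hξ : 0 < b.ξ) {n T : ℕ} (hn : 0 < n) (hT : 1 ≤ T) :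
    0 < nSamples b n T := by
  have : (1 : ℝ) ≤ T := by exact_mod_cast hT
  have := Real.log_pos (show (1 : ℝ) < 2 * T by linarith)
  unfold nSamples
  positivity

lemma one_le_union_size {n N E T : ℕ} (hn : 1 ≤ n) (hN : 1 ≤ N) (hE : 1 ≤ E) (hT : 1 ≤ T) :
    (1 : ℝ) ≤ n * N * T * √E := by
  have h1 : (1 : ℝ) ≤ n := by exact_mod_cast hn
  have h2 : (1 : ℝ) ≤ N := by exact_mod_cast hN
  have h3 : (1 : ℝ) ≤ T := by exact_mod_cast hT
  have h4 : (1 : ℝ) ≤ √E := Real.one_le_sqrt.2 (by exact_mod_cast hE)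
  exact one_le_mul_of_one_le_of_one_le (one_le_mul_of_one_le_of_one_le
    (one_le_mul_of_one_le_of_one_le h1 h2) h3) h4

end Sizes

section Total

variable {X V : Type*} [Fintype X] [Fintype V] [DecidableEq X] [DecidableEq V] {N E : ℕ}
  {b : Params} {I : Bandit X V N E} {T : ℕ} {Ω : Type*} {mΩ : MeasurableSpace Ω}
  {P : Measure Ω} {F : Filtration ℕ mΩ} {k : ℕ → Ω → Fin N} {x : ℕ → Ω → X} {v : ℕ → Ω → V}
  {y : ℕ → Ω → ℝ}

variable [IsProbabilityMeasure P]
  (hr : IsOnlineRun b I T (A b (Fintype.card X) (Fintype.card V) N E T) P F k x v y)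
include hr

/-- The contribution of inaccurate empirical policies to the regret. -/
lemma mul_measure_not_accurate_le (hb : b.Admissible) (hI : I.Bounded b)
    (hV : 1 ≤ Fintype.card V) (hX1 : 1 ≤ Fintype.card X) (hN1 : 1 ≤ N) (hE : 1 ≤ E) (hT : 1 ≤ T)
    (hNA : N * A b (Fintype.card X) (Fintype.card V) N E T ≤ E * T)
    (hN : (N : ℝ) ≤ (T : ℝ) ^ 2) (hX : (Fintype.card X : ℝ) ≤ T) :
    E * T * P.real {ω | ¬ Accurate b I.pol
      (empirical (N * A b (Fintype.card X) (Fintype.card V) N E T)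
        (fun s => k s ω) (fun s => x s ω) (fun s => v s ω))} ≤ √E + E := by
  set m := A b (Fintype.card X) (Fintype.card V) N E T with hm
  set n := nSamples b (Fintype.card V) T with hn
  set L := Real.log (Fintype.card X * N * T * √E) with hL
  have hpX := hb.pX_pos
  have hn0 : 0 < n := nSamples_pos hb.ξ_pos hV hT
  have hsize := one_le_union_size hX1 hN1 hE hT
  have hL0 : 0 ≤ L := Real.log_nonneg hsize
  have hmA : 2 * n / b.pX + L / (2 * b.pX ^ 2) ≤ m := Nat.le_ceil _
  have hm0R : (0 : ℝ) < m := lt_of_lt_of_le (by positivity) hmA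
  have hm0 : 0 < m := by exact_mod_cast hm0R
  have hmp : 2 * n + L / (2 * b.pX) ≤ m * b.pX := by
    calc 2 * n + L / (2 * b.pX) = (2 * n / b.pX + L / (2 * b.pX ^ 2)) * b.pX := by
          field_simp
      _ ≤ _ := by gcongr
  have hLp : 0 ≤ L / (2 * b.pX) := by positivity
  have hmain := hr.measure_not_accurate_le hb hI hm0 hNA hn0 (by linarith)
  have hE0 : (0 : ℝ) < E := by exact_mod_cast hE
  have hT1 : (1 : ℝ) ≤ T := by exact_mod_cast hT
  have hN0 : (0 : ℝ) < N := by exact_mod_cast hN1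
  have hX0 : (0 : ℝ) < Fintype.card X := by exact_mod_cast hX1
  have hsE : 0 < √(E : ℝ) := Real.sqrt_pos.2 hE0
  have h1 : Real.exp (-(2 * (m * b.pX - n) ^ 2 / m)) ≤ (Fintype.card X * N * T * √E)⁻¹ := by
    rw [← Real.exp_log (show 0 < (Fintype.card X : ℝ) * N * T * √E by positivity), ← Real.exp_neg]
    refine Real.exp_le_exp.2 (neg_le_neg ?_)
    rw [le_div_iff₀ hm0R]
    have e1 : L ≤ 2 * b.pX * (m * b.pX - 2 * n) := by
      have : L / (2 * b.pX) ≤ m * b.pX - 2 * n := by linarith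
      rw [div_le_iff₀ (by positivity)] at this
      linarith
    have e2 := mul_le_mul_of_nonneg_right e1 hm0R.le
    nlinarith [sq_nonneg n]
  have h2 : Real.exp (-(2 * b.ξ ^ 2 * n)) = ((2 * T : ℝ) ^ (4 * Fintype.card V))⁻¹ := by
    have hξ := hb.ξ_pos
    rw [Real.exp_neg, ← Real.exp_log (show (0 : ℝ) < 2 * T by linarith), ← Real.exp_nat_mul]
    congr 2
    rw [hn, nSamples]
    push_cast
    field_simp
    ring
  rw [h2] at hmain
  have h3 := two_mul_card_mul_pow_le hT1 hV
  set W := (2 * T : ℝ) ^ (4 * Fintype.card V) with hW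
  have hW0 : 0 < W := by positivity
  have h4 : N * Fintype.card X * T * (Fintype.card V * 2) * W⁻¹ ≤ 1 := by
    rw [← div_eq_mul_inv, div_le_one hW0]
    refine le_trans ?_ h3
    calc (N : ℝ) * Fintype.card X * T * (Fintype.card V * 2)
        ≤ (T : ℝ) ^ 2 * T * T * (Fintype.card V * 2) := by gcongr
      _ = _ := by ring
  calc _ ≤ E * T * (N * Fintype.card X * ((Fintype.card X * N * T * √E)⁻¹
        + Fintype.card V * (2 * W⁻¹))) := by
        refine mul_le_mul_of_nonneg_left (hmain.trans ?_) (by positivity)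
        gcongr
    _ = E / √E + E * (N * Fintype.card X * T * (Fintype.card V * 2) * W⁻¹) := by
        field_simp
    _ ≤ √E + E * 1 := by
        rw [Real.div_sqrt]
        gcongr
    _ = _ := by rw [mul_one]

/-- The regret bound for at least two experts. -/
theorem integral_regret_le_of_two_le (hpX : 0 < b.pX) (hpV : 0 < b.pV) (hγ : 0 < b.γ)
    (hM₁ : 1 + Real.log (1 + f₁ ((1 - b.pV) / b.pV)) ≤ b.M)
    (hM₂ : (1 - b.pX) * Fintype.card X * Fintype.card V * f₁ ((1 - b.pV) / b.pV) ≤ b.M)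
    (hN : 2 ≤ N) (hE : 1 ≤ E) (hT : 1 ≤ T) (hI : I.Bounded b) (hsep : Separated b I)
    (htime : ∀ e i, 0 < I.gap e i → time b I (I.gap e i) ≤ T) :
    ∫ ω, regret I T k ω ∂P ≤ (A b (Fintype.card X) (Fintype.card V) N E T : ℝ) * N
      + (√E + E + ∑ e, regretConst b I e) := by
  obtain ⟨hb, hπ⟩ := admissible_and_policyBounds hI hsep hE hpX hpV hγ hM₁ hN
  have hV := one_lt_card_act hsep hE (mul_pos hγ hpV) hN
  have hX := nonempty_ctx (I := I) hE
  have hg := hb.γ_mul_pV_pos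
  set m := A b (Fintype.card X) (Fintype.card V) N E T with hm
  have hC0 : ∀ e, 0 ≤ regretConst b I e := fun e => regretConst_nonneg (by omega) hsep e
  have hCs : 0 ≤ ∑ e, regretConst b I e := Finset.sum_nonneg fun e _ => hC0 e
  have hE0 : (0 : ℝ) ≤ E := Nat.cast_nonneg _
  have hs0 := Real.sqrt_nonneg (E : ℝ)
  have hm0 : (0 : ℝ) ≤ m * N := by positivity
  have hcard := hr.integral_regret_le_card
  by_cases hNA : N * m ≤ E * T
  swap
  · have : (E : ℝ) * T ≤ m * N := by
      rw [mul_comm (m : ℝ)]; exact_mod_cast (not_le.1 hNA).le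
    linarith
  by_cases hNT : 3 * (((N : ℝ) - 1) * (b.γ * b.pV)) < T
  · have : Nontrivial (Fin N) := Fin.nontrivial_iff_two_le.2 hN
    obtain ⟨i₀, h0, hi₀⟩ := hsep ⟨0, hE⟩
    obtain ⟨i, hi⟩ := exists_ne i₀
    have hgap := hi₀ i hi
    have hTle : 6 * b.C ^ 2 * b.M ^ 2 ≤ T := by
      refine (le_tau hb hgap (gap_le_one _ _ _)).trans ?_
      exact_mod_cast (le_max_right _ _).trans (htime _ i (hg.trans hgap))
    have hXT : (Fintype.card X : ℝ) ≤ T := by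
      refine (card_ctx_le hb hπ hV hM₂ hgap).trans (le_trans ?_ hTle)
      have h1 : 1 ≤ b.C * b.M := by nlinarith [hb.C_ge, hb.one_le_M]
      nlinarith
    have h1 := mul_measure_not_accurate_le hr hb hI hV.le (Fintype.card_pos) (by omega) hE hT hNA
      (card_experts_le hb hTle hNT) hXT
    have h2 := hr.integral_regret_le hb hπ hsep hN
    linarith
  · have h1 : ∀ e, (T : ℝ) ≤ regretConst b I e := by
      intro e
      refine (not_lt.1 hNT).trans ?_
      have hsum : ((N : ℝ) - 1) * (b.γ * b.pV) ≤ ∑ i, I.gap e i := by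
        rw [← sum_sortedGap hsep e]
        calc ((N : ℝ) - 1) * (b.γ * b.pV) = ∑ _k ∈ Finset.Icc 2 N, b.γ * b.pV := by
              rw [Finset.sum_const, Nat.card_Icc, nsmul_eq_mul,
                show N + 1 - 2 = N - 1 by omega, Nat.cast_sub (by omega), Nat.cast_one]
          _ ≤ _ := Finset.sum_le_sum fun l hl =>
              (lt_sortedGap hg hsep e (Finset.mem_Icc.1 hl).1 (Finset.mem_Icc.1 hl).2).le
      rw [regretConst_eq hN hsep]
      have h2 := Finset.sum_nonneg fun l hl => mul_nonneg
        (Nat.cast_nonneg (α := ℝ) (time b I (sortedGap I e l)))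
        (sortedGap_sub_nonneg (I := I) e hl)
      have h3 : 3 ≤ Real.pi ^ 2 / 3 := by nlinarith [Real.pi_gt_three]
      have h4 : 0 ≤ ∑ i, I.gap e i := Finset.sum_nonneg fun i _ => gap_nonneg I e i
      nlinarith
    have h2 : (E : ℝ) * T ≤ ∑ e, regretConst b I e := by
      calc (E : ℝ) * T = ∑ _e : Fin E, (T : ℝ) := by simp
        _ ≤ _ := Finset.sum_le_sum fun e _ => h1 e
    linarith

end Total

section Order

variable {X V : Type*} [Fintype X] [Fintype V] {N E : ℕ} {b : Params} {I : Bandit X V N E}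

lemma regret_eq_zero {T : ℕ} {I : Bandit X V 1 E} {Ω : Type*} [MeasurableSpace Ω]
    (k : ℕ → Ω → Fin 1) (ω : Ω) : regret I T k ω = 0 := by
  refine Finset.sum_eq_zero fun e _ => Finset.sum_eq_zero fun t _ => ?_
  have := gap_eq_of_best (I := I) (e := e) (i₀ := 0)
    (fun i hi => absurd (Subsingleton.elim i 0) hi) (k (e * T + t) ω)
  unfold Bandit.gap at this
  rw [this, Subsingleton.elim (k (e * T + t) ω) 0, sub_self]

/-- A bound for the regret constant when all times are bounded. -/
lemma regretConst_le (hN : 2 ≤ N) (hsep : Separated b I) (e : Fin E) {τ : ℕ}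
    (hτ : ∀ k, 2 ≤ k → k ≤ N → time b I (sortedGap I e k) ≤ τ) :
    regretConst b I e ≤ (4 + τ) * (N + 1) := by
  rw [regretConst_eq hN hsep]
  have h1 : ∑ i, I.gap e i ≤ N := by
    calc ∑ i, I.gap e i ≤ ∑ _i : Fin N, (1 : ℝ) := Finset.sum_le_sum fun i _ => gap_le_one I e i
      _ = N := by simp
  have h2 : ∑ k ∈ Finset.Icc 2 N, (time b I (sortedGap I e k) : ℝ) *
      (sortedGap I e k - sortedGap I e (k - 1)) ≤ τ := by
    calc _ ≤ ∑ k ∈ Finset.Icc 2 N, (τ : ℝ) * (sortedGap I e k - sortedGap I e (k - 1)) := by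
          refine Finset.sum_le_sum fun k hk => ?_
          have hk' := Finset.mem_Icc.1 hk
          exact mul_le_mul_of_nonneg_right (by exact_mod_cast hτ k hk'.1 hk'.2)
            (sortedGap_sub_nonneg e hk)
      _ = τ * sortedGap I e N := by
          rw [← Finset.mul_sum, telescope _ (by omega), sortedGap_one hsep e, sub_zero]
      _ ≤ τ := mul_le_of_le_one_right (Nat.cast_nonneg _) (sortedGap_le_one e N)
  have h3 : Real.pi ^ 2 / 3 ≤ 4 := by nlinarith [Real.pi_lt_d2, Real.pi_gt_three]
  have h4 : Real.pi ^ 2 / 3 * ∑ i, I.gap e i ≤ 4 * N :=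
    mul_le_mul h3 h1 (Finset.sum_nonneg fun i _ => gap_nonneg I e i) (by norm_num)
  have h5 : (0 : ℝ) ≤ τ * N := by positivity
  linarith

/-- The number of samples per expert is logarithmic. -/
lemma A_le {b : Params} (hpX : 0 < b.pX) (hξ : 0 < b.ξ) {cX cV N E T : ℕ} (hX : 1 ≤ cX)
    (hN : 2 ≤ N) (hE : 1 ≤ E) (hT : 1 ≤ T) :
    (A b cX cV N E T : ℝ) ≤ (4 * cV / (b.ξ ^ 2 * b.pX) + (1 + 2 * Real.log cX) / (2 * b.pX ^ 2) + 2)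
      * Real.log (N * (T : ℝ) ^ 2 * √E) := by
  have hN2 : (2 : ℝ) ≤ N := by exact_mod_cast hN
  have hT1 : (1 : ℝ) ≤ T := by exact_mod_cast hT
  have hX1 : (1 : ℝ) ≤ cX := by exact_mod_cast hX
  have hE1 : (1 : ℝ) ≤ √E := Real.one_le_sqrt.2 (by exact_mod_cast hE)
  have hTT : (T : ℝ) ≤ (T : ℝ) ^ 2 := by nlinarith
  set Λ := Real.log (N * (T : ℝ) ^ 2 * √E) with hΛ
  have h1 : Real.log (2 * T) ≤ Λ := by
    refine Real.log_le_log (by linarith) ?_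
    calc (2 : ℝ) * T = 2 * T * 1 := (mul_one _).symm
      _ ≤ N * (T : ℝ) ^ 2 * √E := by gcongr
  have h2 : Real.log (cX * N * T * √E) ≤ Real.log cX + Λ := by
    rw [hΛ, ← Real.log_mul (by positivity) (by positivity)]
    refine Real.log_le_log (by positivity) ?_
    calc (cX : ℝ) * N * T * √E = cX * (N * T * √E) := by ring
      _ ≤ cX * (N * (T : ℝ) ^ 2 * √E) := by gcongr
  have h3 : 1 / 2 ≤ Λ := by
    have : Real.log 2 ≤ Real.log (2 * T) := Real.log_le_log two_pos (by linarith)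
    linarith [Real.log_two_gt_d9]
  have hlX : 0 ≤ Real.log cX := Real.log_nonneg hX1
  have hlT : 0 ≤ Real.log (2 * T) := Real.log_nonneg (by linarith)
  have hlL : 0 ≤ Real.log (cX * N * T * √E) :=
    Real.log_nonneg (one_le_union_size hX (by omega) hE hT)
  have hceil := (Nat.ceil_lt_add_one (a := 2 * nSamples b cV T / b.pX
    + Real.log (cX * N * T * √E) / (2 * b.pX ^ 2)) (by unfold nSamples; positivity)).le
  refine hceil.trans ?_
  have e1 : 2 * nSamples b cV T / b.pX = 4 * cV / (b.ξ ^ 2 * b.pX) * Real.log (2 * T) := by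
    unfold nSamples; field_simp; ring
  have e2 : 4 * cV / (b.ξ ^ 2 * b.pX) * Real.log (2 * T) ≤ 4 * cV / (b.ξ ^ 2 * b.pX) * Λ := by
    gcongr
  have e3 : Real.log (cX * N * T * √E) / (2 * b.pX ^ 2)
      ≤ (1 + 2 * Real.log cX) / (2 * b.pX ^ 2) * Λ := by
    rw [div_mul_eq_mul_div]
    gcongr
    nlinarith
  rw [e1]
  linarith

end Order

end EDUCB

theorem theorem4 {X : Type u₁} {V : Type u₂} [Fintype X] [Fintype V]
    [DecidableEq X] [DecidableEq V] (b : EDUCB.Params)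
    (hpX : 0 < b.pX) (hpV : 0 < b.pV) (hγ : 0 < b.γ)
    -- `M` is an upper bound on all the divergences `M_{ij}`
    (hM₁ : 1 + Real.log (1 + EDUCB.f₁ ((1 - b.pV) / b.pV)) ≤ b.M)
    (hM₂ : (1 - b.pX) * Fintype.card X * Fintype.card V * EDUCB.f₁ ((1 - b.pV) / b.pV) ≤ b.M) :
    -- the explicit bound: that of the bootstrapped agent plus `A N`
    (∀ (N E T : ℕ), 1 ≤ N → 1 ≤ E → 1 ≤ T →
      ∀ I : EDUCB.Bandit X V N E, I.Bounded b →
      (∀ e, ∃ i₀, ∀ i, i ≠ i₀ → I.mean e i + b.γ * b.pV < I.mean e i₀) →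
      (∀ e i, 0 < I.gap e i → EDUCB.time b I (I.gap e i) ≤ T) →
      ∀ (Ω : Type u₃) [mΩ : MeasurableSpace Ω] (P : Measure Ω) [IsProbabilityMeasure P]
        (F : Filtration ℕ mΩ) (k : ℕ → Ω → Fin N) (x : ℕ → Ω → X) (v : ℕ → Ω → V)
        (y : ℕ → Ω → ℝ),
      EDUCB.IsOnlineRun b I T (EDUCB.A b (Fintype.card X) (Fintype.card V) N E T) P F k x v y →
      ∫ ω, EDUCB.regret I T k ω ∂P ≤
        (EDUCB.A b (Fintype.card X) (Fintype.card V) N E T : ℝ) * N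
          + (√E + E + (∑ e, EDUCB.regretConst b I e) * (1 + 1 / ((T : ℝ) ^ 2 * √E)))) ∧
    -- the order of the total regret; the constant depends on `X`, `V`, `b` and a lower bound
    -- `g` on the excess `Δ_{2,e} - γ p_V` of the gaps only
    (∀ g : ℝ, 0 < g → ∃ K : ℝ, ∀ (N E T : ℕ), 1 ≤ N → 1 ≤ E → 1 ≤ T →
      ∀ I : EDUCB.Bandit X V N E, I.Bounded b →
      (∀ e, ∃ i₀, ∀ i, i ≠ i₀ → I.mean e i + b.γ * b.pV + g ≤ I.mean e i₀) →
      (∀ e i, 0 < I.gap e i → EDUCB.time b I (I.gap e i) ≤ T) →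
      ∀ (Ω : Type u₃) [mΩ : MeasurableSpace Ω] (P : Measure Ω) [IsProbabilityMeasure P]
        (F : Filtration ℕ mΩ) (k : ℕ → Ω → Fin N) (x : ℕ → Ω → X) (v : ℕ → Ω → V)
        (y : ℕ → Ω → ℝ),
      EDUCB.IsOnlineRun b I T (EDUCB.A b (Fintype.card X) (Fintype.card V) N E T) P F k x v y →
      ∫ ω, EDUCB.regret I T k ω ∂P ≤
        K * (N * Real.log (N * (T : ℝ) ^ 2 * √E) + E * (N + 1) + N * √E / (T : ℝ) ^ 2)) := by
  refine ⟨?_, ?_⟩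
  · intro N E T hN hE hT I hI hbest htime Ω mΩ P _ F k x v y hr
    have hsep : EDUCB.Separated b I := EDUCB.separated_of_best hγ hpV hbest
    have hCs : 0 ≤ ∑ e, EDUCB.regretConst b I e :=
      Finset.sum_nonneg fun e _ => EDUCB.regretConst_nonneg hN hsep e
    have hextra : 0 ≤ (∑ e, EDUCB.regretConst b I e) * (1 / ((T : ℝ) ^ 2 * √E)) :=
      mul_nonneg hCs (by positivity)
    have hsE := Real.sqrt_nonneg (E : ℝ)
    have hE0 : (0 : ℝ) ≤ E := Nat.cast_nonneg _
    rcases hN.lt_or_eq with hN2 | rfl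
    · have := EDUCB.integral_regret_le_of_two_le hr hpX hpV hγ hM₁ hM₂ hN2 hE hT hI hsep htime
      linarith
    · simp only [EDUCB.regret_eq_zero, integral_zero]
      have hA0 : (0 : ℝ) ≤ EDUCB.A b (Fintype.card X) (Fintype.card V) 1 E T * (1 : ℕ) := by
        positivity
      linarith
  · intro g hg
    by_cases hb : b.Admissible
    swap
    · refine ⟨0, fun N E T hN hE hT I hI hbest htime Ω mΩ P _ F k x v y hr => ?_⟩
      have hsep : EDUCB.Separated b I := EDUCB.separated_of_best hγ hpV fun e => by
        obtain ⟨i₀, h⟩ := hbest e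
        exact ⟨i₀, fun i hi => by linarith [h i hi]⟩
      rcases hN.lt_or_eq with hN2 | rfl
      · exact absurd (EDUCB.admissible_and_policyBounds hI hsep hE hpX hpV hγ hM₁ hN2).1 hb
      · simp only [EDUCB.regret_eq_zero, integral_zero, zero_mul, le_refl]
    obtain ⟨t₀, ht₀⟩ := EDUCB.exists_unclipped_time hb
    set τ : ℕ := max (max t₀ (EDUCB.tau₁ b)) (EDUCB.tau b (b.γ * b.pV + g)) with hτ
    set KA : ℝ := 4 * Fintype.card V / (b.ξ ^ 2 * b.pX)
      + (1 + 2 * Real.log (Fintype.card X)) / (2 * b.pX ^ 2) + 2 with hKA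
    have hKA0 : 0 ≤ KA := by
      have := hb.ξ_pos
      have := Real.log_natCast_nonneg (Fintype.card X)
      positivity
    refine ⟨KA + 2 + 2 * (4 + τ), fun N E T hN hE hT I hI hbest htime Ω mΩ P _ F k x v y hr => ?_⟩
    have hN1 : (1 : ℝ) ≤ N := by exact_mod_cast hN
    have hT1 : (1 : ℝ) ≤ T := by exact_mod_cast hT
    have hE1 : (1 : ℝ) ≤ E := by exact_mod_cast hE
    have hsE : 1 ≤ √(E : ℝ) := Real.one_le_sqrt.2 hE1
    have hsE2 : √(E : ℝ) ≤ E := Real.sqrt_le_iff.2 ⟨by linarith, by nlinarith⟩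
    have hΛ : 0 ≤ Real.log (N * (T : ℝ) ^ 2 * √E) := Real.log_nonneg
      (one_le_mul_of_one_le_of_one_le (one_le_mul_of_one_le_of_one_le hN1 (one_le_pow₀ hT1)) hsE)
    rcases hN.lt_or_eq with hN2 | rfl
    swap
    · simp only [EDUCB.regret_eq_zero, integral_zero]
      positivity
    have hgp := hb.γ_mul_pV_pos
    have hgap : ∀ e, ∃ i₀, I.gap e i₀ = 0 ∧ ∀ i, i ≠ i₀ → b.γ * b.pV + g ≤ I.gap e i := fun e => by
      obtain ⟨i₀, h⟩ := hbest e
      have h' := EDUCB.gap_eq_of_best (I := I) (e := e) (i₀ := i₀) fun i hi => by linarith [h i hi]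
      exact ⟨i₀, by rw [h', sub_self], fun i hi => by rw [h']; linarith [h i hi]⟩
    have hsep : EDUCB.Separated b I := fun e => by
      obtain ⟨i₀, h0, h⟩ := hgap e
      exact ⟨i₀, h0, fun i hi => by linarith [h i hi]⟩
    have hπ := (EDUCB.admissible_and_policyBounds hI hsep hE hpX hpV hγ hM₁ hN2).2
    have hX : Nonempty X := EDUCB.nonempty_ctx (I := I) hE
    have hclip : EDUCB.tClip b I.pol ≤ t₀ := Nat.sInf_le (ht₀ I.pol hπ)
    have hconst : ∀ e, EDUCB.regretConst b I e ≤ (4 + τ) * (N + 1) := fun e => by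
      refine EDUCB.regretConst_le hN2 hsep e fun l hl hlN => ?_
      have hlt := EDUCB.lt_sortedGap hgp hsep e hl hlN
      have hle : b.γ * b.pV + g ≤ EDUCB.sortedGap I e l := by
        obtain ⟨i₀, h0, h⟩ := hgap e
        rw [EDUCB.sortedGap_eq e (show l - 1 < N by omega)] at hlt ⊢
        refine h _ fun hc => ?_
        rw [hc, h0] at hlt
        linarith
      exact max_le_max (max_le_max hclip le_rfl)
        (EDUCB.tau_anti hb (by linarith) hle (EDUCB.sortedGap_le_one e l))
    have hmain := EDUCB.integral_regret_le_of_two_le hr hpX hpV hγ hM₁ hM₂ hN2 hE hT hI hsep htime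
    have hA := EDUCB.A_le (cX := Fintype.card X) (cV := Fintype.card V) hpX hb.ξ_pos
      Fintype.card_pos hN2 hE hT
    have hsum : ∑ e, EDUCB.regretConst b I e ≤ E * ((4 + τ) * (N + 1)) := by
      calc _ ≤ ∑ _e : Fin E, (4 + τ : ℝ) * (N + 1) := Finset.sum_le_sum fun e _ => hconst e
        _ = _ := by simp
    have hAN := mul_le_mul_of_nonneg_right hA (show (0 : ℝ) ≤ N by linarith)
    rw [← hKA] at hAN
    set Λ := Real.log (N * (T : ℝ) ^ 2 * √E)
    have h1 : (0 : ℝ) ≤ N * √E / (T : ℝ) ^ 2 := by positivity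
    have h2 : (0 : ℝ) ≤ τ := Nat.cast_nonneg _
    have h3 : 0 ≤ N * Λ := by positivity
    have h4 : (E : ℝ) ≤ E * (N + 1) := by nlinarith
    have h5 : (KA + 2 + 2 * (4 + τ)) * (N * Λ + E * (N + 1) + N * √E / (T : ℝ) ^ 2)
        = KA * (N * Λ) + (2 + 2 * (4 + τ)) * (N * Λ) + (KA + (4 + τ)) * (E * (N + 1))
          + 2 * (E * (N + 1)) + E * ((4 + τ) * (N + 1))
          + (KA + 2 + 2 * (4 + τ)) * (N * √E / (T : ℝ) ^ 2) := by ring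
    rw [h5]
    have h6 : 0 ≤ (2 + 2 * (4 + (τ : ℝ))) * (N * Λ) := by positivity
    have h7 : 0 ≤ (KA + (4 + (τ : ℝ))) * (E * (N + 1)) := by positivity
    have h8 : 0 ≤ (KA + 2 + 2 * (4 + (τ : ℝ))) * (N * √E / (T : ℝ) ^ 2) := by positivity
    linarith
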